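/- All graphs are finite, simple, undirected and have at least one vertex; $G[S]$ denotes the subgraph of $G=(V,E)$ induced by $S\subseteq V$. A set $S\subseteq V$ is a \emph{2-club} if $G[S]$ has diameter at most two. For an integer $t\ge 0$, a set $S\subseteq V$ is - a \emph{$t$-robust 2-club} if any two distinct vertices of $S$ are connected in $G[S]$ by $t$ pairwise distinct, internally vertex-disjoint paths of length at most two; - a \emph{$t$-hereditary 2-club} if $S\setminus U$ is a 2-club for all $U\subset S$ with $|U|\le t$; - a \emph{$t$-connected 2-club} if $S$ is a 2-club, $|S|>t$, and $G[S\setminus U]$ is connected for all $U\subseteq S$ with $|U|<t$. In the problem \textsc{$t$-Robust 2-Club} (respectively \textsc{$t$-Hereditary 2-Club}, \textsc{$t$-Connected 2-Club}) the input consists of a graph $G$ and nonnegative integers $t$ and $k$, and the question is whether $G$ contains a $t$-robust (respectively $t$-hereditary, $t$-connected) 2-club of size at least $k$. \textbf{Corollary.} Each of the problems \textsc{$t$-Robust 2-Club}, \textsc{$t$-Hereditary 2-Club} and \textsc{$t$-Connected 2-Club} can be solved in $O(1.62^{\Delta^2}\cdot n)$ time, where $n$ is the number of vertices and $\Delta$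 the maximum degree of the input graph. That is, for each of them there is a single random access machine program, with unit cost per operation and machine words of $O(\log(n+t+k+2))$ bits, and a constant $C$ independent of $G$, $t$ and $k$, such that the program, given $G$ by adjacency lists together with $t$ and $k$, answers the question correctly after at most $C\cdot 1.62^{\Delta^2}\cdot n$ steps. -/

import Mathlib

/-! ### Well-connected 2-clubs -/

/-- `S` is a 2-club: the induced subgraph `G[S]` has diameter at most two. -/
def IsTwoClub {V : Type*} (G : SimpleGraph V) (S : Set V) : Prop :=
  (G.induce S).ediam ≤ 2

/-- `S` is a `t`-robust 2-club: any two distinct vertices of `S` are joined in `G[S]` by `t`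
(pairwise distinct) internally vertex-disjoint paths of length at most two. -/
def IsRobustTwoClub {V : Type*} (G : SimpleGraph V) (t : ℕ) (S : Finset V) : Prop :=
  ∀ u v : (S : Set V), u ≠ v →
    ∃ P : Fin t → (G.induce (S : Set V)).Path u v,
      Function.Injective P ∧
      (∀ i, (P i : (G.induce (S : Set V)).Walk u v).length ≤ 2) ∧
      ∀ i j, i ≠ j → ∀ x,
        x ∈ (P i : (G.induce (S : Set V)).Walk u v).support →
        x ∈ (P j : (G.induce (S : Set V)).Walk u v).support → x = u ∨ x = v

/-- `S` is a `t`-hereditary 2-club: `S \ U` is a 2-club for all `U ⊂ S` with `|U| ≤ t`. -/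
def IsHereditaryTwoClub {V : Type*} (G : SimpleGraph V) (t : ℕ) (S : Finset V) : Prop :=
  ∀ U : Finset V, U ⊂ S → U.card ≤ t → IsTwoClub G ((S : Set V) \ (U : Set V))

/-- `S` is a `t`-connected 2-club: `S` is a 2-club, `|S| > t`, and `G[S \ U]` is connected for all
`U ⊆ S` with `|U| < t`. -/
def IsConnectedTwoClub {V : Type*} (G : SimpleGraph V) (t : ℕ) (S : Finset V) : Prop :=
  IsTwoClub G (S : Set V) ∧ t < S.card ∧
    ∀ U : Finset V, U ⊆ S → U.card < t →
      (G.induce ((S : Set V) \ (U : Set V))).Connected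

/-! ### Random access machine

Programs of a random access machine in structured form. The memory consists of registers
`reg 0, reg 1, …` and of arrays `arr 0, arr 1, …` with random access; a program mentions only
finitely many registers and arrays. Every arithmetic operation, comparison, register access, array
access and control step costs one time unit. -/

namespace RAM

/-- Memory contents. -/
structure State where
  reg : ℕ → ℕ
  arr : ℕ → ℕ → ℕ

/-- Elementary operations; subtraction is truncated, division rounds down (and gives `0` for the
divisor `0`), comparisons return `1` for true and `0` for false. -/
inductive Op
  | add | sub | mul | div | lt | eq

/-- The value of an elementary operation. -/
def Op.eval : Op → ℕ → ℕ → ℕ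
  | add, a, b => a + b
  | sub, a, b => a - b
  | mul, a, b => a * b
  | div, a, b => a / b
  | lt, a, b => if a < b then 1 else 0
  | eq, a, b => if a = b then 1 else 0

/-- Expressions: constants, registers, array cells `arr a [e]`, and elementary operations. -/
inductive Expr
  | const (c : ℕ)
  | reg (x : ℕ)
  | arr (a : ℕ) (e : Expr)
  | op (o : Op) (e₁ e₂ : Expr)

/-- The value of an expression. -/
def Expr.eval (s : State) : Expr → ℕ
  | const c => c
  | reg x => s.reg x
  | arr a e => s.arr a (e.eval s)
  | op o e₁ e₂ => o.eval (e₁.eval s) (e₂.eval s)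

/-- The number of time units for evaluating an expression: one for each of its nodes. -/
def Expr.cost : Expr → ℕ
  | const _ => 1
  | reg _ => 1
  | arr _ e => e.cost + 1
  | op _ e₁ e₂ => e₁.cost + e₂.cost + 1

/-- Programs. A condition counts as true if its value is not `0`. -/
inductive Prog
  | skip
  | assign (x : ℕ) (e : Expr)
  | store (a : ℕ) (i e : Expr)
  | seq (p q : Prog)
  | cond (b : Expr) (p q : Prog)
  | loop (b : Expr) (p : Prog)

/-- `reg x := v`. -/
def State.setReg (s : State) (x v : ℕ) : State :=
  { s with reg := Function.update s.reg x v }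

/-- `arr a [i] := v`. -/
def State.setArr (s : State) (a i v : ℕ) : State :=
  { s with arr := Function.update s.arr a (Function.update (s.arr a) i v) }

/-- `Exec B p s T s'`: started in `s`, the program `p` halts after `T` time units in `s'`, and every
number that it writes into a register or an array cell is at most `B` (the largest number that fits
into a machine word). -/
inductive Exec (B : ℕ) : Prog → State → ℕ → State → Prop
  | skip (s : State) : Exec B .skip s 1 s
  | assign (s : State) (x : ℕ) (e : Expr) (h : e.eval s ≤ B) :
      Exec B (.assign x e) s (e.cost + 1) (s.setReg x (e.eval s))
  | store (s : State) (a : ℕ) (i e : Expr) (h : e.eval s ≤ B) :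
      Exec B (.store a i e) s (i.cost + e.cost + 1) (s.setArr a (i.eval s) (e.eval s))
  | seq {p q : Prog} {s s₁ s₂ : State} {T₁ T₂ : ℕ}
      (h₁ : Exec B p s T₁ s₁) (h₂ : Exec B q s₁ T₂ s₂) :
      Exec B (.seq p q) s (T₁ + T₂) s₂
  | cond_true {b : Expr} {p q : Prog} {s s' : State} {T : ℕ}
      (hb : b.eval s ≠ 0) (h : Exec B p s T s') :
      Exec B (.cond b p q) s (b.cost + 1 + T) s'
  | cond_false {b : Expr} {p q : Prog} {s s' : State} {T : ℕ}
      (hb : b.eval s = 0) (h : Exec B q s T s') :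
      Exec B (.cond b p q) s (b.cost + 1 + T) s'
  | loop_true {b : Expr} {p : Prog} {s s₁ s₂ : State} {T₁ T₂ : ℕ}
      (hb : b.eval s ≠ 0) (h₁ : Exec B p s T₁ s₁) (h₂ : Exec B (.loop b p) s₁ T₂ s₂) :
      Exec B (.loop b p) s (b.cost + 1 + T₁ + T₂) s₂
  | loop_false {b : Expr} {p : Prog} {s : State}
      (hb : b.eval s = 0) :
      Exec B (.loop b p) s (b.cost + 1) s

end RAM

/-! ### Solving a problem on graphs within a time bound -/

/-- `adj` is an adjacency-list representation of `G`: `adj v` lists every neighbor of `v` exactly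
once, in any order. -/
def IsAdjacencyList {n : ℕ} (G : SimpleGraph (Fin n)) (adj : Fin n → List (Fin n)) : Prop :=
  ∀ v, (adj v).Nodup ∧ ∀ w, w ∈ adj v ↔ G.Adj v w

/-- The initial memory for a graph given by adjacency lists and numbers `t`, `k`: the registers
`1, 2, 3` hold `n, t, k`; array `1` is the concatenation of the adjacency lists of the vertices
`0, …, n - 1`; for `v ≤ n`, cell `v` of array `0` is the total length of the lists of the vertices
below `v`, so that the list of `v` occupies the cells of array `1` from `arr 0 [v]` up to, but not
including, `arr 0 [v + 1]`. All other registers and cells hold `0`. -/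
def inputState {n : ℕ} (adj : Fin n → List (Fin n)) (t k : ℕ) : RAM.State where
  reg x := if x = 1 then n else if x = 2 then t else if x = 3 then k else 0
  arr a i :=
    if a = 0 then
      if i ≤ n then (((List.finRange n).take i).map fun v => (adj v).length).sum else 0
    else if a = 1 then
      (((List.finRange n).flatMap adj).map Fin.val).getD i 0
    else 0

/-- The decision problem "given a graph `G` and numbers `t, k`, is there a set `S` of at least `k`
vertices with `Club G t S`?" can be solved within `O(f(G))` time: a single program decides it on
every graph with at least one vertex, given by adjacency lists, and for all `t` and `k`, in at most
`C * f(G)` time units, where `C` does not depend on the input, using machine words that hold numbers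
up to `(n + t + k + 2) ^ c`, that is, words of `O(log (n + t + k + 2))` bits. The answer (`1` for
yes, `0` for no) is found in register `0`. -/
def SolvableInTime
    (Club : ∀ n : ℕ, SimpleGraph (Fin n) → ℕ → Finset (Fin n) → Prop)
    (f : ∀ n : ℕ, SimpleGraph (Fin n) → ℝ) : Prop :=
  ∃ (p : RAM.Prog) (c : ℕ) (C : ℝ),
    ∀ (n : ℕ), 0 < n → ∀ (G : SimpleGraph (Fin n)) (adj : Fin n → List (Fin n)),
      IsAdjacencyList G adj → ∀ t k : ℕ,
        ∃ (T : ℕ) (s : RAM.State),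
          RAM.Exec ((n + t + k + 2) ^ c) p (inputState adj t k) T s ∧
          (T : ℝ) ≤ C * f n G ∧
          ((∃ S : Finset (Fin n), Club n G t S ∧ k ≤ S.card) → s.reg 0 = 1) ∧
          ((¬ ∃ S : Finset (Fin n), Club n G t S ∧ k ≤ S.card) → s.reg 0 = 0)

open Classical in
/-- The bound `1.62 ^ (Δ ^ 2) * n`, where `Δ` is the maximum degree of `G`. -/
noncomputable def maxDegreeBound (n : ℕ) (G : SimpleGraph (Fin n)) : ℝ :=
  (1.62 : ℝ) ^ (G.maxDegree ^ 2) * (n : ℝ)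

/-!
A set `S` is a solution of one of the three problems, up to its size, exactly if no two of its
vertices are in conflict within `S`, that is, if no two of them have too few common neighbors or
are separated by too few vertices of `S`. A conflict persists in every subset that contains both
vertices. Hence, if `u` and `w` are in conflict within the vertices that are still available, then
either `u` is deleted, or `u` is kept and `w` is deleted. The first branch decides one vertex and
the second one two, so that the search tree on `m` vertices has `O(φ ^ m)` nodes, where
`φ = 1.618…` is the golden ratio. Since `φ < 1.62`, the factor `1.62 ^ m` also pays for the
polynomial time spent at each node; vertex separators are found by augmenting a flow in the graph
in which every vertex is split into two. Finally, a conflict-free set has diameter at most two, so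
that it lies in the ball of radius two around each of its vertices. This ball has at most
`Δ ^ 2 + 1` vertices, and the search is carried out once for each of the `n` centers.
-/

/-! ### Programs with bounded loops -/

namespace RAM

instance (n : ℕ) : OfNat Expr n := ⟨.const n⟩
instance : Add Expr := ⟨.op .add⟩
instance : Sub Expr := ⟨.op .sub⟩
instance : Mul Expr := ⟨.op .mul⟩
instance : Div Expr := ⟨.op .div⟩

infixr:40 ";;" => Prog.seq
infix:45 "::=" => Prog.assign
infix:50 "<ₑ" => Expr.op Op.lt
infix:50 "=ₑ" => Expr.op Op.eq

section Simp

variable (s : State) (a b e : Expr) (x y i v : ℕ)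

@[simp] theorem Expr.eval_ofNat : (ofNat(x) : Expr).eval s = OfNat.ofNat x := rfl
@[simp] theorem Expr.eval_reg : (Expr.reg x).eval s = s.reg x := rfl
@[simp] theorem Expr.eval_arr : (Expr.arr x e).eval s = s.arr x (e.eval s) := rfl
@[simp] theorem Expr.eval_add : (a + b).eval s = a.eval s + b.eval s := rfl
@[simp] theorem Expr.eval_sub : (a - b).eval s = a.eval s - b.eval s := rfl
@[simp] theorem Expr.eval_mul : (a * b).eval s = a.eval s * b.eval s := rfl
@[simp] theorem Expr.eval_div : (a / b).eval s = a.eval s / b.eval s := rfl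
@[simp] theorem Expr.eval_lt : (a <ₑ b).eval s = if a.eval s < b.eval s then 1 else 0 := rfl
@[simp] theorem Expr.eval_eq : (a =ₑ b).eval s = if a.eval s = b.eval s then 1 else 0 := rfl

@[simp] theorem State.reg_setReg : (s.setReg x v).reg y = if y = x then v else s.reg y := by
  simp only [State.setReg, Function.update_apply]

@[simp] theorem State.arr_setReg : (s.setReg x v).arr = s.arr := rfl

@[simp] theorem State.reg_setArr : (s.setArr x i v).reg = s.reg := rfl

@[simp] theorem State.arr_setArr :
    (s.setArr x i v).arr y = if y = x then Function.update (s.arr x) i v else s.arr y := by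
  simp only [State.setArr, Function.update_apply]

end Simp

/-- The registers that a program may write to. -/
def Prog.regs : Prog → List ℕ
  | skip => []
  | assign x _ => [x]
  | store _ _ _ => []
  | seq p q => p.regs ++ q.regs
  | cond _ p q => p.regs ++ q.regs
  | loop _ p => p.regs

/-- The arrays that a program may write to. -/
def Prog.arrs : Prog → List ℕ
  | skip => []
  | assign _ _ => []
  | store a _ _ => [a]
  | seq p q => p.arrs ++ q.arrs
  | cond _ p q => p.arrs ++ q.arrs
  | loop _ p => p.arrs

/-- The running time of a program if every loop in it makes at most `M` rounds each time it is
entered. Both branches of a conditional are charged. -/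
def Prog.time (M : ℕ) : Prog → ℕ
  | skip => 1
  | assign _ e => e.cost + 1
  | store _ i e => i.cost + e.cost + 1
  | seq p q => p.time M + q.time M
  | cond b p q => b.cost + 1 + (p.time M + q.time M)
  | loop b p => M * (b.cost + 1 + p.time M) + (b.cost + 1)

theorem Prog.exists_time_le (p : Prog) : ∃ c a : ℕ, ∀ M, p.time M ≤ c * (M + 1) ^ a := by
  have add_const {f : ℕ → ℕ} (d : ℕ) (h : ∃ c a : ℕ, ∀ M, f M ≤ c * (M + 1) ^ a) :
      ∃ c a : ℕ, ∀ M, d + f M ≤ c * (M + 1) ^ a := by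
    obtain ⟨c, a, h⟩ := h
    refine ⟨d + c, a, fun M => ?_⟩
    have : d * 1 ≤ d * (M + 1) ^ a := Nat.mul_le_mul_left d (Nat.one_le_pow _ _ M.succ_pos)
    linarith [h M]
  have add {f g : ℕ → ℕ} (hf : ∃ c a : ℕ, ∀ M, f M ≤ c * (M + 1) ^ a)
      (hg : ∃ c a : ℕ, ∀ M, g M ≤ c * (M + 1) ^ a) :
      ∃ c a : ℕ, ∀ M, f M + g M ≤ c * (M + 1) ^ a := by
    obtain ⟨c, a, hf⟩ := hf
    obtain ⟨c', a', hg⟩ := hg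
    refine ⟨c + c', a + a', fun M => ?_⟩
    have hM : 1 ≤ M + 1 := M.succ_pos
    calc f M + g M ≤ c * (M + 1) ^ a + c' * (M + 1) ^ a' := Nat.add_le_add (hf M) (hg M)
      _ ≤ c * (M + 1) ^ (a + a') + c' * (M + 1) ^ (a + a') := by gcongr <;> omega
      _ = (c + c') * (M + 1) ^ (a + a') := by ring
  induction p with
  | skip => exact ⟨1, 0, by simp [time]⟩
  | assign x e => exact ⟨e.cost + 1, 0, by simp [time]⟩
  | store a i e => exact ⟨i.cost + e.cost + 1, 0, by simp [time]⟩
  | seq p q hp hq => exact add hp hq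
  | cond b p q hp hq => exact add_const _ (add hp hq)
  | loop b p hp =>
    obtain ⟨c, a, h⟩ := add_const (b.cost + 1) hp
    simp only [time, Nat.add_comm (_ * _)]
    refine add_const _ ⟨c, a + 1, fun M => ?_⟩
    calc M * (b.cost + 1 + p.time M) ≤ (M + 1) * (c * (M + 1) ^ a) :=
          Nat.mul_le_mul M.le_succ (h M)
      _ = c * (M + 1) ^ (a + 1) := by ring

/-- The two states agree outside of the listed registers and arrays. -/
def Agree (R A : List ℕ) (s s' : State) : Prop :=
  (∀ x ∉ R, s'.reg x = s.reg x) ∧ ∀ a ∉ A, s'.arr a = s.arr a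

section Agree

variable {R A R' A' : List ℕ} {s s₁ s₂ : State}

theorem Agree.reg (h : Agree R A s s₁) (x : ℕ) (hx : x ∉ R := by decide) :
    s₁.reg x = s.reg x := h.1 x hx

theorem Agree.arr (h : Agree R A s s₁) (a : ℕ) (ha : a ∉ A := by decide) :
    s₁.arr a = s.arr a := h.2 a ha

theorem Agree.refl (R A : List ℕ) (s : State) : Agree R A s s :=
  ⟨fun _ _ => rfl, fun _ _ => rfl⟩

theorem Agree.trans (h : Agree R A s s₁) (h' : Agree R A s₁ s₂) : Agree R A s s₂ :=
  ⟨fun x hx => (h'.reg x hx).trans (h.reg x hx), fun a ha => (h'.arr a ha).trans (h.arr a ha)⟩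

theorem Agree.mono (h : Agree R A s s₁) (hR : R ⊆ R') (hA : A ⊆ A') : Agree R' A' s s₁ :=
  ⟨fun x hx => h.reg x fun hx' => hx (hR hx'), fun a ha => h.arr a fun ha' => ha (hA ha')⟩

theorem Agree.setReg {x v : ℕ} (h : Agree R A s s₁) (hx : x ∈ R) :
    Agree R A s (s₁.setReg x v) := by
  refine ⟨fun y hy => ?_, h.2⟩
  rw [State.reg_setReg, if_neg (ne_of_mem_of_not_mem hx hy).symm, h.reg y hy]

end Agree

theorem Exec.agree {B T : ℕ} {p : Prog} {s s' : State} (h : Exec B p s T s') :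
    Agree p.regs p.arrs s s' := by
  induction h with
  | skip s => exact .refl _ _ _
  | assign s x e => exact (Agree.refl _ _ _).setReg (by simp [Prog.regs])
  | store s a i e =>
    refine ⟨fun _ _ => rfl, fun a' ha' => ?_⟩
    rw [Prog.arrs, List.mem_singleton] at ha'
    rw [State.arr_setArr, if_neg ha']
  | seq _ _ ih₁ ih₂ =>
    exact (ih₁.mono (by simp [Prog.regs]) (by simp [Prog.arrs])).trans
      (ih₂.mono (by simp [Prog.regs]) (by simp [Prog.arrs]))
  | cond_true _ _ ih => exact ih.mono (by simp [Prog.regs]) (by simp [Prog.arrs])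
  | cond_false _ _ ih => exact ih.mono (by simp [Prog.regs]) (by simp [Prog.arrs])
  | loop_true _ _ _ ih₁ ih₂ => exact .trans ih₁ ih₂
  | loop_false _ => exact .refl _ _ _

/-- The program writes no register below `r` and no array below `a`. -/
def Prog.WritesAbove (r a : ℕ) (p : Prog) : Prop :=
  (∀ x ∈ p.regs, r ≤ x) ∧ ∀ b ∈ p.arrs, a ≤ b

instance (r a : ℕ) (p : Prog) : Decidable (p.WritesAbove r a) :=
  inferInstanceAs (Decidable (_ ∧ _))

namespace Prog.WritesAbove

variable {r a r' a' : ℕ} {p q : Prog} {s s' : State}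

theorem mono (h : p.WritesAbove r a) (hr : r' ≤ r) (ha : a' ≤ a) : p.WritesAbove r' a' :=
  ⟨fun x hx => hr.trans (h.1 x hx), fun b hb => ha.trans (h.2 b hb)⟩

theorem reg (h : p.WritesAbove r a) (hA : Agree p.regs p.arrs s s') {x : ℕ} (hx : x < r) :
    s'.reg x = s.reg x :=
  hA.reg x fun hx' => (h.1 x hx').not_gt hx

theorem arr (h : p.WritesAbove r a) (hA : Agree p.regs p.arrs s s') {b : ℕ} (hb : b < a) :
    s'.arr b = s.arr b :=
  hA.arr b fun hb' => (h.2 b hb').not_gt hb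

theorem seq (hp : p.WritesAbove r a) (hq : q.WritesAbove r a) : (p ;; q).WritesAbove r a := by
  simp only [WritesAbove, Prog.regs, Prog.arrs, List.mem_append] at *
  grind

theorem cond {b : Expr} (hp : p.WritesAbove r a) (hq : q.WritesAbove r a) :
    (Prog.cond b p q).WritesAbove r a := seq hp hq

end Prog.WritesAbove

/-- A Hoare triple with total correctness: started in `s`, the program `p` halts within `T` time
units in a state with the property `Q`, and writes no number above `B`. -/
def HaltsIn (B T : ℕ) (p : Prog) (s : State) (Q : State → Prop) : Prop :=
  ∃ T' s', T' ≤ T ∧ Exec B p s T' s' ∧ Q s'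

/-- `for reg i := 0, …, reg y - 1 do p`. -/
def forLoop (i y : ℕ) (p : Prog) : Prog :=
  i ::= 0 ;; .loop (.reg i <ₑ .reg y) (p ;; i ::= .reg i + 1)

section HaltsIn

variable {B T T₁ T₂ : ℕ} {p q : Prog} {s : State} {Q Q' : State → Prop} {b e : Expr}

theorem HaltsIn.mono (h : HaltsIn B T₁ p s Q) (hT : T₁ ≤ T) : HaltsIn B T p s Q := by
  obtain ⟨T', s', hT', hp, hQ⟩ := h
  exact ⟨T', s', hT'.trans hT, hp, hQ⟩

theorem HaltsIn.post (h : HaltsIn B T p s Q) (hQ : ∀ s', Agree p.regs p.arrs s s' → Q s' → Q' s') :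
    HaltsIn B T p s Q' := by
  obtain ⟨T', s', hT', hp, hs'⟩ := h
  exact ⟨T', s', hT', hp, hQ s' hp.agree hs'⟩

theorem HaltsIn.assign {x : ℕ} (he : e.eval s ≤ B) (hQ : Q (s.setReg x (e.eval s))) :
    HaltsIn B (e.cost + 1) (x ::= e) s Q :=
  ⟨_, _, le_rfl, .assign s x e he, hQ⟩

theorem HaltsIn.seq (h : HaltsIn B T₁ p s fun s' => HaltsIn B T₂ q s' Q) :
    HaltsIn B (T₁ + T₂) (p ;; q) s Q := by
  obtain ⟨T', s', hT', hp, T'', s'', hT'', hq, hQ⟩ := h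
  exact ⟨_, _, Nat.add_le_add hT' hT'', .seq hp hq, hQ⟩

theorem HaltsIn.andThen (h : HaltsIn B T₁ p s Q')
    (h' : ∀ s', Agree p.regs p.arrs s s' → Q' s' → HaltsIn B T₂ q s' Q) :
    HaltsIn B (T₁ + T₂) (p ;; q) s Q :=
  .seq (h.post h')

/-- `I r s'` is the invariant: in `s'` at most `r` further rounds follow. -/
theorem HaltsIn.loop (I : ℕ → State → Prop) {r : ℕ} (h₀ : I r s)
    (hstep : ∀ r s', Agree p.regs p.arrs s s' → I r s' → b.eval s' ≠ 0 →
      HaltsIn B T p s' fun s'' => ∃ r' < r, I r' s'') :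
    HaltsIn B (r * (b.cost + 1 + T) + (b.cost + 1)) (.loop b p) s fun s' =>
      (∃ r, I r s') ∧ b.eval s' = 0 := by
  suffices H : ∀ r s', Agree p.regs p.arrs s s' → I r s' →
      HaltsIn B (r * (b.cost + 1 + T) + (b.cost + 1)) (.loop b p) s' fun s' =>
        (∃ r, I r s') ∧ b.eval s' = 0 from H r s (.refl _ _ _) h₀
  intro r
  induction r using Nat.strong_induction_on with
  | _ r ih =>
    intro s' hA hI
    by_cases hb : b.eval s' = 0
    · exact ⟨_, s', by omega, .loop_false hb, ⟨r, hI⟩, hb⟩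
    · obtain ⟨T₁, s₁, hT₁, hp, r', hr', hI'⟩ := hstep r s' hA hI hb
      obtain ⟨T₂, s₂, hT₂, hp', hQ⟩ := ih r' hr' s₁ (hA.trans hp.agree) hI'
      refine ⟨_, s₂, ?_, .loop_true hb hp hp', hQ⟩
      have : (r' + 1) * (b.cost + 1 + T) ≤ r * (b.cost + 1 + T) := Nat.mul_le_mul_right _ hr'
      rw [Nat.add_mul] at this
      omega

/-- `I j s'` is the invariant before the round with counter `j`. -/
theorem HaltsIn.forLoop {i y N : ℕ} (I : ℕ → State → Prop) (hN : s.reg y = N) (hB : N ≤ B)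
    (hi : i ∉ p.regs) (hy : y ∉ i :: p.regs) (h₀ : I 0 (s.setReg i 0))
    (hstep : ∀ j < N, ∀ s', Agree (forLoop i y p).regs p.arrs s s' → s'.reg i = j → I j s' →
      HaltsIn B T p s' fun s'' => I (j + 1) (s''.setReg i (j + 1)))
    (hQ : ∀ s', Agree (forLoop i y p).regs p.arrs s s' → I N s' → Q s') :
    HaltsIn B (2 + (N * (4 + (T + 4)) + 4)) (forLoop i y p) s Q := by
  have hiR : i ∈ (RAM.forLoop i y p).regs := by simp [RAM.forLoop, Prog.regs]
  have hyR : y ∉ (RAM.forLoop i y p).regs := by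
    simp only [List.mem_cons, not_or] at hy
    simp [RAM.forLoop, Prog.regs, hy]
  have hframe : ∀ {s₁ s₂}, Agree p.regs p.arrs s₁ s₂ →
      Agree (RAM.forLoop i y p).regs p.arrs s₁ s₂ :=
    fun h => h.mono (by simp [RAM.forLoop, Prog.regs]) fun _ h => h
  refine .seq (.assign (e := 0) (Nat.zero_le B) ?_)
  change HaltsIn B _ _ (s.setReg i 0) Q
  refine (HaltsIn.loop (b := .reg i <ₑ .reg y) (T := T + 4) (r := N) (fun r s' =>
    Agree (RAM.forLoop i y p).regs p.arrs s s' ∧ s'.reg i + r = N ∧ I (s'.reg i) s') ?_ ?_).post ?_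
  · exact ⟨(Agree.refl _ _ _).setReg hiR, by simp, by simpa using h₀⟩
  · rintro r s' - ⟨hA, hr, hI⟩ hb
    have hlt : s'.reg i < N := by simpa [hA.reg y hyR, hN] using hb
    refine (hstep _ hlt s' hA rfl hI).andThen fun s'' hA' hI' => ?_
    have hi' : s''.reg i = s'.reg i := hA'.reg i hi
    have hle : s'.reg i + 1 ≤ B := by omega
    refine HaltsIn.assign (s := s'') (e := .reg i + 1) (by simpa [hi'] using hle) ?_
    refine ⟨r - 1, by omega, (hA.trans (hframe hA')).setReg hiR, ?_, by simpa [hi'] using hI'⟩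
    simp only [State.reg_setReg, Expr.eval_add, Expr.eval_reg, Expr.eval_ofNat, if_true]
    omega
  · rintro s' - ⟨⟨r, hA, hr, hI⟩, hb⟩
    have hge : N ≤ s'.reg i := by simpa [hA.reg y hyR, hN] using hb
    have hiN : s'.reg i = N := by omega
    exact hQ s' hA (hiN ▸ hI)

end HaltsIn

/-- `HaltsIn` with the time that results if every loop makes at most `M` rounds. -/
def Halts (B M : ℕ) (p : Prog) (s : State) (Q : State → Prop) : Prop :=
  HaltsIn B (p.time M) p s Q

section Halts

variable {B M : ℕ} {p q : Prog} {s : State} {Q Q' : State → Prop} {b e i : Expr} {x a : ℕ}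

theorem Halts.post (h : Halts B M p s Q) (hQ : ∀ s', Agree p.regs p.arrs s s' → Q s' → Q' s') :
    Halts B M p s Q' := HaltsIn.post h hQ

theorem Halts.skip (hQ : Q s) : Halts B M .skip s Q := ⟨1, s, le_rfl, .skip s, hQ⟩

theorem Halts.assign (he : e.eval s ≤ B) (hQ : Q (s.setReg x (e.eval s))) :
    Halts B M (x ::= e) s Q := HaltsIn.assign he hQ

theorem Halts.store (he : e.eval s ≤ B) (hQ : Q (s.setArr a (i.eval s) (e.eval s))) :
    Halts B M (.store a i e) s Q := ⟨_, _, le_rfl, .store s a i e he, hQ⟩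

theorem Halts.andThen (h : Halts B M p s Q')
    (h' : ∀ s', Agree p.regs p.arrs s s' → Q' s' → Halts B M q s' Q) :
    Halts B M (p ;; q) s Q := HaltsIn.andThen h h'

theorem Halts.assign_seq (he : e.eval s ≤ B) (h : Halts B M q (s.setReg x (e.eval s)) Q) :
    Halts B M (x ::= e ;; q) s Q := HaltsIn.seq (.assign he h)

theorem Halts.store_seq (he : e.eval s ≤ B)
    (h : Halts B M q (s.setArr a (i.eval s) (e.eval s)) Q) :
    Halts B M (.store a i e ;; q) s Q :=
  (Halts.store (Q := (· = s.setArr a (i.eval s) (e.eval s))) he rfl).andThen fun _ _ hs => hs ▸ h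

theorem Halts.cond (h₁ : b.eval s ≠ 0 → Halts B M p s Q) (h₂ : b.eval s = 0 → Halts B M q s Q) :
    Halts B M (.cond b p q) s Q := by
  by_cases hb : b.eval s = 0
  · obtain ⟨T, s', hT, hq, hQ⟩ := h₂ hb
    exact ⟨_, s', by rw [Prog.time]; omega, .cond_false hb hq, hQ⟩
  · obtain ⟨T, s', hT, hp, hQ⟩ := h₁ hb
    exact ⟨_, s', by rw [Prog.time]; omega, .cond_true hb hp, hQ⟩

theorem Halts.loop (I : ℕ → State → Prop) {r : ℕ} (hr : r ≤ M) (h₀ : I r s)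
    (hstep : ∀ r s', Agree p.regs p.arrs s s' → I r s' → b.eval s' ≠ 0 →
      Halts B M p s' fun s'' => ∃ r' < r, I r' s'')
    (hQ : ∀ r s', Agree p.regs p.arrs s s' → I r s' → b.eval s' = 0 → Q s') :
    Halts B M (.loop b p) s Q :=
  ((HaltsIn.loop I h₀ hstep).mono (by rw [Prog.time]; gcongr)).post
    fun s' hA ⟨⟨r, hI⟩, hb⟩ => hQ r s' hA hI hb

theorem Halts.forLoop {i y N : ℕ} (I : ℕ → State → Prop) (hN : s.reg y = N) (hM : N ≤ M)
    (hB : M ≤ B) (h₀ : I 0 (s.setReg i 0))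
    (hstep : ∀ j < N, ∀ s', Agree (forLoop i y p).regs p.arrs s s' → s'.reg i = j → I j s' →
      Halts B M p s' fun s'' => I (j + 1) (s''.setReg i (j + 1)))
    (hQ : ∀ s', Agree (forLoop i y p).regs p.arrs s s' → I N s' → Q s')
    (hi : i ∉ p.regs := by decide) (hy : y ∉ i :: p.regs := by decide) :
    Halts B M (forLoop i y p) s Q :=
  (HaltsIn.forLoop I hN (hM.trans hB) hi hy h₀ hstep hQ).mono
    (Nat.add_le_add_left (Nat.add_le_add_right (Nat.mul_le_mul_right _ hM) 4) 2)

end Halts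

/-- For all `i, j < reg m` do `p`, with a single counter `c` up to `y = (reg m) ^ 2`, so that the
number of rounds of this loop is a square. -/
def forPairs (y c i j m : ℕ) (p : Prog) : Prog :=
  y ::= .reg m * .reg m ;;
  forLoop c y (i ::= .reg c / .reg m ;; j ::= .reg c - .reg i * .reg m ;; p)

theorem mul_add_lt_mul_self {m i j : ℕ} (hi : i < m) (hj : j < m) : i * m + j < m * m := by
  nlinarith

theorem exists_eq_mul_add {m c : ℕ} (hc : c < m * m) :
    ∃ i j, i < m ∧ j < m ∧ c = i * m + j ∧ c / m = i ∧ c - i * m = j := by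
  have hm : 0 < m := Nat.pos_of_ne_zero fun h => by simp [h] at hc
  have hdiv : c / m * m + c % m = c := Nat.div_add_mod' c m
  exact ⟨c / m, c % m, (Nat.div_lt_iff_lt_mul hm).2 hc, Nat.mod_lt c hm, hdiv.symm, rfl, by omega⟩

theorem mul_add_inj {m i j i' j' : ℕ} (hj : j < m) (hj' : j' < m) :
    i * m + j = i' * m + j' ↔ i = i' ∧ j = j' := by
  refine ⟨fun h => ?_, fun ⟨h, h'⟩ => by rw [h, h']⟩
  have hi : i = i' := by
    rcases lt_trichotomy i i' with hlt | heq | hlt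
    · nlinarith
    · exact heq
    · nlinarith
  subst hi
  exact ⟨rfl, by omega⟩

theorem Prog.WritesAbove.forPairs {r a y c i j m : ℕ} {p : Prog} (hp : p.WritesAbove r a)
    (hregs : ∀ x ∈ [y, c, i, j], r ≤ x := by decide) :
    (RAM.forPairs y c i j m p).WritesAbove r a := by
  simp only [WritesAbove, RAM.forPairs, forLoop, Prog.regs, Prog.arrs] at hp ⊢
  grind

theorem Halts.forPairs {B M m y c i j mReg : ℕ} {p : Prog} {s : State} {Q : State → Prop}
    (I : ℕ → State → Prop) (hm : s.reg mReg = m) (hM : m * m ≤ M) (hB : M ≤ B)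
    (hcongr : ∀ k s₁ s₂, Agree [y, c, i, j] [] s₁ s₂ → I k s₁ → I k s₂) (h₀ : I 0 s)
    (hstep : ∀ a < m, ∀ b < m, ∀ s', Agree (RAM.forPairs y c i j mReg p).regs
      (RAM.forPairs y c i j mReg p).arrs s s' →
      s'.reg i = a → s'.reg j = b → I (a * m + b) s' → Halts B M p s' (I (a * m + b + 1)))
    (hQ : ∀ s', Agree (RAM.forPairs y c i j mReg p).regs
      (RAM.forPairs y c i j mReg p).arrs s s' → I (m * m) s' → Q s')
    (hregs : [y, c, i, j, mReg].Nodup := by decide)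
    (hp : ∀ x ∈ [y, c, mReg], x ∉ p.regs := by decide) :
    Halts B M (RAM.forPairs y c i j mReg p) s Q := by
  simp only [List.nodup_cons, List.mem_cons, List.not_mem_nil, not_or, or_false] at hregs
  obtain ⟨⟨hyc, hyi, hyj, hym⟩, ⟨hci, hcj, hcm⟩, ⟨hij, him⟩, hjm, -⟩ := hregs
  simp only [List.mem_cons, List.not_mem_nil, or_false, forall_eq_or_imp, forall_eq] at hp
  obtain ⟨hpy, hpc, hpm⟩ := hp
  have hregs : (RAM.forPairs y c i j mReg p).regs = y :: c :: i :: j :: (p.regs ++ [c]) := by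
    simp [RAM.forPairs, RAM.forLoop, Prog.regs]
  have harrs : (RAM.forPairs y c i j mReg p).arrs = p.arrs := by
    simp [RAM.forPairs, RAM.forLoop, Prog.arrs]
  simp only [harrs] at hstep hQ
  have hset {x v : ℕ} (s' : State) (hx : x ∈ [y, c, i, j]) :
      Agree [y, c, i, j] [] s' (s'.setReg x v) := (Agree.refl _ _ s').setReg hx
  have hsub : [y, c, i, j] ⊆ (RAM.forPairs y c i j mReg p).regs := by rw [hregs]; simp
  refine .assign_seq (by simpa [hm] using hM.trans hB) ?_
  have h₁ := hset (v := m * m) s (x := y) (by simp)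
  simp only [Expr.eval_mul, Expr.eval_reg, hm]
  have hA {s'} (h : Agree (y :: c :: i :: j :: (p.regs ++ [c])) p.arrs (s.setReg y (m * m)) s') :
      Agree (RAM.forPairs y c i j mReg p).regs p.arrs s s' :=
    (h₁.mono hsub (List.nil_subset _)).trans (hregs ▸ h)
  refine .forLoop I (N := m * m) (by simp) hM hB (hcongr _ _ _ (h₁.trans (hset _ (by simp))) h₀)
    (fun k hk s' hs' hc hI => ?_) (fun s' hs' => hQ s' (hA (hs'.mono ?_ ?_))) ?_ ?_
  · obtain ⟨a, b, ha, hb, rfl, hdiv, hmod⟩ := exists_eq_mul_add hk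
    have hs' := hA (hs'.mono (by simp [RAM.forLoop, Prog.regs]) (by simp [Prog.arrs]))
    have hms' : s'.reg mReg = m := (hs'.reg mReg (by rw [hregs]; simp; tauto)).trans hm
    refine .assign_seq (by simp [hc, hms', hdiv]; nlinarith) <| .assign_seq
      (by simp [hc, hms', hdiv, hci, Ne.symm him]; nlinarith) ?_
    have h₂ : Agree [y, c, i, j] [] s' ((s'.setReg i a).setReg j b) :=
      (hset _ (by simp)).trans (hset _ (by simp))
    simp only [Expr.eval_div, Expr.eval_sub, Expr.eval_mul, Expr.eval_reg, hc, hms', hdiv,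
      State.reg_setReg, hci, Ne.symm him, if_true, if_false, hmod]
    refine (hstep a ha b hb _ (hs'.trans (h₂.mono hsub (List.nil_subset _))) (by simp [hij])
      (by simp) (hcongr _ _ _ h₂ hI)).post fun s'' _ hI' => ?_
    exact hcongr _ _ _ (hset _ (by simp)) hI'
  · simp [RAM.forLoop, Prog.regs]
  · simp [Prog.arrs]
  · simp [Prog.regs, hci, hcj, hpc]
  · simp [Prog.regs, hyc, hyi, hyj, hpy]

end RAM

/-! ### The search tree -/

namespace TwoClub

section ConflictFree

variable {V : Type*}

/-- No two vertices of `S` are in conflict, where `bad S u w` says that `u` and `w` are in conflict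
within `S`. -/
def ConflictFree (bad : Finset V → V → V → Prop) (S : Finset V) : Prop :=
  ∀ u ∈ S, ∀ w ∈ S, u ≠ w → ¬ bad S u w

/-- Conflicts persist in subsets, so that every subset that contains both vertices of a conflict
contains a conflict. -/
def Persistent (bad : Finset V → V → V → Prop) : Prop :=
  ∀ ⦃S S' : Finset V⦄, S ⊆ S' → ∀ u ∈ S, ∀ w ∈ S, bad S' u w → bad S u w

end ConflictFree

/-- An upper bound for the number of nodes of a search tree with `k` undecided vertices: a conflict
of two undecided vertices is resolved by deciding one vertex in the first branch (deletion) and two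
vertices in the second (one is kept and the other deleted). -/
def treeSize : ℕ → ℕ
  | 0 => 1
  | 1 => 2
  | k + 2 => treeSize (k + 1) + treeSize k + 1

theorem treeSize_pos (k : ℕ) : 0 < treeSize k := by
  match k with
  | 0 | 1 | k + 2 => simp [treeSize]

theorem treeSize_strictMono : StrictMono treeSize :=
  strictMono_nat_of_lt_succ fun k => by
    match k with
    | 0 => simp [treeSize]
    | k + 1 => rw [treeSize]; omega

/- `1.6181` exceeds the golden ratio, the growth rate of the recursion. -/
theorem treeSize_le (k : ℕ) : (treeSize k : ℝ) + 1 ≤ 3 * (1.6181 : ℝ) ^ k := by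
  induction k using Nat.twoStepInduction with
  | zero => norm_num [treeSize]
  | one => norm_num [treeSize]
  | more k h₁ h₂ =>
    have : (0 : ℝ) < 1.6181 ^ k := by positivity
    rw [treeSize]
    push_cast
    rw [pow_succ] at h₂
    rw [pow_succ, pow_succ]
    nlinarith

/-- The status of a vertex in the search: `0` if it is undecided, `1` if it is kept, `2` if it is
deleted. -/
abbrev Status : Type := Fin 3

section Search

variable {V : Type*} {bad : Finset V → V → V → Prop} {K : ℕ} {A : Finset V} {f : V → Status}
  {u w : V} {F : List (V → Status)}

/-- The vertices of `A` whose status is undecided. -/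
def undecided (A : Finset V) (f : V → Status) : Finset V := A.filter (f · = 0)

/-- The vertices of `A` that are not deleted. -/
def alive (A : Finset V) (f : V → Status) : Finset V := A.filter (f · ≠ 2)

/-- `A` has a conflict-free subset with at least `K` elements that respects the status `f`. -/
def Extendable (bad : Finset V → V → V → Prop) (K : ℕ) (A : Finset V) (f : V → Status) : Prop :=
  ∃ S ⊆ alive A f, (∀ v ∈ A, f v = 1 → v ∈ S) ∧ ConflictFree bad S ∧ K ≤ S.card

theorem mem_alive {v : V} : v ∈ alive A f ↔ v ∈ A ∧ f v ≠ 2 := Finset.mem_filter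

theorem undecided_zero : undecided A (fun _ => 0) = A := by simp [undecided]

theorem extendable_zero :
    Extendable bad K A (fun _ => 0) ↔ ∃ S ⊆ A, ConflictFree bad S ∧ K ≤ S.card := by
  simp [Extendable, alive]

theorem extendable_iff_of_conflictFree (h : ConflictFree bad (alive A f)) :
    Extendable bad K A f ↔ K ≤ (alive A f).card := by
  refine ⟨fun ⟨S, hS, _, _, hK⟩ => hK.trans (Finset.card_le_card hS), fun hK => ?_⟩
  exact ⟨_, subset_rfl, fun v hv hf => mem_alive.2 ⟨hv, by simp [hf]⟩, h, hK⟩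

section Update

variable [DecidableEq V]

theorem card_undecided_update {c : Status} (hu : u ∈ A) (hf : f u = 0) (hc : c ≠ 0) :
    (undecided A (Function.update f u c)).card + 1 = (undecided A f).card := by
  have : undecided A (Function.update f u c) = (undecided A f).erase u := by
    ext v
    by_cases hv : v = u <;> simp [undecided, hv, hc]
  have hu : u ∈ undecided A f := Finset.mem_filter.2 ⟨hu, hf⟩
  rw [this, Finset.card_erase_add_one hu]

theorem card_undecided_update_le {c : Status} (hc : c ≠ 0) :
    (undecided A (Function.update f u c)).card ≤ (undecided A f).card := by
  refine Finset.card_le_card fun v => ?_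
  by_cases hv : v = u <;> simp [undecided, hv, hc]

theorem extendable_update_two (hf : f u = 0) :
    Extendable bad K A (Function.update f u 2) ↔
      ∃ S ⊆ alive A f, u ∉ S ∧ (∀ v ∈ A, f v = 1 → v ∈ S) ∧ ConflictFree bad S ∧ K ≤ S.card := by
  refine exists_congr fun S => ?_
  have hS : S ⊆ alive A (Function.update f u 2) ↔ S ⊆ alive A f ∧ u ∉ S := by
    simp only [Finset.subset_iff, mem_alive, Function.update_apply]
    grind
  have hkept : ∀ v, Function.update f u 2 v = 1 ↔ f v = 1 := by
    intro v
    by_cases hv : v = u <;> simp [hv, hf]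
  simp only [hS, hkept, and_assoc]

theorem extendable_update_one (hu : u ∈ A) (hf : f u ≠ 2) :
    Extendable bad K A (Function.update f u 1) ↔
      ∃ S ⊆ alive A f, u ∈ S ∧ (∀ v ∈ A, f v = 1 → v ∈ S) ∧ ConflictFree bad S ∧ K ≤ S.card := by
  refine exists_congr fun S => ?_
  have halive : alive A (Function.update f u 1) = alive A f := by
    ext v
    by_cases hv : v = u <;> simp [mem_alive, hv, hf]
  have hkept : (∀ v ∈ A, Function.update f u 1 v = 1 → v ∈ S) ↔
      u ∈ S ∧ ∀ v ∈ A, f v = 1 → v ∈ S := by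
    simp only [Function.update_apply]
    grind
  rw [halive, hkept, and_assoc]

/-- The branches for a conflict between `u` and `w`: delete `u`, or keep `u` and delete `w`. Only
undecided vertices can be deleted. -/
def branches (f : V → Status) (u w : V) : List (V → Status) :=
  (if f w = 0 then [Function.update (Function.update f u 1) w 2] else []) ++
    if f u = 0 then [Function.update f u 2] else []

theorem extendable_iff_branches (hbad : Persistent bad) (hu : u ∈ alive A f) (hw : w ∈ alive A f)
    (huw : u ≠ w) (h : bad (alive A f) u w) :
    Extendable bad K A f ↔ ∃ g ∈ branches f u w, Extendable bad K A g := by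
  rw [mem_alive] at hu hw
  have hbranches : (∃ g ∈ branches f u w, Extendable bad K A g) ↔
      (f w = 0 ∧ Extendable bad K A (Function.update (Function.update f u 1) w 2)) ∨
        (f u = 0 ∧ Extendable bad K A (Function.update f u 2)) := by
    unfold branches
    by_cases hfu : f u = 0 <;> by_cases hfw : f w = 0 <;> simp [hfu, hfw]
  have hnot {S : Finset V} (hS : S ⊆ alive A f) (hcf : ConflictFree bad S) (huS : u ∈ S) :
      w ∉ S := fun hwS => hcf u huS w hwS huw (hbad hS u huS w hwS h)
  have hundecided {S : Finset V} {v : V} (hv : v ∈ A ∧ f v ≠ 2) (hS : ∀ v ∈ A, f v = 1 → v ∈ S)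
      (hvS : v ∉ S) : f v = 0 := by
    have hne : ∀ c : Status, c ≠ 2 → c ≠ 1 → c = 0 := by decide
    exact hne _ hv.2 (mt (hS v hv.1) hvS)
  rw [hbranches]
  constructor
  · rintro ⟨S, hS, hkept, hcf, hK⟩
    by_cases huS : u ∈ S
    · have hwS := hnot hS hcf huS
      have hfw := hundecided hw hkept hwS
      refine .inl ⟨hfw, (extendable_update_two (by rwa [Function.update_of_ne huw.symm])).2 ?_⟩
      obtain ⟨-, hS'⟩ : S ⊆ alive A f ∧ S ⊆ alive A (Function.update f u 1) := by
        refine ⟨hS, fun v hv => ?_⟩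
        have := mem_alive.1 (hS hv)
        by_cases hvu : v = u <;> simp_all [mem_alive]
      refine ⟨S, hS', hwS, fun v hv hfv => ?_, hcf, hK⟩
      by_cases hvu : v = u
      · rwa [hvu]
      · exact hkept v hv (by rwa [Function.update_of_ne hvu] at hfv)
    · have hfu := hundecided hu hkept huS
      exact .inr ⟨hfu, (extendable_update_two hfu).2 ⟨S, hS, huS, hkept, hcf, hK⟩⟩
  · rintro (⟨hfw, hext⟩ | ⟨hfu, hext⟩)
    · have hfw' : Function.update f u 1 w = 0 := by rwa [Function.update_of_ne huw.symm]
      obtain ⟨S, hS, -, h⟩ := (extendable_update_two hfw').1 hext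
      obtain ⟨S, hS, -, h⟩ := (extendable_update_one hu.1 hu.2).1 ⟨S, hS, h⟩
      exact ⟨S, hS, h⟩
    · obtain ⟨S, hS, -, h⟩ := (extendable_update_two hfu).1 hext
      exact ⟨S, hS, h⟩

end Update

/-- The number of search tree nodes that remain to be visited if the nodes on the stack `F` are
open. -/
def potential (A : Finset V) (F : List (V → Status)) : ℕ :=
  (F.map fun f => treeSize (undecided A f).card).sum

/-- Every entry of the stack `F`, whose top is the head of the list, has decided at least as many
vertices of `A` as there are entries below it. This keeps the stack small. -/
def DepthBounded (A : Finset V) : List (V → Status) → Prop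
  | [] => True
  | f :: F => (undecided A f).card + F.length ≤ A.card ∧ DepthBounded A F

theorem DepthBounded.length_le (h : DepthBounded A F) : F.length ≤ A.card + 1 := by
  cases F with
  | nil => simp
  | cons f F => have := h.1; rw [List.length_cons]; omega

variable [DecidableEq V]

theorem DepthBounded.branches_append (h : DepthBounded A (f :: F)) (hu : u ∈ A) (hw : w ∈ A)
    (huw : u ≠ w) : DepthBounded A (branches f u w ++ F) := by
  obtain ⟨hf, hF⟩ := h
  have hdelete (hfu : f u = 0) := card_undecided_update (c := 2) hu hfu (by decide)
  have hkeep (hfu : f u = 0) := card_undecided_update (c := 1) hu hfu (by decide)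
  have hkeep_le : (undecided A (Function.update f u 1)).card ≤ _ :=
    card_undecided_update_le (by decide)
  have hsecond (hfw : f w = 0) := card_undecided_update (f := Function.update f u 1) (c := 2) hw
    (by rwa [Function.update_of_ne huw.symm]) (by decide)
  by_cases hfu : f u = 0 <;> by_cases hfw : f w = 0 <;>
    simp only [branches, hfu, hfw, if_true, if_false, List.nil_append, List.cons_append,
      DepthBounded, List.length_cons] <;> grind

theorem potential_branches_append_lt (hu : u ∈ A) (hw : w ∈ A) (huw : u ≠ w) :
    potential A (branches f u w ++ F) < potential A (f :: F) := by
  have hpos := treeSize_pos (undecided A f).card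
  have hlt {k : ℕ} (h : k < (undecided A f).card) := treeSize_strictMono h
  have hkeep (hfu : f u = 0) := card_undecided_update (c := 1) hu hfu (by decide)
  have hkeep_le : (undecided A (Function.update f u 1)).card ≤ _ :=
    card_undecided_update_le (by decide)
  have hsecond (hfw : f w = 0) := card_undecided_update (f := Function.update f u 1) (c := 2) hw
    (by rwa [Function.update_of_ne huw.symm]) (by decide)
  simp only [potential, branches, List.map_append, List.sum_append, List.map_cons, List.sum_cons]
  refine Nat.add_lt_add_right ?_ _
  by_cases hfu : f u = 0
  · have hdelete := card_undecided_update (c := 2) hu hfu (by decide)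
    by_cases hfw : f w = 0
    · have hrec : treeSize (undecided A f).card =
          treeSize (undecided A (Function.update f u 2)).card +
            treeSize (undecided A (Function.update (Function.update f u 1) w 2)).card + 1 := by
        rw [← hdelete, ← Nat.add_right_cancel (hkeep hfu |>.trans hdelete.symm), ← hsecond hfw,
          treeSize]
      simp only [hfu, hfw, if_true, List.map_cons, List.map_nil, List.sum_cons, List.sum_nil]
      omega
    · simpa [hfu, hfw] using hlt (by omega)
  · by_cases hfw : f w = 0
    · simpa [hfu, hfw] using hlt (by have := hsecond hfw; omega)
    · simpa [hfu, hfw] using hpos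

end Search

/-! ### Listing the vertices at distance at most two -/

theorem flatMap_eq_of_lt_length {α β : Type*} {l : List α} (f : α → List β) {j : ℕ}
    (hj : j < l.length) :
    l.flatMap f = (l.take j).flatMap f ++ (f l[j] ++ (l.drop (j + 1)).flatMap f) := by
  conv_lhs => rw [← List.take_append_drop j l, List.drop_eq_getElem_cons hj]
  rw [List.flatMap_append, List.flatMap_cons]

section Ball

variable {V : Type*} [DecidableEq V] {l l' : List V} {x y v : V} {adj : V → List V}

/-- Append `x` to the list `l` unless it occurs there. -/
def insertEnd (l : List V) (x : V) : List V := if x ∈ l then l else l ++ [x]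

theorem mem_insertEnd : y ∈ insertEnd l x ↔ y ∈ l ∨ y = x := by
  unfold insertEnd
  split_ifs with h
  · exact ⟨.inl, fun h' => h'.elim id (· ▸ h)⟩
  · simp

theorem nodup_insertEnd (hl : l.Nodup) : (insertEnd l x).Nodup := by
  unfold insertEnd
  split_ifs with h
  · exact hl
  · exact List.nodup_append_comm.1 (List.nodup_cons.2 ⟨h, hl⟩)

theorem prefix_insertEnd : l <+: insertEnd l x := by
  unfold insertEnd
  split_ifs
  · exact List.prefix_rfl
  · exact List.prefix_append l [x]

theorem mem_foldl_insertEnd : y ∈ l'.foldl insertEnd l ↔ y ∈ l ∨ y ∈ l' := by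
  induction l' generalizing l with
  | nil => simp
  | cons x l' ih => rw [List.foldl_cons, ih, mem_insertEnd, List.mem_cons, or_assoc]

theorem nodup_foldl_insertEnd (hl : l.Nodup) : (l'.foldl insertEnd l).Nodup := by
  induction l' generalizing l with
  | nil => exact hl
  | cons x _ ih => exact ih (nodup_insertEnd hl)

theorem prefix_foldl_insertEnd : l <+: l'.foldl insertEnd l := by
  induction l' generalizing l with
  | nil => exact List.prefix_rfl
  | cons x _ ih => exact prefix_insertEnd.trans ih

/-- The list `l` together with the neighbors of its members. -/
def expand (adj : V → List V) (l : List V) : List V := (l.flatMap adj).foldl insertEnd l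

/-- The vertices at distance at most two from `v`. -/
def ballList (adj : V → List V) (v : V) : List V := expand adj (expand adj [v])

theorem mem_expand : y ∈ expand adj l ↔ y ∈ l ∨ ∃ x ∈ l, y ∈ adj x := by
  rw [expand, mem_foldl_insertEnd, List.mem_flatMap]

theorem mem_ballList : y ∈ ballList adj v ↔
    (y = v ∨ y ∈ adj v) ∨ ∃ x, (x = v ∨ x ∈ adj v) ∧ y ∈ adj x := by
  simp [ballList, mem_expand]

theorem nodup_ballList : (ballList adj v).Nodup :=
  nodup_foldl_insertEnd (nodup_foldl_insertEnd (List.nodup_singleton v))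

theorem length_expand_le_ballList : (expand adj [v]).length ≤ (ballList adj v).length :=
  prefix_foldl_insertEnd.length_le

theorem length_ballList_le {D : ℕ} (hD : ∀ x, (adj x).length ≤ D)
    (hsymm : ∀ x ∈ adj v, v ∈ adj x) : (ballList adj v).length ≤ D ^ 2 + 1 := by
  set N : Finset V := (adj v).toFinset
  have hcard (x : V) : (adj x).toFinset.card ≤ D := (List.toFinset_card_le _).trans (hD x)
  have hsub : (ballList adj v).toFinset ⊆
      insert v (N ∪ N.biUnion fun x => (adj x).toFinset.erase v) := by
    intro y
    simp only [List.mem_toFinset, mem_ballList, Finset.mem_insert, Finset.mem_union,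
      Finset.mem_biUnion, Finset.mem_erase, N]
    grind
  have hsecond : (N.biUnion fun x => (adj x).toFinset.erase v).card ≤ D * (D - 1) := by
    refine (Finset.card_biUnion_le_card_mul _ _ (D - 1) fun x hx => ?_).trans
      (Nat.mul_le_mul_right _ (hcard v))
    rw [Finset.card_erase_of_mem (List.mem_toFinset.2 (hsymm x (List.mem_toFinset.1 hx)))]
    exact Nat.sub_le_sub_right (hcard x) 1
  have hD : D + D * (D - 1) = D ^ 2 := by cases D <;> simp; ring
  calc (ballList adj v).length = (ballList adj v).toFinset.card :=
        (List.toFinset_card_of_nodup nodup_ballList).symm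
    _ ≤ (N.card + (N.biUnion fun x => (adj x).toFinset.erase v).card) + 1 :=
        (Finset.card_le_card hsub).trans <| (Finset.card_insert_le _ _).trans <|
          Nat.add_le_add_right (Finset.card_union_le _ _) 1
    _ ≤ D ^ 2 + 1 := by have : N.card ≤ D := hcard v; omega

end Ball

/-! ### The local adjacency matrix -/

open RAM
open RAM.Expr (reg arr)

namespace Reg

abbrev answer : ℕ := 0
abbrev order : ℕ := 1
abbrev param : ℕ := 2
abbrev threshold : ℕ := 3
abbrev target : ℕ := 4
abbrev center : ℕ := 5
abbrev size : ℕ := 6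
abbrev oldSize : ℕ := 7
abbrev entry : ℕ := 8
abbrev source : ℕ := 9
abbrev offset : ℕ := 10
abbrev degree : ℕ := 11
abbrev slot : ℕ := 12
abbrev vertex : ℕ := 13
abbrev present : ℕ := 14
abbrev probe : ℕ := 15
abbrev cells : ℕ := 16
abbrev cell : ℕ := 17
abbrev row : ℕ := 18
abbrev col : ℕ := 19

end Reg

namespace Arr

abbrev offsets : ℕ := 0
abbrev neighbors : ℕ := 1
abbrev list : ℕ := 2
abbrev matrix : ℕ := 3

end Arr

open Reg Arr

/-- The adjacency lists `adj` in the format of `inputState`. -/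
structure HoldsGraph {n : ℕ} (adj : Fin n → List (Fin n)) (s : State) : Prop where
  next (v : Fin n) : s.arr offsets (v + 1) = s.arr offsets v + (adj v).length
  entry (v : Fin n) (i : ℕ) (h : i < (adj v).length) :
    s.arr neighbors (s.arr offsets v + i) = (adj v)[i]

/-- The array `list` holds `l`, and the register `size` its length. -/
structure HoldsList {n : ℕ} (l : List (Fin n)) (s : State) : Prop where
  size : s.reg size = l.length
  entry (i : ℕ) (h : i < l.length) : s.arr list i = l[i]

/-- Append the vertex in register `vertex` to the list unless it occurs there. -/
def insertVertex : Prog :=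
  present ::= 0 ;;
  forLoop probe size (.cond (arr list (reg probe) =ₑ reg vertex) (present ::= 1) .skip) ;;
  .cond (reg present) .skip (.store list (reg size) (reg vertex) ;; size ::= reg size + 1)

/-- Run `p` with each neighbor of the vertex in register `source` in register `vertex`. -/
def forNeighbors (p : Prog) : Prog :=
  offset ::= arr offsets (reg source) ;;
  degree ::= arr offsets (reg source + 1) - reg offset ;;
  forLoop slot degree (vertex ::= arr neighbors (reg offset + reg slot) ;; p)

/-- Append the neighbors of the listed vertices to the list. -/
def expandList : Prog :=
  oldSize ::= reg size ;;
  forLoop entry oldSize (source ::= arr list (reg entry) ;; forNeighbors insertVertex)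

/-- List the vertices at distance at most two from the vertex in register `center`. -/
def listBall : Prog :=
  .store list 0 (reg center) ;; size ::= 1 ;; expandList ;; expandList

section

variable {n B M : ℕ} {adj : Fin n → List (Fin n)} {l : List (Fin n)} {x v : Fin n}
  {s s' : State} {p : Prog} {Q : State → Prop}

theorem HoldsGraph.congr (h : HoldsGraph adj s) (h₀ : s'.arr offsets = s.arr offsets)
    (h₁ : s'.arr neighbors = s.arr neighbors) : HoldsGraph adj s' :=
  ⟨by simpa only [h₀] using h.next, by simpa only [h₀, h₁] using h.entry⟩

theorem HoldsList.congr (h : HoldsList l s) (hr : s'.reg Reg.size = s.reg Reg.size)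
    (ha : s'.arr list = s.arr list) : HoldsList l s' :=
  ⟨by rw [hr, h.size], by simpa only [ha] using h.entry⟩

theorem HoldsList.entry_eq_iff (h : HoldsList l s) {i : ℕ} (hi : i < l.length) :
    s.arr list i = x ↔ l[i] = x := by
  rw [h.entry i hi, Fin.val_inj]

theorem halts_insertVertex (hl : HoldsList l s) (hx : s.reg vertex = x)
    (hM : (insertEnd l x).length ≤ M) (hMB : M ≤ B) (hn : n ≤ B) (hB : 1 ≤ B) :
    Halts B M insertVertex s (HoldsList (insertEnd l x)) := by
  have hlM : l.length ≤ M := prefix_insertEnd.length_le.trans hM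
  refine .assign_seq (by simp) <| .andThen (Q' := fun s' => s'.reg present = if x ∈ l then 1 else 0)
    (.forLoop (fun j s' => s'.reg present = if x ∈ l.take j then 1 else 0) (N := l.length)
      (by simp [hl.size]) hlM hMB (by simp) (fun j hj s' hA hjs hI => ?_)
      (fun s' _ hI => by simpa using hI)) fun s' hA hpresent => ?_
  · have hls : HoldsList l s' := hl.congr (hA.reg _) (hA.arr _)
    have hxs : s'.reg vertex = x := (hA.reg _).trans (by simpa using hx)
    have hstep : x ∈ l.take (j + 1) ↔ x ∈ l.take j ∨ l[j] = x := by
      rw [List.take_succ_eq_append_getElem hj, List.mem_append, List.mem_singleton,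
        eq_comm (a := x)]
    have htest : (arr list (reg probe) =ₑ reg vertex).eval s' ≠ 0 ↔ l[j] = x := by
      simp [hjs, hxs, hls.entry_eq_iff hj]
    refine .cond (fun h => .assign (by simpa) ?_) fun h => .skip ?_
    · simp [hstep, htest.1 h]
    · simp [hstep, hI, mt htest.2 (not_not.2 h)]
  · have hls : HoldsList l s' := hl.congr (hA.reg _) (hA.arr _)
    have hxs : s'.reg vertex = x := (hA.reg _).trans (by simpa using hx)
    refine .cond (fun h => .skip ?_) fun h => ?_
    · rwa [insertEnd, if_pos (by simpa [hpresent] using h)]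
    · have hmem : x ∉ l := by simpa [hpresent] using h
      rw [insertEnd, if_neg hmem] at hM ⊢
      refine .store_seq (by simp [hxs]; omega) (.assign ?_ ⟨?_, fun i hi => ?_⟩)
      · simp [hls.size] at hM ⊢; omega
      · simp [hls.size]
      · rcases Nat.lt_or_ge i l.length with hlt | hge
        · simp [hls.size, hlt, hlt.ne, hls.entry]
        · obtain rfl : i = l.length := by simp at hi; omega
          simp [hls.size, hxs]

theorem halts_forNeighbors (I : ℕ → State → Prop) (hgraph : HoldsGraph adj s)
    (hx : s.reg source = x) (hM : (adj x).length ≤ M) (hMB : M ≤ B)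
    (hB : ∀ v : Fin n, s.arr offsets v ≤ B) (hn : n ≤ B)
    (hcongr : ∀ k s₁ s₂, Agree [offset, degree, slot, vertex] [] s₁ s₂ → I k s₁ → I k s₂)
    (h₀ : I 0 s)
    (hstep : ∀ i (hi : i < (adj x).length), ∀ s',
      Agree (forNeighbors p).regs p.arrs s s' → s'.reg vertex = (adj x)[i] → I i s' →
        Halts B M p s' (I (i + 1)))
    (hQ : ∀ s', Agree (forNeighbors p).regs p.arrs s s' → I (adj x).length s' → Q s')
    (hp : ∀ y ∈ [offset, degree, slot], y ∉ p.regs := by decide)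
    (hp' : neighbors ∉ p.arrs := by decide) :
    Halts B M (forNeighbors p) s Q := by
  simp only [List.mem_cons, List.not_mem_nil, or_false, forall_eq_or_imp, forall_eq] at hp
  obtain ⟨hpo, hpd, hps⟩ := hp
  have hregs : (forNeighbors p).regs =
      offset :: degree :: slot :: vertex :: (p.regs ++ [slot]) := by
    simp [forNeighbors, forLoop, Prog.regs]
  have hset {y c : ℕ} (s' : State) (hy : y ∈ [offset, degree, slot, vertex]) :
      Agree [offset, degree, slot, vertex] [] s' (s'.setReg y c) := (Agree.refl _ _ s').setReg hy
  have hframe {s₁ s₂ : State} (h : Agree [offset, degree, slot, vertex] [] s₁ s₂) :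
      Agree (forNeighbors p).regs p.arrs s₁ s₂ := h.mono (by rw [hregs]; simp) (List.nil_subset _)
  suffices h : ∀ s₁, Agree [offset, degree, slot, vertex] [] s s₁ →
      s₁.reg offset = s.arr offsets x → s₁.reg degree = (adj x).length →
        Halts B M (forLoop slot degree (vertex ::= arr neighbors (reg offset + reg slot) ;; p)) s₁ Q
      from .assign_seq (by simpa [hx] using hB x) <| .assign_seq
        (by simpa [hx, hgraph.next] using hM.trans hMB) <|
          h _ ((hset _ (by simp)).trans (hset _ (by simp))) (by simp [hx])
            (by simp [hx, hgraph.next])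
  intro s₁ h₁ hoffset hdegree
  have hA {s'} (h : Agree (slot :: vertex :: (p.regs ++ [slot])) p.arrs s₁ s') :
      Agree (forNeighbors p).regs p.arrs s s' :=
    (hframe h₁).trans (h.mono (by rw [hregs]; simp) fun _ h => h)
  refine .forLoop I hdegree hM hMB (hcongr _ _ _ (h₁.trans (hset _ (by simp))) h₀)
    (fun i hi s' hs' hslot hI => ?_) (fun s' hs' hI => hQ s' (hA ?_) hI) ?_ ?_
  · have hoff : s'.reg offset = s.arr offsets x :=
      (hs'.reg offset (by simp [forLoop, Prog.regs, hpo])).trans hoffset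
    have hs' := hA (s' := s') (by simpa [forLoop, Prog.regs, Prog.arrs] using hs')
    have hread : s'.arr neighbors (s'.reg offset + s'.reg slot) = (adj x)[i] := by
      rw [hs'.arr neighbors hp', hoff, hslot, hgraph.entry x i hi]
    refine .assign_seq (by simp only [Expr.eval_arr, Expr.eval_add, Expr.eval_reg, hread]; omega) ?_
    have h₂ := hset (y := vertex) (c := (adj x)[i]) s' (by simp)
    simp only [Expr.eval_arr, Expr.eval_add, Expr.eval_reg, hread]
    exact (hstep i hi _ (hs'.trans (hframe h₂)) (by simp) (hcongr _ _ _ h₂ hI)).post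
      fun s'' _ hI' => hcongr _ _ _ (hset _ (by simp)) hI'
  · simpa [forLoop, Prog.regs, Prog.arrs] using hs'
  · simp [Prog.regs, hps]
  · simp [Prog.regs, hpd]

theorem halts_expandList (hgraph : HoldsGraph adj s) (hl : HoldsList l s)
    (hM : (expand adj l).length ≤ M) (hdeg : ∀ x, (adj x).length ≤ M) (hMB : M ≤ B)
    (hB : ∀ v : Fin n, s.arr offsets v ≤ B) (hn : n ≤ B) (hB₁ : 1 ≤ B) :
    Halts B M expandList s (HoldsList (expand adj l)) := by
  have hlength {l' : List (Fin n)} (h : l' <+: l.flatMap adj) :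
      (l'.foldl insertEnd l).length ≤ M := by
    obtain ⟨r, hr⟩ := h
    rw [expand, ← hr, List.foldl_append] at hM
    exact prefix_foldl_insertEnd.length_le.trans hM
  have hlM : l.length ≤ M := hlength List.nil_prefix
  refine .assign_seq (by simpa [hl.size] using hlM.trans hMB) ?_
  refine .forLoop (fun j => HoldsList (((l.take j).flatMap adj).foldl insertEnd l))
    (N := l.length) (by simp [hl.size]) hlM hMB
    (by simpa using hl.congr (by simp) (by simp)) (fun j hj s' hA hjs hI => ?_)
    (fun s' _ hI => by simpa [expand] using hI)
  have hlist : s'.arr list j = l[j] := by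
    rw [hI.entry j (hj.trans_le prefix_foldl_insertEnd.length_le), Fin.val_inj]
    exact (prefix_foldl_insertEnd.getElem hj).symm
  have hoffsets : s'.arr offsets = s.arr offsets := hA.arr _
  refine .assign_seq (by simp [hjs, hlist]; omega) ?_
  refine halts_forNeighbors (x := l[j]) (adj := adj)
    (fun i => HoldsList (((adj l[j]).take i).foldl insertEnd
      (((l.take j).flatMap adj).foldl insertEnd l)))
    (hgraph.congr hoffsets (hA.arr _)) (by simp [hjs, hlist]) (hdeg _) hMB (by simpa [hoffsets])
    hn (fun k s₁ s₂ h hI => hI.congr (h.reg _) (h.arr _))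
    (HoldsList.congr (s := s') (by simpa using hI) (by simp) rfl)
    (fun i hi s₁ _ hvertex hI => ?_) (fun s₁ _ hI => ?_)
  · have htake : (adj l[j]).take (i + 1) = (adj l[j]).take i ++ [(adj l[j])[i]] :=
      List.take_succ_eq_append_getElem hi
    have := hlength (l' := (l.take j).flatMap adj ++ (adj l[j]).take (i + 1)) ?_
    · rw [htake, List.foldl_append, List.foldl_append, List.foldl_cons] at this
      rw [htake, List.foldl_append]
      exact halts_insertVertex hI hvertex this hMB hn hB₁
    · rw [flatMap_eq_of_lt_length adj hj, List.prefix_append_right_inj]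
      exact (List.take_prefix _ _).trans (List.prefix_append _ _)
  · rw [List.take_length] at hI
    rw [List.take_succ_eq_append_getElem hj, List.flatMap_append, List.foldl_append,
      List.flatMap_singleton]
    exact hI.congr (by simp) rfl

theorem halts_listBall (hgraph : HoldsGraph adj s) (hv : s.reg center = v)
    (hM : (ballList adj v).length ≤ M) (hdeg : ∀ x, (adj x).length ≤ M) (hMB : M ≤ B)
    (hB : ∀ v : Fin n, s.arr offsets v ≤ B) (hn : n ≤ B) (hB₁ : 1 ≤ B) :
    Halts B M listBall s (HoldsList (ballList adj v)) := by
  refine .store_seq (by simp [hv]; omega) <| .assign_seq (by simpa) ?_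
  refine .andThen (halts_expandList (adj := adj) (l := [v]) (hgraph.congr (by simp) (by simp))
    ⟨by simp, by simp [hv]⟩ (length_expand_le_ballList.trans hM) hdeg hMB (by simpa) hn hB₁)
    fun s' hA hl => ?_
  refine halts_expandList (hgraph.congr ((hA.arr _).trans ?_) ((hA.arr _).trans ?_)) hl hM hdeg hMB
    (by simpa [hA.arr offsets]) hn hB₁ <;> simp

end

open Classical in
/-- The cells of the array `a` form the `0-1` matrix of the relation `r` on the list `l`, row by
row. -/
def TabulatesRel {V : Type*} (l : List V) (r : V → V → Prop) (a : ℕ → ℕ) : Prop :=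
  ∀ i j (hi : i < l.length) (hj : j < l.length),
    a (i * l.length + j) = if r l[i] l[j] then 1 else 0

open Classical in
/-- The first `k` cells of the array `a` agree with the `0-1` matrix of the relation `r` on the
list `l`. -/
def TabulatesRelUpTo {V : Type*} (l : List V) (r : V → V → Prop) (k : ℕ) (a : ℕ → ℕ) : Prop :=
  ∀ i j (hi : i < l.length) (hj : j < l.length), i * l.length + j < k →
    a (i * l.length + j) = if r l[i] l[j] then 1 else 0

theorem TabulatesRelUpTo.tabulatesRel {V : Type*} {l : List V} {r : V → V → Prop} {a : ℕ → ℕ}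
    (h : TabulatesRelUpTo l r (l.length * l.length) a) : TabulatesRel l r a :=
  fun i j hi hj => h i j hi hj (mul_add_lt_mul_self hi hj)

open Classical in
theorem TabulatesRelUpTo.update {V : Type*} {l : List V} {r : V → V → Prop} {a : ℕ → ℕ} {i j : ℕ}
    (hi : i < l.length) (hj : j < l.length) (h : TabulatesRelUpTo l r (i * l.length + j) a) :
    TabulatesRelUpTo l r (i * l.length + j + 1)
      (Function.update a (i * l.length + j) (if r l[i] l[j] then 1 else 0)) := by
  intro i' j' hi' hj' hlt
  by_cases heq : i' * l.length + j' = i * l.length + j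
  · obtain ⟨rfl, rfl⟩ := (mul_add_inj hj' hj).1 heq
    rw [Function.update_self]
  · rw [Function.update_of_ne heq]
    exact h i' j' hi' hj' (lt_of_le_of_ne (Nat.lt_succ_iff.1 hlt) heq)

/-- The local data for the search: the number of vertices of the list `l`, the parameter `t`, and
the adjacency matrix of the graph on `l`. -/
structure HoldsInstance {V : Type*} (G : SimpleGraph V) (t : ℕ) (l : List V) (s : State) :
    Prop where
  size : s.reg size = l.length
  param : s.reg param = t
  matrix : TabulatesRel l G.Adj (s.arr matrix)

/-- Test whether the vertices at the positions `row` and `col` of the list are adjacent. -/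
def testAdjacent : Prog :=
  present ::= 0 ;;
  source ::= arr list (reg row) ;;
  forNeighbors (.cond (reg vertex =ₑ arr list (reg col)) (present ::= 1) .skip)

/-- Write the adjacency matrix of the graph on the list to the array `matrix`. -/
def buildMatrix : Prog :=
  forPairs cells cell row col size
    (testAdjacent ;; .store matrix (reg row * reg size + reg col) (reg present))

section

variable {n B M : ℕ} {G : SimpleGraph (Fin n)} {adj : Fin n → List (Fin n)}
  {l : List (Fin n)} {s : State}

open Classical in
theorem halts_testAdjacent {i j : ℕ} (hadj : IsAdjacencyList G adj) (hgraph : HoldsGraph adj s)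
    (hl : HoldsList l s) (hi : i < l.length) (hj : j < l.length) (hrow : s.reg row = i)
    (hcol : s.reg col = j) (hdeg : ∀ x, (adj x).length ≤ M) (hMB : M ≤ B)
    (hB : ∀ v : Fin n, s.arr offsets v ≤ B) (hn : n ≤ B) (hB₁ : 1 ≤ B) :
    Halts B M testAdjacent s fun s' => s'.reg present = if G.Adj l[i] l[j] then 1 else 0 := by
  refine .assign_seq (by simp) <| .assign_seq (by simp [hrow, hl.entry i hi]; omega) ?_
  refine halts_forNeighbors (x := l[i]) (adj := adj)
    (fun k s' => s'.reg present = if l[j] ∈ (adj l[i]).take k then 1 else 0)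
    (hgraph.congr (by simp) (by simp)) (by simp [hrow, hl.entry i hi]) (hdeg _) hMB
    (by simpa) hn (fun k s₁ s₂ h hI => (h.reg _).trans hI) (by simp)
    (fun k hk s' hA hvertex hI => ?_) (fun s' _ hI => by simpa [(hadj l[i]).2] using hI)
  have hcol' : s'.arr list (s'.reg col) = l[j] := by
    rw [hA.arr list, hA.reg col]; simp [hcol, hl.entry j hj]
  have htest : (reg vertex =ₑ arr list (reg col)).eval s' ≠ 0 ↔ l[j] = (adj l[i])[k] := by
    simp [hvertex, hcol', Fin.val_inj, eq_comm]
  have htake : l[j] ∈ (adj l[i]).take (k + 1) ↔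
      l[j] ∈ (adj l[i]).take k ∨ l[j] = (adj l[i])[k] := by
    rw [List.take_succ_eq_append_getElem hk, List.mem_append, List.mem_singleton]
  refine .cond (fun h => .assign (by simpa) ?_) fun h => .skip ?_
  · simp [htake.2 (.inr (htest.1 h))]
  · simp [htake, hI, mt htest.2 (not_not.2 h)]

theorem halts_buildMatrix (hadj : IsAdjacencyList G adj) (hgraph : HoldsGraph adj s)
    (hl : HoldsList l s) (hdeg : ∀ x, (adj x).length ≤ M) (hM : l.length * l.length ≤ M)
    (hMB : M ≤ B) (hB : ∀ v : Fin n, s.arr offsets v ≤ B) (hn : n ≤ B) (hB₁ : 1 ≤ B) :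
    Halts B M buildMatrix s fun s' => TabulatesRel l G.Adj (s'.arr matrix) := by
  classical
  refine .forPairs (fun k s' => TabulatesRelUpTo l G.Adj k (s'.arr matrix)) hl.size hM hMB
    (fun k s₁ s₂ h hI => by simpa only [h.arr matrix] using hI) (by simp [TabulatesRelUpTo])
    (fun a ha b hb s' hA hrow hcol hI => ?_) (fun s' _ => TabulatesRelUpTo.tabulatesRel)
  refine .andThen (halts_testAdjacent hadj (hgraph.congr (hA.arr _) (hA.arr _))
    (hl.congr (hA.reg _) (hA.arr _)) ha hb hrow hcol hdeg hMB (by simpa [hA.arr offsets]) hn hB₁)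
    fun s'' hA' hpresent => .store ?_ ?_
  · simp only [Expr.eval_reg, hpresent]
    split_ifs <;> omega
  · have hsize : s''.reg size = l.length := by rw [hA'.reg size, hA.reg size, hl.size]
    simpa [hA'.reg row, hA'.reg col, hrow, hcol, hsize, hpresent, hA'.arr matrix] using
      hI.update ha hb

end

/-! ### The search program -/

namespace Reg

abbrev found : ℕ := 20
abbrev depth : ℕ := 21
abbrev copy : ℕ := 22
abbrev aliveCount : ℕ := 23
abbrev pairs : ℕ := 24
abbrev pair : ℕ := 25
abbrev fst : ℕ := 26
abbrev snd : ℕ := 27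
abbrev hasConflict : ℕ := 28
abbrev left : ℕ := 29
abbrev right : ℕ := 30
abbrev verdict : ℕ := 31

end Reg

namespace Arr

abbrev stack : ℕ := 4
abbrev status : ℕ := 5
abbrev members : ℕ := 6

end Arr

section Tables

variable {V : Type*} {l : List V}

/-- The cells of the array `a` hold the values of `f` on the list `l`. -/
def Tabulates (l : List V) (f : V → ℕ) (a : ℕ → ℕ) : Prop :=
  ∀ i (hi : i < l.length), a i = f l[i]

open Classical in
/-- The cells of the array `a` hold the indicator function of `S` on the list `l`. -/
def TabulatesSet (l : List V) (S : Finset V) (a : ℕ → ℕ) : Prop :=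
  Tabulates l (fun v => if v ∈ S then 1 else 0) a

/-- The array `a` holds a stack of status vectors on the list `l`. The bottom of the stack, which is
the last entry of `F`, occupies the first cells. -/
def TabulatesStack (l : List V) : List (V → Status) → (ℕ → ℕ) → Prop
  | [], _ => True
  | f :: F, a => Tabulates l (fun v => f v) (fun i => a (F.length * l.length + i)) ∧
      TabulatesStack l F a

theorem Tabulates.update [DecidableEq V] {f : V → ℕ} {a : ℕ → ℕ} {i c : ℕ} {u : V}
    (h : Tabulates l f a) (hl : l.Nodup) (hu : l[i]? = some u) :
    Tabulates l (Function.update f u c) (Function.update a i c) := by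
  obtain ⟨hi, rfl⟩ := List.getElem?_eq_some_iff.1 hu
  intro j hj
  simp [Function.update_apply, hl.getElem_inj_iff, h j hj]

theorem TabulatesStack.congr {F : List (V → Status)} {a a' : ℕ → ℕ} (h : TabulatesStack l F a)
    (ha : ∀ i < F.length * l.length, a' i = a i) : TabulatesStack l F a' := by
  induction F with
  | nil => trivial
  | cons f F ih =>
    rw [List.length_cons, Nat.succ_mul] at ha
    exact ⟨fun i hi => (ha _ (by omega)).trans (h.1 i hi), ih h.2 fun i hi => ha i (by omega)⟩

theorem HoldsInstance.congr {G : SimpleGraph V} {t : ℕ} {s s' : State}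
    (h : HoldsInstance G t l s) (hsize : s'.reg Reg.size = s.reg Reg.size)
    (hparam : s'.reg Reg.param = s.reg Reg.param)
    (hmatrix : s'.arr Arr.matrix = s.arr Arr.matrix) :
    HoldsInstance G t l s' :=
  ⟨hsize.trans h.size, hparam.trans h.param, hmatrix ▸ h.matrix⟩

end Tables

/-- Write the values of `e` for `reg i = 0, …, reg y - 1` to consecutive cells of the array `a`,
starting at the cell `b`. -/
def fill (a : ℕ) (b : Expr) (i y : ℕ) (e : Expr) : Prog := forLoop i y (.store a (b + reg i) e)

theorem halts_fill {V : Type*} {l : List V} {f : V → ℕ} {B M a base i y : ℕ} {b e : Expr}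
    {s : State} (hy : s.reg y = l.length) (hM : l.length ≤ M) (hMB : M ≤ B)
    (hf : ∀ v, f v ≤ B) (hb : ∀ s', Agree [i] [a] s s' → b.eval s' = base)
    (he : ∀ j (hj : j < l.length), ∀ s', Agree [i] [a] s s' → s'.reg i = j → e.eval s' = f l[j])
    (hyi : y ≠ i := by decide) :
    Halts B M (fill a b i y e) s fun s' => Tabulates l f (fun k => s'.arr a (base + k)) ∧
      ∀ k < base, s'.arr a k = s.arr a k := by
  refine .forLoop (fun j s' => (∀ k (hk : k < l.length), k < j → s'.arr a (base + k) = f l[k]) ∧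
    ∀ k < base, s'.arr a k = s.arr a k) hy hM hMB (by simp) (fun j hj s' hA hji hI => ?_)
    (fun s' _ hI => ⟨fun k hk => hI.1 k hk hk, hI.2⟩) (by simp [Prog.regs])
    (by simpa [Prog.regs] using hyi)
  replace hA : Agree [i] [a] s s' :=
    hA.mono (by simp [forLoop, Prog.regs]) (by simp [Prog.arrs])
  refine .store (by rw [he j hj s' hA hji]; exact hf _) ⟨fun k hk hkj => ?_, fun k hk => ?_⟩
  · rcases Nat.lt_succ_iff_lt_or_eq.1 hkj with hlt | rfl
    · simp [hb s' hA, hji, hlt.ne, hI.1 k hk hlt]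
    · simp [hb s' hA, hji, he _ hj s' hA hji]
  · have : k ≠ base + j := by omega
    simp [hb s' hA, hji, this, hI.2 k hk]

/-- Count in the register `x` the rounds `i < reg y` in which `e` has the value `1`. -/
def count (x i y : ℕ) (e : Expr) : Prog := x ::= 0 ;; forLoop i y (x ::= reg x + e)

open Classical in
theorem halts_count {V : Type*} {l : List V} {S : Finset V} {B M x i y : ℕ} {e : Expr} {s : State}
    (hl : l.Nodup) (hS : ∀ v ∈ S, v ∈ l) (hy : s.reg y = l.length) (hM : l.length ≤ M)
    (hMB : M ≤ B)
    (he : ∀ j (hj : j < l.length), ∀ s', Agree [x, i] [] s s' → s'.reg i = j →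
      e.eval s' = if l[j] ∈ S then 1 else 0)
    (hxiy : [y, i, x].Nodup := by decide) :
    Halts B M (count x i y e) s fun s' => s'.reg x = S.card := by
  have hcard : (l.filter (· ∈ S)).length = S.card := by
    rw [← List.toFinset_card_of_nodup (hl.filter _)]
    congr 1
    ext v
    simpa using hS v
  simp only [List.nodup_cons, List.mem_cons, List.not_mem_nil, not_or, or_false] at hxiy
  obtain ⟨⟨hyi, hyx⟩, hix, -⟩ := hxiy
  refine .assign_seq (Nat.zero_le B) <| .forLoop
    (fun j s' => s'.reg x = ((l.take j).filter (· ∈ S)).length) (N := l.length) (by simp [hy, hyx])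
    hM hMB (by simp [Ne.symm hix]) (fun j hj s' hA hji hI => ?_) (fun s' _ hI => ?_)
    (by simp [Prog.regs, hix]) (by simp [Prog.regs, hyi, hyx])
  · have hA : Agree [x, i] [] s s' := ((Agree.refl _ _ s).setReg (by simp)).trans
      (hA.mono (by simp [forLoop, Prog.regs]) (by simp [Prog.arrs]))
    have hsucc : ((l.take (j + 1)).filter (· ∈ S)).length =
        ((l.take j).filter (· ∈ S)).length + if l[j] ∈ S then 1 else 0 := by
      rw [List.take_succ_eq_append_getElem hj, List.filter_append, List.length_append]
      congr 1
      split_ifs with h <;> simp [h]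
    have hle : ((l.take (j + 1)).filter (· ∈ S)).length ≤ l.length :=
      (List.length_filter_le _ _).trans (List.length_take_le' _ _)
    rw [hsucc] at hle
    refine .assign ?_ ?_
    · simpa [he j hj s' hA hji, hI] using hle.trans (hM.trans hMB)
    · simpa [he j hj s' hA hji, hI, Ne.symm hix] using hsucc.symm
  · rwa [List.take_length, hcard] at hI

/-- The program `conf` decides whether the vertices at the positions `left` and `right` are in
conflict within the set in the array `members`; its answer is the register `verdict`. -/
structure DecidesConflict (conf : Prog)
    (bad : ∀ {V : Type}, SimpleGraph V → ℕ → Finset V → V → V → Prop) : Prop where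
  writesAbove : conf.WritesAbove verdict 7
  halts {V : Type} {G : SimpleGraph V} {t B M : ℕ} {l : List V} {S : Finset V} {u w : V}
    {s : State} (hl : l.Nodup) (hinst : HoldsInstance G t l s) (hS : ∀ v ∈ S, v ∈ l)
    (hmem : TabulatesSet l S (s.arr members)) (hu : u ∈ S) (hw : w ∈ S) (huw : u ≠ w)
    (hleft : l[s.reg left]? = some u) (hright : l[s.reg right]? = some w)
    (hM : 4 * l.length ^ 2 ≤ M) (hMB : M ≤ B) :
    Halts B M conf s fun s' => s'.reg verdict ≠ 0 ↔ bad G t S u w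

/-- Pop the topmost status vector, and mark the vertices that it does not delete. -/
def loadTop : Prog :=
  depth ::= reg depth - 1 ;;
  fill status 0 copy size (arr stack (reg depth * reg size + reg copy)) ;;
  fill members 0 copy size (1 - (arr status (reg copy) =ₑ 2))

/-- Unless a conflict is known already, check whether the vertices at the positions `fst` and `snd`
are in conflict. -/
def checkPair (conf : Prog) : Prog :=
  .cond (reg hasConflict) .skip
    (.cond ((arr members (reg fst) * arr members (reg snd)) - (reg fst =ₑ reg snd))
      (left ::= reg fst ;; right ::= reg snd ;; conf ;; hasConflict ::= 0 <ₑ reg verdict)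
      .skip)

/-- Search for a conflict, and remember its vertices in the registers `left` and `right`. -/
def findConflict (conf : Prog) : Prog :=
  hasConflict ::= 0 ;; forPairs pairs pair fst snd size (checkPair conf)

/-- Push the current status vector. -/
def push : Prog :=
  fill stack (reg depth * reg size) copy size (arr status (reg copy)) ;; depth ::= reg depth + 1

/-- Delete the vertex at the position in register `x`, and push the resulting status vector. -/
def deletePush (x : ℕ) : Prog := .store status (reg x) 2 ;; push

/-- Push the branches for the conflict between the vertices `left` and `right`. -/
def pushBranches : Prog :=
  .cond (arr status (reg left)) .skip (deletePush left) ;;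
  .cond (arr status (reg right)) .skip (.store status (reg left) 1 ;; deletePush right)

/-- Test whether at least `target` vertices are marked. -/
def checkSize : Prog :=
  count aliveCount copy size (arr members (reg copy)) ;;
  .cond (reg aliveCount <ₑ reg target) .skip (found ::= 1)

/-- Visit the search tree node on top of the stack. -/
def searchStep (conf : Prog) : Prog :=
  loadTop ;;
  findConflict conf ;;
  .cond (reg hasConflict) pushBranches checkSize

/-- Push the root of the search tree, in which all vertices are undecided, to the empty stack. -/
def pushRoot : Prog := depth ::= 0 ;; fill status 0 copy size 0 ;; push

/-- Search for a conflict-free set of at least `target` listed vertices. -/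
def search (conf : Prog) : Prog := pushRoot ;; .loop (reg depth) (searchStep conf)

section

variable {V : Type} {G : SimpleGraph V} {t K B M : ℕ} {l : List V}
  {f : V → Status} {F : List (V → Status)} {S : Finset V} {u w : V} {s s' : State} {conf : Prog}
  {bad : ∀ {V : Type}, SimpleGraph V → ℕ → Finset V → V → V → Prop}

open Classical in
theorem halts_loadTop (hsize : s.reg size = l.length) (hdepth : s.reg depth = F.length + 1)
    (hstack : TabulatesStack l (f :: F) (s.arr stack)) (hM : l.length ≤ M) (hMB : M ≤ B)
    (hF : F.length ≤ B) (hB : 2 ≤ B) :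
    Halts B M loadTop s fun s' => s'.reg depth = F.length ∧
      Tabulates l (fun v => f v) (s'.arr status) ∧
      TabulatesSet l (alive l.toFinset f) (s'.arr members) := by
  refine .assign_seq (by simpa [hdepth]) <| .andThen (halts_fill (l := l) (f := fun v => f v)
    (base := 0) (by simpa) hM hMB (fun v => (Nat.le_of_lt_succ (f v).2).trans hB) (fun _ _ => rfl)
    fun j hj s' hA hjs => ?_) fun s₁ hA₁ hstatus => (halts_fill (base := 0)
      (f := fun v => if v ∈ alive l.toFinset f then 1 else 0) ?_ hM hMB ?_ (fun _ _ => rfl) ?_).post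
      fun s₂ hA₂ hmem => ⟨?_, ?_, ?_⟩
  · simpa [hA.arr stack, hA.reg depth, hA.reg size, hdepth, hsize, hjs] using hstack.1 j hj
  · simpa [hA₁.reg size]
  · intro v
    split_ifs <;> omega
  · intro j hj s' hA hjs
    have hval : s'.arr status j = f l[j] := by
      simpa [hA.arr status] using hstatus.1 j hj
    have htwo : (f l[j] : ℕ) = 2 ↔ f l[j] = 2 := Fin.val_inj (b := 2)
    by_cases h : f l[j] = 2 <;> simp [hjs, hval, htwo, mem_alive, h]
  · simp [hA₂.reg depth, hA₁.reg depth, hdepth]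
  · simpa [hA₂.arr status] using hstatus.1
  · simpa [TabulatesSet] using hmem.1

/-- The state of the search for a conflict after the first `c` pairs of positions. -/
def SearchedPairs (bad : Finset V → V → V → Prop) (l : List V) (S : Finset V) (c : ℕ)
    (s : State) : Prop :=
  if s.reg hasConflict = 0 then
    ∀ i j (hi : i < l.length) (hj : j < l.length), i * l.length + j < c →
      l[i] ∈ S → l[j] ∈ S → i ≠ j → ¬ bad S l[i] l[j]
  else ∃ u ∈ S, ∃ w ∈ S, u ≠ w ∧ l[s.reg left]? = some u ∧ l[s.reg right]? = some w ∧ bad S u w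

theorem DecidesConflict.checkPair_writesAbove (hconf : DecidesConflict conf bad) :
    (checkPair conf).WritesAbove hasConflict 7 :=
  .cond (by decide) <| .cond (.seq (by decide) <| .seq (by decide) <|
    .seq (hconf.writesAbove.mono (by decide) le_rfl) (by decide)) (by decide)

theorem DecidesConflict.halts_checkPair (hconf : DecidesConflict conf bad) (hl : l.Nodup)
    (hinst : HoldsInstance G t l s) (hS : ∀ v ∈ S, v ∈ l) (hmem : TabulatesSet l S (s.arr members))
    {i j : ℕ} (hi : i < l.length) (hj : j < l.length) (hfst : s.reg fst = i) (hsnd : s.reg snd = j)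
    (hM : 4 * l.length ^ 2 ≤ M) (hMB : M ≤ B)
    (hsearched : SearchedPairs (bad G t) l S (i * l.length + j) s) :
    Halts B M (checkPair conf) s (SearchedPairs (bad G t) l S (i * l.length + j + 1)) := by
  unfold SearchedPairs at hsearched
  have hlB : l.length ≤ B := by nlinarith
  refine .cond (fun h => .skip (by simpa [SearchedPairs, show s.reg hasConflict ≠ 0 from h] using
    hsearched)) fun h => ?_
  have hnone := (if_pos h).mp hsearched
  have htest : ((arr members (reg fst) * arr members (reg snd)) - (reg fst =ₑ reg snd)).eval s ≠ 0 ↔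
      l[i] ∈ S ∧ l[j] ∈ S ∧ i ≠ j := by
    have hmi := hmem i hi
    have hmj := hmem j hj
    by_cases hiS : l[i] ∈ S <;> by_cases hjS : l[j] ∈ S <;> by_cases hij : i = j <;>
      simp_all
  have hsearched_succ {s' : State} (h₀ : s'.reg hasConflict = 0)
      (hij : l[i] ∈ S → l[j] ∈ S → i ≠ j → ¬ bad G t S l[i] l[j]) :
      SearchedPairs (bad G t) l S (i * l.length + j + 1) s' := by
    refine (if_pos h₀).mpr fun i' j' hi' hj' hlt => ?_
    rcases Nat.lt_succ_iff_lt_or_eq.1 hlt with hlt | heq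
    · exact hnone i' j' hi' hj' hlt
    · obtain ⟨rfl, rfl⟩ := (mul_add_inj hj' hj).1 heq
      exact hij
  refine .cond (fun hb => ?_) fun hb => .skip (hsearched_succ h fun hiS hjS hij =>
    absurd hb (htest.2 ⟨hiS, hjS, hij⟩))
  obtain ⟨hiS, hjS, hij⟩ := htest.1 hb
  have huw : l[i] ≠ l[j] := mt hl.getElem_inj_iff.1 hij
  refine .assign_seq (by simp [hfst]; omega) <| .assign_seq (by simp [hsnd]; omega) <|
    .andThen (hconf.halts hl (hinst.congr (by simp) (by simp) (by simp)) hS (by simpa) hiS hjS huw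
      (by simp [hfst]) (by simp [hsnd]) hM hMB) fun s' hA hverdict => ?_
  have hleft : s'.reg left = i := (hconf.writesAbove.reg hA (by decide)).trans (by simp [hfst])
  have hright : s'.reg right = j := (hconf.writesAbove.reg hA (by decide)).trans (by simp [hsnd])
  refine .assign (?_ : ite _ _ _ ≤ B) ?_
  · split_ifs <;> omega
  by_cases hv : s'.reg verdict = 0
  · exact hsearched_succ (by simp [hv]) fun _ _ _ => mt hverdict.2 (not_not.2 hv)
  · rw [SearchedPairs, if_neg (by simp [Nat.pos_iff_ne_zero, hv])]
    exact ⟨_, hiS, _, hjS, huw, by simp [hleft], by simp [hright], hverdict.1 hv⟩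

theorem DecidesConflict.findConflict_writesAbove (hconf : DecidesConflict conf bad) :
    (findConflict conf).WritesAbove pairs 7 := by
  refine .seq (by decide) (.forPairs (hconf.checkPair_writesAbove.mono (by decide) le_rfl))

theorem DecidesConflict.halts_findConflict (hconf : DecidesConflict conf bad) (hl : l.Nodup)
    (hinst : HoldsInstance G t l s) (hS : ∀ v ∈ S, v ∈ l) (hmem : TabulatesSet l S (s.arr members))
    (hM : 4 * l.length ^ 2 ≤ M) (hMB : M ≤ B) :
    Halts B M (findConflict conf) s fun s' =>
      if s'.reg hasConflict = 0 then ConflictFree (bad G t) S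
      else ∃ u ∈ S, ∃ w ∈ S, u ≠ w ∧ l[s'.reg left]? = some u ∧ l[s'.reg right]? = some w ∧
        bad G t S u w := by
  have hwrites : (forPairs pairs pair fst snd size (checkPair conf)).WritesAbove pairs 7 :=
    .forPairs (hconf.checkPair_writesAbove.mono (by decide) le_rfl)
  refine .assign_seq (Nat.zero_le B) <| .forPairs (m := l.length) (SearchedPairs (bad G t) l S)
    (by simp [hinst.size]) (by nlinarith) hMB ?_ ?_ (fun i hi j hj s' hA hfst hsnd hI => ?_)
    (fun s' _ hI => ?_) (by decide) fun x hx hx' => ?_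
  · intro k s₁ s₂ h hI
    simpa only [SearchedPairs, h.reg hasConflict, h.reg left, h.reg right] using hI
  · simp [SearchedPairs]
  · exact hconf.halts_checkPair hl (hinst.congr (hwrites.reg hA (by decide))
      (hwrites.reg hA (by decide)) (hwrites.arr hA (by decide))) hS
      (by rwa [hwrites.arr hA (by decide)]) hi hj hfst hsnd hM hMB hI
  · rw [SearchedPairs] at hI
    split_ifs with h
    · intro u hu w hw huw
      obtain ⟨i, hi, rfl⟩ := List.getElem_of_mem (hS u hu)
      obtain ⟨j, hj, rfl⟩ := List.getElem_of_mem (hS w hw)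
      exact (if_pos h).mp hI i j hi hj (mul_add_lt_mul_self hi hj) hu hw
        fun hij => huw (by simp only [hij])
    · exact (if_neg h).mp hI
  · have hlt : ∀ x ∈ [pairs, pair, size], x < hasConflict := by decide
    exact (hconf.checkPair_writesAbove.1 x hx').not_gt (hlt x hx)

theorem halts_push (hsize : s.reg size = l.length) (hdepth : s.reg depth = F.length)
    (hstatus : Tabulates l (fun v => f v) (s.arr status))
    (hstack : TabulatesStack l F (s.arr stack))
    (hM : l.length ≤ M) (hMB : M ≤ B) (hF : F.length < B) (hB : 2 ≤ B) :
    Halts B M push s fun s' => s'.reg depth = F.length + 1 ∧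
      TabulatesStack l (f :: F) (s'.arr stack) := by
  refine .andThen (halts_fill (f := fun v => f v) (base := F.length * l.length) hsize hM hMB
    (fun v => (Nat.le_of_lt_succ (f v).2).trans hB) (fun s' hA => ?_) fun j hj s' hA hjs => ?_)
    fun s' hA h => .assign ?_ ⟨?_, ?_, hstack.congr h.2⟩
  · simp [hA.reg depth, hA.reg size, hdepth, hsize]
  · simpa [hA.arr status, hjs] using hstatus j hj
  · simpa [hA.reg depth, hdepth] using hF
  · simp [hA.reg depth, hdepth]
  · simpa using h.1

theorem Tabulates.status_update [DecidableEq V] {a : ℕ → ℕ} {i : ℕ} {c : Status}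
    (h : Tabulates l (fun v => f v) a) (hl : l.Nodup) (hu : l[i]? = some u) :
    Tabulates l (fun v => Function.update f u c v) (Function.update a i c) := by
  convert h.update hl hu with v
  simp only [Function.update_apply, apply_ite Fin.val]

theorem halts_deletePush [DecidableEq V] {x : ℕ} (hl : l.Nodup) (hsize : s.reg size = l.length)
    (hdepth : s.reg depth = F.length) (hstatus : Tabulates l (fun v => f v) (s.arr status))
    (hstack : TabulatesStack l F (s.arr stack)) (hu : l[s.reg x]? = some u)
    (hM : l.length ≤ M) (hMB : M ≤ B) (hF : F.length < B) (hB : 2 ≤ B) :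
    Halts B M (deletePush x) s fun s' => s'.reg depth = F.length + 1 ∧
      TabulatesStack l (Function.update f u 2 :: F) (s'.arr stack) ∧
      s'.arr status = Function.update (s.arr status) (s.reg x) 2 :=
  .store_seq hB <| (halts_push (s := s.setArr status (s.reg x) 2) hsize hdepth
    (hstatus.status_update (c := 2) hl hu) hstack hM hMB hF hB).post
      fun _ hA h => ⟨h.1, h.2, hA.arr status⟩

theorem halts_pushBranches [DecidableEq V] (hl : l.Nodup) (hsize : s.reg size = l.length)
    (hdepth : s.reg depth = F.length) (hstatus : Tabulates l (fun v => f v) (s.arr status))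
    (hstack : TabulatesStack l F (s.arr stack)) (hu : l[s.reg left]? = some u)
    (hw : l[s.reg right]? = some w) (huw : u ≠ w) (hM : l.length ≤ M) (hMB : M ≤ B)
    (hF : F.length + 1 < B) (hB : 2 ≤ B) :
    Halts B M pushBranches s fun s' => s'.reg depth = (branches f u w ++ F).length ∧
      TabulatesStack l (branches f u w ++ F) (s'.arr stack) := by
  have hundecided {v : V} {i : ℕ} (hv : l[i]? = some v) : s.arr status i = 0 ↔ f v = 0 := by
    obtain ⟨hi, rfl⟩ := List.getElem?_eq_some_iff.1 hv
    rw [hstatus i hi]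
    exact Fin.val_inj (b := 0)
  have hij : s.reg right ≠ s.reg left := fun h =>
    huw (Option.some.inj (hu.symm.trans (h ▸ hw)))
  set F₁ := (if f u = 0 then [Function.update f u 2] else []) ++ F with hF₁
  have hF₁' : F₁.length ≤ F.length + 1 := by rw [hF₁]; split_ifs <;> simp
  refine .andThen (Q' := fun s' => s'.reg depth = F₁.length ∧ TabulatesStack l F₁ (s'.arr stack) ∧
    ∃ c, s'.arr status = Function.update (s.arr status) (s.reg left) c) ?_ ?_
  · refine .cond (fun h => .skip ?_) fun h => ?_
    · have hfu : f u ≠ 0 := mt (hundecided hu).2 h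
      simp only [hF₁, hfu, if_false, List.nil_append]
      exact ⟨hdepth, hstack, _, (Function.update_eq_self _ _).symm⟩
    · have hfu : f u = 0 := (hundecided hu).1 h
      simp only [hF₁, hfu, if_true, List.cons_append, List.nil_append]
      exact (halts_deletePush hl hsize hdepth hstatus hstack hu hM hMB (by omega) hB).post
        fun s' _ h => ⟨h.1, h.2.1, 2, h.2.2⟩
  · rintro s' hA ⟨hdepth, hstack, c, hstatus'⟩
    have hright : s'.arr status (s'.reg right) = s.arr status (s.reg right) := by
      rw [hA.reg right, hstatus', Function.update_of_ne hij]
    refine .cond (fun h => .skip ?_) fun h => .store_seq (by simp; omega) ?_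
    · have hfw : f w ≠ 0 := mt (hundecided hw).2 (hright ▸ h)
      simpa [branches, hfw, ← hF₁] using ⟨hdepth, hstack⟩
    · have hfw : f w = 0 := (hundecided hw).1 (hright ▸ h)
      have hkept := hstatus.status_update (c := 1) hl hu
      refine (halts_deletePush (s := s'.setArr status (s'.reg left) 1) (f := Function.update f u 1)
        hl (hA.reg size ▸ hsize) hdepth ?_ hstack (hA.reg right ▸ hw) hM hMB (by omega) hB).post
        fun s' _ h => ?_
      · simpa [hA.reg left, hstatus'] using hkept
      · simpa [branches, hfw, ← hF₁] using ⟨h.1, h.2.1⟩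

/-- The invariant of the search: `F` is the stack. -/
structure HoldsSearch (G : SimpleGraph V) (t K : ℕ) (l : List V) (A : Finset V)
    (F : List (V → Status)) (s : State) : Prop where
  inst : HoldsInstance G t l s
  target : s.reg target = K
  depth : s.reg depth = F.length
  stack : TabulatesStack l F (s.arr stack)
  bounded : DepthBounded A F
  found : s.reg found ≤ 1

/-- A sought set is known or can be found from some entry of the stack `F`. -/
def Promising (bad : Finset V → V → V → Prop) (K : ℕ) (A : Finset V) (F : List (V → Status))
    (s : State) : Prop :=
  s.reg found = 1 ∨ ∃ f ∈ F, Extendable bad K A f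

open Classical in
/-- The state while the search visits the node `f` with the stack `F` below it. -/
structure HoldsNode (G : SimpleGraph V) (t K : ℕ) (l : List V) (f : V → Status)
    (F : List (V → Status)) (s : State) : Prop extends HoldsSearch G t K l l.toFinset F s where
  status : Tabulates l (fun v => f v) (s.arr status)
  members : TabulatesSet l (alive l.toFinset f) (s.arr members)
  bounded_cons : DepthBounded l.toFinset (f :: F)

theorem HoldsNode.length_le (h : HoldsNode G t K l f F s) : F.length ≤ l.length := by
  classical
  have := h.bounded_cons.length_le
  rw [List.length_cons] at this
  convert (Nat.le_of_succ_le_succ this).trans (List.toFinset_card_le l)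

theorem HoldsSearch.congr {A : Finset V} (h : HoldsSearch G t K l A F s)
    (hreg : ∀ x ∈ [Reg.size, Reg.param, Reg.target, Reg.depth, Reg.found], s'.reg x = s.reg x)
    (harr : ∀ a ∈ [Arr.matrix, Arr.stack], s'.arr a = s.arr a) : HoldsSearch G t K l A F s' where
  inst := h.inst.congr (hreg _ (by decide)) (hreg _ (by decide)) (harr _ (by decide))
  target := (hreg _ (by decide)).trans h.target
  depth := (hreg _ (by decide)).trans h.depth
  stack := by rw [harr Arr.stack (by decide)]; exact h.stack
  bounded := h.bounded
  found := by rw [hreg Reg.found (by decide)]; exact h.found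

open Classical in
theorem HoldsSearch.halts_loadTop (h : HoldsSearch G t K l l.toFinset (f :: F) s)
    (hM : l.length ≤ M) (hMB : M ≤ B) (hB : l.length + 2 ≤ B) :
    Halts B M loadTop s fun s' =>
      HoldsNode G t K l f F s' ∧ s'.reg Reg.found = s.reg Reg.found := by
  have hF : F.length + 1 ≤ l.length + 1 := h.bounded.length_le.trans
    (Nat.add_le_add_right (List.toFinset_card_le l) 1)
  refine (TwoClub.halts_loadTop h.inst.size h.depth h.stack hM hMB (by omega) (by omega)).post
    fun s' hA h' => ⟨⟨⟨?_, ?_, h'.1, ?_, h.bounded.2, ?_⟩, h'.2.1, h'.2.2, h.bounded⟩, ?_⟩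
  · exact h.inst.congr (hA.reg _) (hA.reg _) (hA.arr _)
  · exact (hA.reg _).trans h.target
  · rw [hA.arr Arr.stack]
    exact h.stack.2
  · rw [hA.reg Reg.found]
    exact h.found
  · exact hA.reg _

theorem DecidesConflict.holdsNode_findConflict (hconf : DecidesConflict conf bad)
    (h : HoldsNode G t K l f F s)
    (hA : Agree (findConflict conf).regs (findConflict conf).arrs s s') :
    HoldsNode G t K l f F s' where
  toHoldsSearch := by
    refine h.congr (fun x hx => hconf.findConflict_writesAbove.reg hA ?_)
      fun a ha => hconf.findConflict_writesAbove.arr hA ?_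
    · exact (by decide : ∀ x ∈ [Reg.size, param, target, depth, found], x < pairs) x hx
    · exact (by decide : ∀ a ∈ [matrix, stack], a < 7) a ha
  status := by
    rw [hconf.findConflict_writesAbove.arr hA (b := Arr.status) (by decide)]
    exact h.status
  members := by
    rw [hconf.findConflict_writesAbove.arr hA (b := Arr.members) (by decide)]
    exact h.members
  bounded_cons := h.bounded_cons

open Classical in
theorem HoldsNode.halts_pushBranches (h : HoldsNode G t K l f F s) (hl : l.Nodup)
    (hu : u ∈ l) (hw : w ∈ l) (huw : u ≠ w) (hleft : l[s.reg left]? = some u)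
    (hright : l[s.reg right]? = some w) (hM : l.length ≤ M) (hMB : M ≤ B)
    (hB : l.length + 2 ≤ B) :
    Halts B M pushBranches s fun s' => HoldsSearch G t K l l.toFinset (branches f u w ++ F) s' ∧
      s'.reg Reg.found = s.reg Reg.found := by
  have hF := h.length_le
  refine (TwoClub.halts_pushBranches hl h.inst.size h.depth h.status h.stack hleft hright huw hM
    hMB (by omega) (by omega)).post fun s' hA h' => ⟨⟨?_, ?_, h'.1, h'.2, ?_, ?_⟩, ?_⟩
  · exact h.inst.congr (hA.reg _) (hA.reg _) (hA.arr _)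
  · exact (hA.reg _).trans h.target
  · exact h.bounded_cons.branches_append (List.mem_toFinset.2 hu) (List.mem_toFinset.2 hw) huw
  · rw [hA.reg Reg.found]
    exact h.found
  · exact hA.reg _

open Classical in
theorem HoldsNode.halts_checkSize (h : HoldsNode G t K l f F s) (hl : l.Nodup)
    (hM : l.length ≤ M) (hMB : M ≤ B) (hB : l.length + 2 ≤ B) :
    Halts B M checkSize s fun s' => HoldsSearch G t K l l.toFinset F s' ∧
      (s'.reg Reg.found = 1 ↔ s.reg Reg.found = 1 ∨ K ≤ (alive l.toFinset f).card) := by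
  have halive : ∀ v ∈ alive l.toFinset f, v ∈ l := fun v hv =>
    List.mem_toFinset.1 (mem_alive.1 hv).1
  refine .andThen (halts_count hl halive h.inst.size hM hMB fun j hj s' hA hjs => ?_)
    fun s' hA hcount => ?_
  · simpa [hA.arr Arr.members, hjs] using h.members j hj
  have hs' : HoldsSearch G t K l l.toFinset F s' := by
    have hne : ∀ x ∈ [Reg.size, param, Reg.target, Reg.depth, Reg.found],
        x ∉ (count aliveCount copy size (arr Arr.members (reg copy))).regs := by decide
    exact h.congr (fun x hx => hA.reg x (hne x hx)) fun a _ =>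
      hA.arr a (by simp [Prog.arrs, count, forLoop])
  have hfound : s'.reg Reg.found = s.reg Reg.found := hA.reg _
  have htest : (reg aliveCount <ₑ reg Reg.target).eval s' = 0 ↔
      K ≤ (alive l.toFinset f).card := by
    simp [hcount, hs'.target]
  refine .cond (fun hb => .skip ⟨hs', ?_⟩) fun hb => .assign (by simp; omega) ⟨?_, ?_⟩
  · rw [hfound, or_iff_left (mt htest.2 hb)]
  · exact ⟨hs'.inst.congr rfl rfl rfl, hs'.target, hs'.depth, hs'.stack, hs'.bounded, le_rfl⟩
  · simp [htest.1 hb]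

open Classical in
theorem DecidesConflict.halts_searchStep (hconf : DecidesConflict conf bad)
    (hbad : Persistent (bad G t)) (hl : l.Nodup)
    (h : HoldsSearch G t K l l.toFinset (f :: F) s) (hM : 4 * l.length ^ 2 ≤ M) (hMB : M ≤ B)
    (hB : l.length + 2 ≤ B) :
    Halts B M (searchStep conf) s fun s' => ∃ F', HoldsSearch G t K l l.toFinset F' s' ∧
      potential l.toFinset F' < potential l.toFinset (f :: F) ∧
      (Promising (bad G t) K l.toFinset F' s' ↔
        Promising (bad G t) K l.toFinset (f :: F) s) := by
  have hlM : l.length ≤ M := by nlinarith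
  refine .andThen (h.halts_loadTop hlM hMB hB) ?_
  rintro s₁ - ⟨hnode₁, hfound₁⟩
  have halive : ∀ v ∈ alive l.toFinset f, v ∈ l := fun v hv =>
    List.mem_toFinset.1 (mem_alive.1 hv).1
  refine .andThen (hconf.halts_findConflict hl hnode₁.inst halive hnode₁.members hM hMB)
    fun s₂ hA hfind => ?_
  have hnode₂ := hconf.holdsNode_findConflict hnode₁ hA
  have hfound₂ : s₂.reg found = s.reg found :=
    (hconf.findConflict_writesAbove.reg hA (by decide)).trans hfound₁
  refine .cond (fun hb => ?_) fun hb => ?_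
  · obtain ⟨u, hu, w, hw, huw, hleft, hright, hconflict⟩ := (if_neg hb).mp hfind
    refine (hnode₂.halts_pushBranches hl (halive u hu) (halive w hw) huw hleft hright hlM hMB
      hB).post fun s₃ _ ⟨hsearch, hfound₃⟩ => ⟨_, hsearch, ?_, ?_⟩
    · exact potential_branches_append_lt (mem_alive.1 hu).1 (mem_alive.1 hw).1 huw
    · have := extendable_iff_branches (K := K) hbad hu hw huw hconflict
      simp only [Promising, hfound₃, hfound₂, List.mem_append, List.mem_cons]
      grind
  · have hcf := (if_pos hb).mp hfind
    refine (hnode₂.halts_checkSize hl hlM hMB hB).post fun s₃ _ ⟨hsearch, hfound₃⟩ =>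
      ⟨F, hsearch, Nat.lt_add_of_pos_left (treeSize_pos _), ?_⟩
    have := extendable_iff_of_conflictFree (K := K) hcf
    simp only [Promising, hfound₃, hfound₂, List.mem_cons]
    grind

theorem DecidesConflict.searchStep_writesAbove (hconf : DecidesConflict conf bad) :
    (searchStep conf).WritesAbove found 4 :=
  .seq (by decide) (.seq (hconf.findConflict_writesAbove.mono (by decide) (by decide))
    (.cond (by decide) (by decide)))

theorem DecidesConflict.search_writesAbove (hconf : DecidesConflict conf bad) :
    (search conf).WritesAbove found 4 :=
  .seq (by decide) hconf.searchStep_writesAbove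

open Classical in
theorem haltsIn_searchLoop (hconf : DecidesConflict conf bad) (hbad : Persistent (bad G t))
    (hl : l.Nodup) (h : HoldsSearch G t K l l.toFinset F s) (hM : 4 * l.length ^ 2 ≤ M)
    (hMB : M ≤ B) (hB : l.length + 2 ≤ B) :
    HaltsIn B (potential l.toFinset F * (2 + (searchStep conf).time M) + 2)
      (.loop (reg depth) (searchStep conf)) s fun s' => s'.reg found ≤ 1 ∧
        (s'.reg found = 1 ↔ Promising (bad G t) K l.toFinset F s) := by
  refine (HaltsIn.loop (b := reg depth) (T := (searchStep conf).time M) (fun r s' =>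
    ∃ F', HoldsSearch G t K l l.toFinset F' s' ∧ potential l.toFinset F' ≤ r ∧
      (Promising (bad G t) K l.toFinset F' s' ↔ Promising (bad G t) K l.toFinset F s))
    ⟨F, h, le_rfl, .rfl⟩ ?_).post ?_
  · rintro r s' - ⟨F', h', hr, hiff⟩ hdepth
    cases F' with
    | nil => exact absurd h'.depth hdepth
    | cons f F' =>
      refine (hconf.halts_searchStep hbad hl h' hM hMB hB).post ?_
      rintro s'' - ⟨F'', h'', hlt, hiff'⟩
      exact ⟨_, hlt.trans_le hr, F'', h'', le_rfl, hiff'.trans hiff⟩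
  · rintro s' - ⟨⟨r, F', h', -, hiff⟩, hdepth⟩
    obtain rfl : F' = [] := List.length_eq_zero_iff.1 (h'.depth.symm.trans hdepth)
    exact ⟨h'.found, by simpa [Promising] using hiff⟩

open Classical in
theorem halts_pushRoot (hinst : HoldsInstance G t l s) (htarget : s.reg target = K)
    (hfound : s.reg found ≤ 1) (hM : l.length ≤ M) (hMB : M ≤ B) (hB : l.length + 2 ≤ B) :
    Halts B M pushRoot s fun s' =>
      HoldsSearch G t K l l.toFinset [fun _ => 0] s' ∧ s'.reg found = s.reg found := by
  refine .assign_seq (Nat.zero_le B) <| .andThen (halts_fill (l := l) (f := fun _ => 0) (base := 0)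
    (by simpa using hinst.size) hM hMB (by simp) (fun _ _ => rfl) fun _ _ _ _ _ => rfl)
    fun s₁ hA₁ hstatus => (halts_push (F := []) (f := fun _ => 0) (l := l) ?_ ?_ ?_ trivial hM hMB
      ?_ ?_).post fun s₂ hA₂ h => ⟨⟨?_, ?_, h.1, h.2, ?_, ?_⟩, ?_⟩
  · simpa [hA₁.reg size] using hinst.size
  · simp [hA₁.reg depth]
  · simpa using hstatus.1
  · simp; omega
  · omega
  · exact hinst.congr (by simp [hA₂.reg size, hA₁.reg size])
      (by simp [hA₂.reg param, hA₁.reg param]) (by simp [hA₂.arr matrix, hA₁.arr matrix])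
  · simpa [hA₂.reg target, hA₁.reg target] using htarget
  · simp [DepthBounded, undecided_zero]
  · simpa [hA₂.reg found, hA₁.reg found] using hfound
  · simp [hA₂.reg found, hA₁.reg found]

open Classical in
theorem haltsIn_search (hconf : DecidesConflict conf bad) (hbad : Persistent (bad G t))
    (hl : l.Nodup) (hinst : HoldsInstance G t l s) (htarget : s.reg target = K)
    (hfound : s.reg found ≤ 1) (hM : 4 * l.length ^ 2 ≤ M) (hM₁ : 1 ≤ M) (hMB : M ≤ B)
    (hB : l.length + 2 ≤ B) :
    HaltsIn B (treeSize l.length * (search conf).time M) (search conf) s fun s' =>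
      s'.reg found ≤ 1 ∧ (s'.reg found = 1 ↔ s.reg found = 1 ∨
        ∃ S ⊆ l.toFinset, ConflictFree (bad G t) S ∧ K ≤ S.card) := by
  have hroot : potential l.toFinset [fun _ => 0] = treeSize l.length := by
    simp [potential, undecided_zero, List.toFinset_card_of_nodup hl]
  refine (HaltsIn.andThen (halts_pushRoot hinst htarget hfound (by nlinarith) hMB hB)
    (T₂ := treeSize l.length * (2 + (searchStep conf).time M) + 2) ?_).mono ?_
  · rintro s₁ - ⟨h, hfound₁⟩
    refine (hroot ▸ haltsIn_searchLoop hconf hbad hl h hM hMB hB).post fun s₂ _ ⟨hle, hiff⟩ =>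
      ⟨hle, ?_⟩
    simp only [hiff, Promising, hfound₁, List.mem_singleton, exists_eq_left, extendable_zero]
  · have hpos := treeSize_pos l.length
    generalize treeSize l.length = τ at hpos
    have hle (P X : ℕ) : P + (τ * X + 2) ≤ τ * (P + (M * X + 2)) := by
      rw [Nat.mul_add, Nat.mul_add]
      exact Nat.add_le_add (Nat.le_mul_of_pos_left _ hpos) (Nat.add_le_add
        (Nat.mul_le_mul_left _ (Nat.le_mul_of_pos_left _ hM₁)) (Nat.le_mul_of_pos_left _ hpos))
    exact hle _ _

end

/-! ### From the search to the problem on graphs -/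

theorem getD_flatMap {α β : Type*} {l : List α} (f : α → List β) (d : β) {v i : ℕ}
    (hv : v < l.length) (hi : i < (f l[v]).length) :
    (l.flatMap f).getD (((l.take v).map fun x => (f x).length).sum + i) d = (f l[v])[i] := by
  rw [flatMap_eq_of_lt_length f hv, ← List.length_flatMap,
    List.getD_append_right _ _ _ _ (Nat.le_add_right _ _), Nat.add_sub_cancel_left,
    List.getD_append _ _ _ _ hi, List.getD_eq_getElem _ _ hi]

section Input

variable {n : ℕ} {adj : Fin n → List (Fin n)} {t k : ℕ}

theorem holdsGraph_inputState : HoldsGraph adj (inputState adj t k) := by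
  constructor
  · intro v
    simp [inputState, v.2.le, List.take_succ_eq_append_getElem]
  · intro v i hi
    have := getD_flatMap (l := List.finRange n) (fun x => (adj x).map Fin.val) 0 (v := v) (i := i)
      (by simp) (by simpa using hi)
    simpa [inputState, v.2.le, List.map_flatMap] using this

theorem inputState_offset_le (hadj : ∀ v, (adj v).Nodup) (v : Fin n) :
    (inputState adj t k).arr offsets v ≤ n * n := by
  simp only [inputState, if_true, if_pos v.2.le]
  refine (List.sum_le_card_nsmul _ n fun x hx => ?_).trans ?_
  · obtain ⟨y, -, rfl⟩ := List.mem_map.1 hx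
    simpa using (hadj y).length_le_card
  · simpa using Nat.mul_le_mul_right n v.2.le

end Input

/-- Search for a conflict-free set in the ball of radius two around the vertex `center`. -/
def searchBall (conf : Prog) : Prog := listBall ;; buildMatrix ;; search conf

/-- Decide whether there is a conflict-free set with at least as many vertices as the value of the
expression `e`. -/
def solve (e : Expr) (conf : Prog) : Prog :=
  target ::= e ;; forLoop center order (searchBall conf) ;; answer ::= reg found

/-- Vertices at distance more than two are in conflict. -/
def IsLocal {V : Type*} (G : SimpleGraph V) (bad : Finset V → V → V → Prop) : Prop :=
  ∀ S, ∀ u ∈ S, ∀ w ∈ S, u ≠ w → ¬ G.Adj u w → (∀ y ∈ S, ¬ (G.Adj u y ∧ G.Adj w y)) → bad S u w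

section Solve

variable {n t K B M D : ℕ} {G : SimpleGraph (Fin n)} {adj : Fin n → List (Fin n)} {s : State}
  {conf : Prog} {bad : ∀ {V : Type}, SimpleGraph V → ℕ → Finset V → V → V → Prop}

theorem exists_subset_ballList_iff [NeZero n] (hadj : IsAdjacencyList G adj)
    {bad : Finset (Fin n) → Fin n → Fin n → Prop} (hloc : IsLocal G bad) :
    (∃ v, ∃ S ⊆ (ballList adj v).toFinset, ConflictFree bad S ∧ K ≤ S.card) ↔
      ∃ S, ConflictFree bad S ∧ K ≤ S.card := by
  refine ⟨fun ⟨_, S, _, h⟩ => ⟨S, h⟩, fun ⟨S, hS, hK⟩ => ?_⟩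
  rcases S.eq_empty_or_nonempty with rfl | ⟨v, hv⟩
  · exact ⟨0, ∅, Finset.empty_subset _, hS, hK⟩
  · refine ⟨v, S, fun x hx => ?_, hS, hK⟩
    simp only [List.mem_toFinset, mem_ballList, (hadj _).2]
    by_contra! h
    refine hS v hv x hx (Ne.symm h.1.1) (hloc S v hv x hx (Ne.symm h.1.1) h.1.2 ?_)
    exact fun y _ ⟨hvy, hxy⟩ => h.2 y (.inr hvy) hxy.symm

theorem haltsIn_searchBall (hconf : DecidesConflict conf bad) (hbad : Persistent (bad G t))
    (hadj : IsAdjacencyList G adj) (hD : ∀ x, (adj x).length ≤ D) {v : Fin n}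
    (hgraph : HoldsGraph adj s) (hv : s.reg center = v) (hparam : s.reg param = t)
    (htarget : s.reg target = K) (hfound : s.reg found ≤ 1) (hM : D + 4 * (D ^ 2 + 1) ^ 2 ≤ M)
    (hMB : M ≤ B) (hoffset : ∀ v : Fin n, s.arr offsets v ≤ B) (hn : n ≤ B) :
    HaltsIn B (treeSize (D ^ 2 + 1) * (searchBall conf).time M) (searchBall conf) s fun s' =>
      s'.reg found ≤ 1 ∧ (s'.reg found = 1 ↔ s.reg found = 1 ∨
        ∃ S ⊆ (ballList adj v).toFinset, ConflictFree (bad G t) S ∧ K ≤ S.card) := by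
  have hlen : (ballList adj v).length ≤ D ^ 2 + 1 := length_ballList_le hD fun x hx =>
    ((hadj x).2 v).2 (((hadj v).2 x).1 hx).symm
  have hsq := Nat.pow_le_pow_left hlen 2
  have hDsq : D ^ 2 + 1 ≤ (D ^ 2 + 1) ^ 2 := Nat.le_self_pow two_ne_zero _
  have hlM : 4 * (ballList adj v).length ^ 2 ≤ M := by omega
  have hDM (x : Fin n) : (adj x).length ≤ M := (hD x).trans (by omega)
  refine (HaltsIn.andThen (halts_listBall hgraph hv (by omega) hDM hMB hoffset hn (by omega))
    (T₂ := buildMatrix.time M + treeSize (D ^ 2 + 1) * (search conf).time M)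
    fun s₁ hA₁ hlist => .andThen (halts_buildMatrix hadj
      (hgraph.congr (hA₁.arr _) (hA₁.arr _)) hlist hDM (by nlinarith) hMB
      (by simpa [hA₁.arr offsets]) hn (by omega)) fun s₂ hA₂ hmatrix => ?_).mono ?_
  · have hinst : HoldsInstance G t (ballList adj v) s₂ :=
      ⟨(hA₂.reg _).trans hlist.size, ((hA₂.reg _).trans (hA₁.reg _)).trans hparam, hmatrix⟩
    have hfound₂ : s₂.reg found = s.reg found := (hA₂.reg _).trans (hA₁.reg _)
    refine ((haltsIn_search hconf hbad nodup_ballList hinst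
      (((hA₂.reg _).trans (hA₁.reg _)).trans htarget) (hfound₂ ▸ hfound) hlM (by omega) hMB
      (by omega)).mono ?_).post fun s₃ _ h => ⟨h.1, ?_⟩
    · exact Nat.mul_le_mul_right _ (treeSize_strictMono.monotone hlen)
    · simp only [h.2, hfound₂, Finset.subset_iff, List.mem_toFinset]
  · have hpos := treeSize_pos (D ^ 2 + 1)
    simp only [searchBall, Prog.time, Nat.mul_add]
    exact Nat.add_le_add (Nat.le_mul_of_pos_left _ hpos)
      (Nat.add_le_add_right (Nat.le_mul_of_pos_left _ hpos) _)

theorem DecidesConflict.searchBall_writesAbove (hconf : DecidesConflict conf bad) :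
    (searchBall conf).WritesAbove size 2 :=
  .seq (by decide) (.seq (by decide) (hconf.search_writesAbove.mono (by decide) (by decide)))

theorem haltsIn_searchBalls (hconf : DecidesConflict conf bad) (hbad : Persistent (bad G t))
    (hadj : IsAdjacencyList G adj) (hD : ∀ x, (adj x).length ≤ D) (hgraph : HoldsGraph adj s)
    (horder : s.reg order = n) (hparam : s.reg param = t) (htarget : s.reg target = K)
    (hfound : s.reg found = 0) (hM : D + 4 * (D ^ 2 + 1) ^ 2 ≤ M) (hMB : M ≤ B)
    (hoffset : ∀ v : Fin n, s.arr offsets v ≤ B) (hn : n ≤ B) :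
    HaltsIn B (2 + (n * (4 + (treeSize (D ^ 2 + 1) * (searchBall conf).time M + 4)) + 4))
      (forLoop center order (searchBall conf)) s fun s' => s'.reg found ≤ 1 ∧ (s'.reg found = 1 ↔
        ∃ v, ∃ S ⊆ (ballList adj v).toFinset, ConflictFree (bad G t) S ∧ K ≤ S.card) := by
  have hforLoop : (forLoop center order (searchBall conf)).WritesAbove center 2 :=
    .seq (by decide) (.seq (hconf.searchBall_writesAbove.mono (by decide) le_rfl) (by decide))
  have hnotMem : ∀ x < size, x ∉ (searchBall conf).regs := fun x hx hx' =>
    (hconf.searchBall_writesAbove.1 x hx').not_gt hx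
  refine .forLoop (fun j s' => s'.reg found ≤ 1 ∧ (s'.reg found = 1 ↔ ∃ v : Fin n, v < j ∧
      ∃ S ⊆ (ballList adj v).toFinset, ConflictFree (bad G t) S ∧ K ≤ S.card)) horder hn
    (hnotMem _ (by decide)) ?_ ?_ (fun j hj s' hA hcenter hI => ?_) fun s' _ h => ?_
  · simpa using hnotMem order (by decide)
  · simp [hfound]
  · have hj' : s'.reg center = (⟨j, hj⟩ : Fin n) := hcenter
    have hreg : ∀ x < center, s'.reg x = s.reg x := fun x hx => hA.reg x fun hx' =>
      (hforLoop.1 x hx').not_gt hx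
    have harr : ∀ a < 2, s'.arr a = s.arr a := fun a ha => hA.arr a fun ha' =>
      (hconf.searchBall_writesAbove.2 a ha').not_gt ha
    refine (haltsIn_searchBall hconf hbad hadj hD (hgraph.congr (harr _ (by decide))
      (harr _ (by decide))) hj' ((hreg _ (by decide)).trans hparam)
      ((hreg _ (by decide)).trans htarget) hI.1 hM hMB (by simpa [harr offsets (by decide)])
      hn).post fun s'' _ h => ⟨h.1, ?_⟩
    simp only [State.reg_setReg]
    grind
  · simpa using h

theorem haltsIn_solve [NeZero n] (hconf : DecidesConflict conf bad) (hbad : Persistent (bad G t))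
    (hloc : IsLocal G (bad G t)) (hadj : IsAdjacencyList G adj)
    (hD : ∀ x, (adj x).length ≤ D) {e : Expr} (he : e.eval s = K) (hgraph : HoldsGraph adj s)
    (horder : s.reg order = n) (hparam : s.reg param = t) (hfound : s.reg found = 0)
    (hM : D + 4 * (D ^ 2 + 1) ^ 2 ≤ M) (hMB : M ≤ B) (hoffset : ∀ v : Fin n, s.arr offsets v ≤ B)
    (hn : n ≤ B) (hK : K ≤ B) :
    HaltsIn B (n * (treeSize (D ^ 2 + 1) * (searchBall conf).time M + 8) + (e.cost + 9))
      (solve e conf) s fun s' => s'.reg answer ≤ 1 ∧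
        (s'.reg answer = 1 ↔ ∃ S, ConflictFree (bad G t) S ∧ K ≤ S.card) := by
  refine (HaltsIn.seq (.assign (he ▸ hK) (.andThen (haltsIn_searchBalls
    (s := s.setReg target (e.eval s)) (K := K) hconf hbad hadj hD (hgraph.congr rfl rfl) horder
    hparam (by simpa) hfound hM hMB hoffset hn) fun s' _ h => .assign ?_ ?_))).mono ?_
  · have hpos : 0 < (D ^ 2 + 1) ^ 2 := by positivity
    exact h.1.trans (by omega)
  · simpa [exists_subset_ballList_iff hadj hloc] using h
  · simp only [Expr.cost]
    linarith

end Solve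

theorem exists_pow_mul_pow_le (a : ℕ) :
    ∃ C : ℝ, ∀ x : ℕ, (x : ℝ) ^ a * 1.6181 ^ x ≤ C * 1.62 ^ x := by
  obtain ⟨C, hC⟩ := (tendsto_pow_const_mul_const_pow_of_abs_lt_one (r := (1.6181 / 1.62 : ℝ)) a
    (by rw [abs_of_pos] <;> norm_num)).bddAbove_range
  refine ⟨C, fun x => ?_⟩
  have h : (x : ℝ) ^ a * (1.6181 / 1.62) ^ x ≤ C := hC ⟨x, rfl⟩
  rwa [div_pow, ← mul_div_assoc, div_le_iff₀ (by positivity)] at h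

theorem exists_treeSize_mul_time_le (p : Prog) : ∃ C : ℝ, ∀ D : ℕ,
    (treeSize (D ^ 2 + 1) * p.time (D + 4 * (D ^ 2 + 1) ^ 2) : ℝ) ≤ C * 1.62 ^ (D ^ 2) := by
  obtain ⟨c, a, hc⟩ := p.exists_time_le
  obtain ⟨C, hpow⟩ := exists_pow_mul_pow_le (2 * a)
  refine ⟨3 * (c * 6 ^ a) * C * 1.62, fun D => ?_⟩
  have htree : (treeSize (D ^ 2 + 1) : ℝ) ≤ 3 * 1.6181 ^ (D ^ 2 + 1) := by
    linarith [treeSize_le (D ^ 2 + 1)]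
  have hM : D + 4 * (D ^ 2 + 1) ^ 2 + 1 ≤ 6 * (D ^ 2 + 1) ^ 2 := by
    linarith [Nat.le_self_pow two_ne_zero D, Nat.le_self_pow two_ne_zero (D ^ 2 + 1)]
  have htime : (p.time (D + 4 * (D ^ 2 + 1) ^ 2) : ℝ) ≤
      c * 6 ^ a * ((D ^ 2 + 1 : ℕ) : ℝ) ^ (2 * a) := by
    have := (hc _).trans (Nat.mul_le_mul_left c (Nat.pow_le_pow_left hM a))
    rw [mul_pow, ← pow_mul, ← mul_assoc] at this
    exact_mod_cast this
  calc (treeSize (D ^ 2 + 1) * p.time (D + 4 * (D ^ 2 + 1) ^ 2) : ℝ)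
      ≤ 3 * 1.6181 ^ (D ^ 2 + 1) * (c * 6 ^ a * ((D ^ 2 + 1 : ℕ) : ℝ) ^ (2 * a)) := by gcongr
    _ = 3 * (c * 6 ^ a) * (((D ^ 2 + 1 : ℕ) : ℝ) ^ (2 * a) * 1.6181 ^ (D ^ 2 + 1)) := by ring
    _ ≤ 3 * (c * 6 ^ a) * (C * 1.62 ^ (D ^ 2 + 1)) :=
        mul_le_mul_of_nonneg_left (hpow _) (by positivity)
    _ = 3 * (c * 6 ^ a) * C * 1.62 * 1.62 ^ (D ^ 2) := by ring

theorem length_le_maxDegree {n : ℕ} {G : SimpleGraph (Fin n)} [DecidableRel G.Adj]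
    {adj : Fin n → List (Fin n)} (hadj : IsAdjacencyList G adj) (v : Fin n) :
    (adj v).length ≤ G.maxDegree := by
  have : (adj v).toFinset = G.neighborFinset v := by
    ext w
    simp [(hadj v).2 w]
  rw [← List.toFinset_card_of_nodup (hadj v).1, this, G.card_neighborFinset_eq_degree]
  exact G.degree_le_maxDegree v

theorem le_two_add_pow_eight {D n : ℕ} (hD : D ≤ n) (t k : ℕ) :
    D + 4 * (D ^ 2 + 1) ^ 2 ≤ (n + t + k + 2) ^ 8 ∧
      n * n + n + t + k + 1 ≤ (n + t + k + 2) ^ 8 := by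
  obtain ⟨x, hx⟩ : ∃ x, x = n + t + k + 2 := ⟨_, rfl⟩
  have hDx : D ^ 2 + 1 ≤ x ^ 2 := by nlinarith
  have h4 : (D ^ 2 + 1) ^ 2 ≤ x ^ 4 := (Nat.pow_le_pow_left hDx 2).trans_eq (by ring)
  have h8 : 16 * x ^ 4 ≤ x ^ 8 := by
    rw [show x ^ 8 = x ^ 4 * x ^ 4 by ring]
    exact Nat.mul_le_mul_right _ (Nat.pow_le_pow_left (show 2 ≤ x by omega) 4)
  have h2 : x ^ 2 ≤ x ^ 4 := Nat.pow_le_pow_right (by omega) (by norm_num)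
  have hlin : x ≤ x ^ 2 := Nat.le_self_pow two_ne_zero x
  rw [← hx]
  constructor <;> nlinarith

open Classical in
theorem exists_exec_solve {conf : Prog}
    {bad : ∀ {V : Type}, SimpleGraph V → ℕ → Finset V → V → V → Prop}
    (hconf : DecidesConflict conf bad) (hbad : ∀ {V : Type} (G : SimpleGraph V) t,
      Persistent (bad G t)) (e : Expr) (K : ℕ → ℕ → ℕ)
    (he : ∀ s : State, e.eval s = K (s.reg param) (s.reg threshold))
    (hK : ∀ t k, K t k ≤ t + k + 1) :
    ∃ C : ℝ, ∀ n, 0 < n → ∀ (G : SimpleGraph (Fin n)) (adj : Fin n → List (Fin n)),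
      IsAdjacencyList G adj → ∀ t k, IsLocal G (bad G t) → ∃ (T : ℕ) (s : State),
        Exec ((n + t + k + 2) ^ 8) (solve e conf) (inputState adj t k) T s ∧
        (T : ℝ) ≤ C * maxDegreeBound n G ∧ s.reg answer ≤ 1 ∧
        (s.reg answer = 1 ↔ ∃ S, ConflictFree (bad G t) S ∧ K t k ≤ S.card) := by
  obtain ⟨C, hC⟩ := exists_treeSize_mul_time_le (searchBall conf)
  refine ⟨C + 8 + (e.cost + 9), fun n hn G adj hadj t k hloc => ?_⟩
  have : NeZero n := ⟨hn.ne'⟩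
  have hDn : G.maxDegree ≤ n := G.maxDegree_le_of_forall_degree_le n fun v => by
    simpa using (G.degree_lt_card_verts v).le
  have hdeg := length_le_maxDegree hadj
  have hbound : maxDegreeBound n G = 1.62 ^ (G.maxDegree ^ 2) * n := rfl
  generalize G.maxDegree = D at hDn hdeg hbound
  obtain ⟨hMB, hnB⟩ := le_two_add_pow_eight hDn t k
  obtain ⟨T, s, hT, hexec, hs⟩ := haltsIn_solve (s := inputState adj t k) (t := t) (e := e)
    (K := K t k) hconf (hbad G t) hloc hadj
    hdeg (by simp [he, inputState]) holdsGraph_inputState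
    (by simp [inputState]) (by simp [inputState]) (by simp [inputState]) le_rfl hMB
    (fun v => (inputState_offset_le (fun v => (hadj v).1) v).trans (by omega)) (by omega)
    ((hK t k).trans (by omega))
  refine ⟨T, s, hexec, ?_, hs⟩
  have hT' : (T : ℝ) ≤ n * (treeSize (D ^ 2 + 1) * (searchBall conf).time
      (D + 4 * (D ^ 2 + 1) ^ 2) + 8) + (e.cost + 9) := by exact_mod_cast hT
  have hpow : (1 : ℝ) ≤ 1.62 ^ (D ^ 2) := one_le_pow₀ (by norm_num)
  have hn' : (1 : ℝ) ≤ n := by exact_mod_cast hn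
  calc (T : ℝ) ≤ n * (C * 1.62 ^ (D ^ 2) + 8) + (e.cost + 9) := by
        have := mul_le_mul_of_nonneg_left (add_le_add_left (hC D) 8) (Nat.cast_nonneg (α := ℝ) n)
        linarith
    _ ≤ n * (C * 1.62 ^ (D ^ 2) + 8 * 1.62 ^ (D ^ 2)) + (e.cost + 9) * (1.62 ^ (D ^ 2) * n) := by
        gcongr
        · linarith
        · exact le_mul_of_one_le_right (by positivity) (one_le_mul_of_one_le_of_one_le hpow hn')
    _ = (C + 8 + (e.cost + 9)) * maxDegreeBound n G := by
        rw [hbound]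
        ring

/-! ### Conflicts in robust and hereditary 2-clubs -/

section CommonNeighbors

variable {V : Type*} {G : SimpleGraph V} {S S' : Finset V} {t : ℕ} {u w z : V}

open Classical in
/-- The common neighbors of `u` and `w` in `S`. -/
noncomputable def commonNeighbors (G : SimpleGraph V) (S : Finset V) (u w : V) : Finset V :=
  S.filter fun z => G.Adj u z ∧ G.Adj w z

theorem mem_commonNeighbors : z ∈ commonNeighbors G S u w ↔ z ∈ S ∧ G.Adj u z ∧ G.Adj w z := by
  classical exact Finset.mem_filter

theorem commonNeighbors_mono (h : S ⊆ S') : commonNeighbors G S u w ⊆ commonNeighbors G S' u w := by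
  classical exact Finset.filter_subset_filter _ h

theorem commonNeighbors_eq_empty_iff :
    commonNeighbors G S u w = ∅ ↔ ∀ z ∈ S, ¬ (G.Adj u z ∧ G.Adj w z) := by
  classical exact Finset.filter_eq_empty_iff

open Classical in
/-- There are fewer than `t` internally disjoint paths of length at most two from `u` to `w` in
`S`. -/
def RobustConflict (G : SimpleGraph V) (t : ℕ) (S : Finset V) (u w : V) : Prop :=
  (commonNeighbors G S u w).card + (if G.Adj u w then 1 else 0) < t

/-- The deletion of at most `t` vertices from `S` can leave `u` and `w` without a path of length at
most two. -/
def HereditaryConflict (G : SimpleGraph V) (t : ℕ) (S : Finset V) (u w : V) : Prop :=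
  ¬ G.Adj u w ∧ (commonNeighbors G S u w).card ≤ t

theorem persistent_robustConflict (G : SimpleGraph V) (t : ℕ) : Persistent (RobustConflict G t) :=
  fun _ _ hS _ _ _ _ h =>
    (Nat.add_le_add_right (Finset.card_le_card (commonNeighbors_mono hS)) _).trans_lt h

theorem persistent_hereditaryConflict (G : SimpleGraph V) (t : ℕ) :
    Persistent (HereditaryConflict G t) := fun _ _ hS _ _ _ _ h =>
  ⟨h.1, (Finset.card_le_card (commonNeighbors_mono hS)).trans h.2⟩

theorem isLocal_robustConflict (ht : t ≠ 0) : IsLocal G (RobustConflict G t) := by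
  intro S u _ w _ _ hadj h
  simpa [RobustConflict, commonNeighbors_eq_empty_iff.2 h, hadj] using Nat.pos_of_ne_zero ht

theorem isLocal_hereditaryConflict : IsLocal G (HereditaryConflict G t) := by
  intro S u _ w _ _ hadj h
  simp [HereditaryConflict, commonNeighbors_eq_empty_iff.2 h, hadj]

end CommonNeighbors

namespace Reg

abbrev common : ℕ := 32
abbrev candidate : ℕ := 33

end Reg

/-- `1` if the vertices `left` and `right` are adjacent, and `0` otherwise. -/
def adjacent : Expr := arr matrix (reg left * reg size + reg right)

/-- Count the common neighbors of the vertices `left` and `right` among the marked vertices. -/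
def countCommon : Prog :=
  count common candidate size (arr members (reg candidate) *
    (arr matrix (reg left * reg size + reg candidate) *
      arr matrix (reg right * reg size + reg candidate)))

/-- Decide whether the vertices `left` and `right` are in conflict in a robust 2-club. -/
def robustConf : Prog := countCommon ;; verdict ::= (reg common + adjacent) <ₑ reg param

/-- Decide whether the vertices `left` and `right` are in conflict in a hereditary 2-club. -/
def hereditaryConf : Prog :=
  countCommon ;; verdict ::= (1 - adjacent) * (reg common <ₑ (reg param + 1))

section

variable {V : Type} {G : SimpleGraph V} {t B M : ℕ} {l : List V} {S : Finset V} {u w : V}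
  {s s' : State}

open Classical in
theorem TabulatesRel.apply_of_getElem? {r : V → V → Prop} {a : ℕ → ℕ} (h : TabulatesRel l r a)
    {i j : ℕ} (hu : l[i]? = some u) (hw : l[j]? = some w) :
    a (i * l.length + j) = if r u w then 1 else 0 := by
  obtain ⟨hi, rfl⟩ := List.getElem?_eq_some_iff.1 hu
  obtain ⟨hj, rfl⟩ := List.getElem?_eq_some_iff.1 hw
  exact h i j hi hj

open Classical in
theorem HoldsInstance.eval_adjacent (h : HoldsInstance G t l s) (hleft : l[s.reg left]? = some u)
    (hright : l[s.reg right]? = some w) : adjacent.eval s = if G.Adj u w then 1 else 0 := by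
  simpa [adjacent, h.size] using h.matrix.apply_of_getElem? hleft hright

theorem HoldsInstance.of_agree_countCommon (h : HoldsInstance G t l s)
    (hA : Agree countCommon.regs countCommon.arrs s s') : HoldsInstance G t l s' :=
  h.congr (hA.reg _) (hA.reg _) (hA.arr _)

theorem halts_countCommon (hl : l.Nodup) (hinst : HoldsInstance G t l s) (hS : ∀ v ∈ S, v ∈ l)
    (hmem : TabulatesSet l S (s.arr members)) (hleft : l[s.reg left]? = some u)
    (hright : l[s.reg right]? = some w) (hM : l.length ≤ M) (hMB : M ≤ B) :
    Halts B M countCommon s fun s' => s'.reg common = (commonNeighbors G S u w).card := by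
  classical
  refine halts_count hl (fun v hv => hS v (mem_commonNeighbors.1 hv).1) hinst.size hM hMB
    fun j hj s' hA hjs => ?_
  have hlj : l[j]? = some l[j] := List.getElem?_eq_getElem hj
  have hadj := hinst.matrix.apply_of_getElem? hleft hlj
  have hadj' := hinst.matrix.apply_of_getElem? hright hlj
  have hmemj := hmem j hj
  simp only [Expr.eval_mul, Expr.eval_arr, Expr.eval_add, Expr.eval_reg, hA.arr members,
    hA.arr matrix, hA.reg left, hA.reg right, hA.reg size, hinst.size, hjs, hadj, hadj', hmemj,
    mem_commonNeighbors]
  split_ifs <;> simp_all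

theorem decidesConflict_robustConf : DecidesConflict robustConf RobustConflict where
  writesAbove := by decide
  halts {V G t B M l S u w s} hl hinst hS hmem _ _ _ hleft hright hM hMB := by
    classical
    refine .andThen (halts_countCommon hl hinst hS hmem hleft hright (by nlinarith) hMB)
      fun s' hA hcommon => ?_
    have hadj := (hinst.of_agree_countCommon hA).eval_adjacent
      (by rwa [hA.reg left]) (by rwa [hA.reg right])
    have hparam : s'.reg param = t := (hA.reg _).trans hinst.param
    have hlpos : l.length ≠ 0 := by
      rintro h; simp [List.length_eq_zero_iff.1 h] at hleft
    have hB : 1 ≤ B := (Nat.one_le_iff_ne_zero.2 (by positivity)).trans (hM.trans hMB)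
    refine .assign (?_ : ite _ _ _ ≤ B) ?_
    · split_ifs <;> omega
    · simp [hadj, hcommon, hparam, RobustConflict]

theorem decidesConflict_hereditaryConf : DecidesConflict hereditaryConf HereditaryConflict where
  writesAbove := by decide
  halts {V G t B M l S u w s} hl hinst hS hmem _ _ _ hleft hright hM hMB := by
    classical
    refine .andThen (halts_countCommon hl hinst hS hmem hleft hright (by nlinarith) hMB)
      fun s' hA hcommon => ?_
    have hadj := (hinst.of_agree_countCommon hA).eval_adjacent
      (by rwa [hA.reg left]) (by rwa [hA.reg right])
    have hparam : s'.reg param = t := (hA.reg _).trans hinst.param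
    have hval : ((1 - adjacent) * (reg common <ₑ (reg param + 1))).eval s' =
        if HereditaryConflict G t S u w then 1 else 0 := by
      simp only [Expr.eval_mul, Expr.eval_sub, Expr.eval_lt, Expr.eval_add, Expr.eval_reg,
        Expr.eval_ofNat, hadj, hcommon, hparam, HereditaryConflict, Nat.lt_succ_iff]
      split_ifs <;> simp_all
    have hlpos : l.length ≠ 0 := by
      rintro h; simp [List.length_eq_zero_iff.1 h] at hleft
    have hB : 1 ≤ B := (Nat.one_le_iff_ne_zero.2 (by positivity)).trans (hM.trans hMB)
    refine .assign ?_ ?_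
    · rw [hval]; split_ifs <;> omega
    · simp [hval]

end

/-! ### Characterizations by conflicts -/

section Characterizations

variable {V : Type*} {G : SimpleGraph V} {S : Finset V} {t : ℕ}

theorem isTwoClub_iff {A : Set V} : IsTwoClub G A ↔
    ∀ u ∈ A, ∀ w ∈ A, u ≠ w → G.Adj u w ∨ ∃ z ∈ A, G.Adj u z ∧ G.Adj w z := by
  have hedist : ∀ u w : A, (G.induce A).edist u w ≤ 2 ↔
      (u ≠ w → G.Adj u w ∨ ∃ z ∈ A, G.Adj u z ∧ G.Adj w z) := by
    intro u w
    rw [← not_lt, SimpleGraph.two_lt_edist_iff, Set.eq_empty_iff_forall_notMem]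
    simp only [SimpleGraph.mem_commonNeighbors, SimpleGraph.comap_adj,
      Function.Embedding.subtype_apply, Subtype.forall, not_and, not_forall, not_not, exists_prop]
    exact forall_congr' fun _ => ⟨fun h => or_iff_not_imp_left.2 h, fun h => h.resolve_left⟩
  simp only [IsTwoClub, SimpleGraph.ediam_le_iff, hedist, Subtype.forall, ne_eq, Subtype.mk.injEq]

theorem isTwoClub_coe_iff : IsTwoClub G (S : Set V) ↔
    ∀ u ∈ S, ∀ w ∈ S, u ≠ w → G.Adj u w ∨ commonNeighbors G S u w ≠ ∅ := by
  simp [isTwoClub_iff, commonNeighbors_eq_empty_iff]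

theorem isHereditaryTwoClub_iff :
    IsHereditaryTwoClub G t S ↔ ConflictFree (HereditaryConflict G t) S := by
  simp only [IsHereditaryTwoClub, isTwoClub_iff]
  constructor
  · rintro h u hu w hw hne ⟨hadj, hcard⟩
    have hsub : commonNeighbors G S u w ⊂ S := (Finset.ssubset_iff_of_subset fun z hz =>
      (mem_commonNeighbors.1 hz).1).2 ⟨u, hu, fun hz => (mem_commonNeighbors.1 hz).2.1.ne rfl⟩
    obtain h | ⟨z, ⟨hz, hz'⟩, h⟩ := h _ hsub hcard
      u ⟨hu, fun hz => (mem_commonNeighbors.1 hz).2.1.ne rfl⟩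
      w ⟨hw, fun hz => (mem_commonNeighbors.1 hz).2.2.ne rfl⟩ hne
    · exact hadj h
    · exact hz' (mem_commonNeighbors.2 ⟨hz, h⟩)
  · intro h U _ hcard u hu w hw hne
    by_contra! hcon
    have hsub : commonNeighbors G S u w ⊆ U := fun z hz => by
      rw [mem_commonNeighbors] at hz
      by_contra hzU
      exact hcon.2 z ⟨hz.1, hzU⟩ hz.2.1 hz.2.2
    exact h u hu.1 w hw.1 hne ⟨hcon.1, (Finset.card_le_card hsub).trans hcard⟩

section Robust

variable {H : SimpleGraph V} {u w : V}

theorem adj_getVert_one {p : H.Walk u w} (hne : u ≠ w) (hp : p.length ≤ 2) :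
    H.Adj u (p.getVert 1) ∧ (p.getVert 1 = w ∨ H.Adj (p.getVert 1) w) := by
  match p with
  | .nil => exact absurd rfl hne
  | .cons h .nil => simpa using h
  | .cons h (.cons h' .nil) => simpa using ⟨h, .inr h'⟩
  | .cons _ (.cons _ (.cons _ _)) => simp at hp

theorem walk_eq_of_getVert_one_eq {p q : H.Walk u w} (hne : u ≠ w) (hp : p.length ≤ 2)
    (hq : q.length ≤ 2) (h : p.getVert 1 = q.getVert 1) : p = q := by
  match p, q with
  | .nil, _ | _, .nil => exact absurd rfl hne
  | .cons _ .nil, .cons _ .nil => rfl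
  | .cons _ .nil, .cons _ (.cons h' .nil) => exact absurd h h'.ne'
  | .cons _ (.cons h' .nil), .cons _ .nil => exact absurd h h'.ne
  | .cons _ (.cons _ .nil), .cons _ (.cons _ .nil) => cases h; rfl
  | .cons _ (.cons _ (.cons _ _)), _ => simp at hp
  | _, .cons _ (.cons _ (.cons _ _)) => simp at hq

open Classical in
/-- The possible second vertices of a path of length at most two from `u` to `w` in `S`. -/
noncomputable def secondVertices (G : SimpleGraph V) (S : Finset V) (u w : V) : Finset V :=
  commonNeighbors G S u w ∪ if G.Adj u w then {w} else ∅

open Classical in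
theorem card_secondVertices : (secondVertices G S u w).card =
    (commonNeighbors G S u w).card + if G.Adj u w then 1 else 0 := by
  unfold secondVertices
  rw [Finset.card_union_of_disjoint]
  · split_ifs <;> simp
  · split_ifs <;> simp [mem_commonNeighbors]

theorem mem_secondVertices {z : V} : z ∈ secondVertices G S u w ↔
    (z ∈ S ∧ G.Adj u z ∧ G.Adj w z) ∨ (z = w ∧ G.Adj u w) := by
  unfold secondVertices
  split_ifs with h <;> simp [mem_commonNeighbors, h, or_comm]

theorem exists_path_of_mem_secondVertices {u w : (S : Set V)} (hne : u ≠ w) {z : V}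
    (hz : z ∈ secondVertices G S u w) :
    ∃ p : (G.induce (S : Set V)).Path u w, p.1.length ≤ 2 ∧ (p.1.getVert 1 : V) = z ∧
      ∀ x ∈ p.1.support, x = u ∨ x = w ∨ (x : V) = z := by
  rcases mem_secondVertices.1 hz with ⟨hzS, huz, hwz⟩ | ⟨rfl, hadj⟩
  · have huz' : (G.induce (S : Set V)).Adj u ⟨z, hzS⟩ := huz
    have hzw' : (G.induce (S : Set V)).Adj ⟨z, hzS⟩ w := hwz.symm
    refine ⟨⟨.cons huz' (.cons hzw' .nil), ?_⟩, by simp, by simp, by simp⟩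
    simp [SimpleGraph.Walk.isPath_def, huz'.ne, hzw'.ne, hne]
  · have hadj' : (G.induce (S : Set V)).Adj u w := hadj
    exact ⟨⟨.cons hadj' .nil, by simp [SimpleGraph.Walk.isPath_def, hne]⟩, by simp, by simp,
      by simp⟩

theorem le_card_secondVertices_iff {u w : (S : Set V)} (hne : u ≠ w) :
    t ≤ (secondVertices G S u w).card ↔
      ∃ P : Fin t → (G.induce (S : Set V)).Path u w, Function.Injective P ∧
        (∀ i, (P i).1.length ≤ 2) ∧ ∀ i j, i ≠ j → ∀ x,
          x ∈ (P i).1.support → x ∈ (P j).1.support → x = u ∨ x = w := by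
  constructor
  · intro hcard
    obtain ⟨e⟩ : Nonempty (Fin t ↪ secondVertices G S (u : V) w) :=
      Function.Embedding.nonempty_iff_card_le.2 (by simpa using hcard)
    choose P hlen hget hsupp using fun i => exists_path_of_mem_secondVertices hne (e i).2
    refine ⟨P, fun i j hij => e.injective (Subtype.ext ?_), hlen, fun i j hij x hxi hxj => ?_⟩
    · rw [← hget i, ← hget j, hij]
    · by_contra! hx
      have hxi' := (hsupp i x hxi).resolve_left hx.1 |>.resolve_left hx.2
      have hxj' := (hsupp j x hxj).resolve_left hx.1 |>.resolve_left hx.2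
      exact hij (e.injective (Subtype.ext (hxi'.symm.trans hxj')))
  · rintro ⟨P, hinj, hlen, -⟩
    have hmem : ∀ i ∈ (Finset.univ : Finset (Fin t)),
        ((P i).1.getVert 1 : V) ∈ secondVertices G S u w := fun i _ => by
      obtain ⟨h, h'⟩ := adj_getVert_one hne (hlen i)
      refine mem_secondVertices.2 (h'.elim (fun hw => .inr ⟨congrArg _ hw, ?_⟩)
        fun hw => .inl ⟨Subtype.prop _, h, hw.symm⟩)
      rwa [hw] at h
    simpa using Finset.card_le_card_of_injOn _ hmem fun i _ j _ hij =>
      hinj (Subtype.ext (walk_eq_of_getVert_one_eq hne (hlen i) (hlen j) (Subtype.ext hij)))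

theorem isRobustTwoClub_iff :
    IsRobustTwoClub G t S ↔ ConflictFree (RobustConflict G t) S := by
  classical
  have hconf : ConflictFree (RobustConflict G t) S ↔
      ∀ u w : (S : Set V), u ≠ w → t ≤ (secondVertices G S u w).card := by
    simp [ConflictFree, RobustConflict, card_secondVertices]
  rw [hconf]
  exact forall₃_congr fun u w hne => (le_card_secondVertices_iff hne).symm

end Robust

section Connected

variable {U : Finset V} {u w : V}

/-- The set `U` separates `u` from `w` in `G[S]`: there is a set `R` that contains `u` but not `w`
and is closed under adjacency in `G[S \ U]`. -/
def Separates (G : SimpleGraph V) (S U : Finset V) (u w : V) : Prop :=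
  u ∉ U ∧ w ∉ U ∧ ∃ R : Set V, u ∈ R ∧ w ∉ R ∧
    ∀ a ∈ R, a ∈ S → a ∉ U → ∀ b ∈ S, b ∉ U → G.Adj a b → b ∈ R

/-- The vertices are not adjacent, and they have no common neighbor or can be separated by fewer
than `t` vertices. -/
def ConnectedConflict (G : SimpleGraph V) (t : ℕ) (S : Finset V) (u w : V) : Prop :=
  ¬ G.Adj u w ∧ (commonNeighbors G S u w = ∅ ∨ ∃ U ⊆ S, U.card < t ∧ Separates G S U u w)

theorem persistent_connectedConflict (G : SimpleGraph V) (t : ℕ) :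
    Persistent (ConnectedConflict G t) := by
  classical
  rintro S S' hS u - w - ⟨hadj, h⟩
  refine ⟨hadj, h.imp
    (fun h => Finset.subset_empty.1 ((commonNeighbors_mono hS).trans h.subset)) ?_⟩
  rintro ⟨U, -, hcard, huU, hwU, R, huR, hwR, hcl⟩
  refine ⟨U ∩ S, Finset.inter_subset_right, (Finset.card_le_card
    Finset.inter_subset_left).trans_lt hcard, by simp [huU], by simp [hwU], R, huR, hwR, ?_⟩
  intro a haR haS haU b hbS hbU hab
  exact hcl a haR (hS haS) (by simpa [haS] using haU) b (hS hbS) (by simpa [hbS] using hbU) hab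

theorem isLocal_connectedConflict : IsLocal G (ConnectedConflict G t) :=
  fun _ _ _ _ _ _ hadj h => ⟨hadj, .inl (commonNeighbors_eq_empty_iff.2 h)⟩

theorem separates_iff_not_reachable (hu : u ∈ (S : Set V) \ U) (hw : w ∈ (S : Set V) \ U) :
    Separates G S U u w ↔ ¬ (G.induce ((S : Set V) \ U)).Reachable ⟨u, hu⟩ ⟨w, hw⟩ := by
  constructor
  · rintro ⟨-, -, R, huR, hwR, hcl⟩ ⟨p⟩
    have hmem : ∀ {x y} (_ : (G.induce ((S : Set V) \ U)).Walk x y), (x : V) ∈ R → (y : V) ∈ R := by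
      intro x y p
      induction p with
      | nil => exact id
      | @cons a b _ hab _ ih => exact fun ha => ih (hcl a ha a.2.1 a.2.2 b b.2.1 b.2.2 hab)
    exact hwR (hmem p huR)
  · intro h
    refine ⟨hu.2, hw.2, {y | ∃ hy, (G.induce ((S : Set V) \ U)).Reachable ⟨u, hu⟩ ⟨y, hy⟩},
      ⟨hu, .refl _⟩, fun ⟨_, h'⟩ => h h', ?_⟩
    rintro a ⟨ha, har⟩ - - b hbS hbU hab
    exact ⟨⟨hbS, hbU⟩, har.trans (SimpleGraph.Adj.reachable hab)⟩

theorem isConnectedTwoClub_iff :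
    IsConnectedTwoClub G t S ↔ t < S.card ∧ ConflictFree (ConnectedConflict G t) S := by
  rw [IsConnectedTwoClub, isTwoClub_coe_iff]
  constructor
  · rintro ⟨hclub, hcard, hconn⟩
    refine ⟨hcard, ?_⟩
    rintro u hu w hw hne ⟨hadj, hempty | ⟨U, hU, hUt, hsep⟩⟩
    · exact (hclub u hu w hw hne).resolve_left hadj hempty
    · exact (separates_iff_not_reachable ⟨hu, hsep.1⟩ ⟨hw, hsep.2.1⟩).1 hsep
        ((hconn U hU hUt).preconnected _ _)
  · rintro ⟨hcard, hfree⟩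
    refine ⟨fun u hu w hw hne => ?_, hcard, fun U hU hUt => ?_⟩
    · by_contra! h
      exact hfree u hu w hw hne ⟨h.1, .inl h.2⟩
    obtain ⟨x, hx⟩ := Finset.exists_mem_notMem_of_card_lt_card (hUt.trans hcard)
    have : Nonempty ((S : Set V) \ (U : Set V) : Set V) := ⟨⟨x, hx⟩⟩
    refine ⟨fun u w => by_contra fun hreach => ?_⟩
    refine hfree u u.2.1 w w.2.1 (fun h => hreach ?_) ⟨fun hadj => hreach ?_,
      .inr ⟨U, hU, hUt, (separates_iff_not_reachable u.2 w.2).2 hreach⟩⟩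
    · rw [Subtype.ext h]
    · exact SimpleGraph.Adj.reachable (show (G.induce _).Adj u w from hadj)

end Connected

end Characterizations

/-! ### Flows and cuts -/

section Residual

variable {ν : Type*} {E E' c : Finset (ν × ν)} {L : List ν} {Q : Set ν} {a b p q src dst : ν}
  {v : ℕ}

open Classical in
/-- The number of arcs that leave the node set `Q`. -/
noncomputable def outCut (E : Finset (ν × ν)) (Q : Set ν) : ℕ :=
  (E.filter fun e => e.1 ∈ Q ∧ e.2 ∉ Q).card

open Classical in
/-- The arcs after sending one unit of flow along the arc from `p` to `q`, which reverses it. -/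
noncomputable def reverseArc (E : Finset (ν × ν)) (p q : ν) : Finset (ν × ν) :=
  insert (q, p) (E.erase (p, q))

theorem mem_reverseArc :
    (a, b) ∈ reverseArc E p q ↔ (a = q ∧ b = p) ∨ (¬(a = p ∧ b = q) ∧ (a, b) ∈ E) := by
  simp [reverseArc]

/-- No two arcs are opposite to each other. -/
def IsOriented (E : Finset (ν × ν)) : Prop := ∀ a b, (a, b) ∈ E → (b, a) ∉ E

theorem IsOriented.reverseArc (hE : IsOriented E) (hpq : (p, q) ∈ E) :
    IsOriented (reverseArc E p q) := by
  intro a b hab hba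
  rw [mem_reverseArc] at hab hba
  have hne : p ≠ q := by rintro rfl; exact hE p p hpq hpq
  rcases hab with ⟨rfl, rfl⟩ | ⟨hab', hab⟩
  · simp [hne] at hba
  · rcases hba with ⟨rfl, rfl⟩ | ⟨-, hba⟩
    · simp at hab'
    · exact hE a b hab hba

open Classical in
theorem outCut_reverseArc (hE : IsOriented E) (hpq : (p, q) ∈ E) (Q : Set ν) :
    outCut (reverseArc E p q) Q + (if p ∈ Q then 1 else 0) =
      outCut E Q + (if q ∈ Q then 1 else 0) := by
  have hqp : (q, p) ∉ E.erase (p, q) := fun h => hE p q hpq (Finset.mem_of_mem_erase h)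
  simp only [outCut, Finset.card_filter, reverseArc, Finset.sum_insert hqp,
    ← Finset.add_sum_erase E _ hpq]
  split_ifs <;> first | omega | simp_all

theorem outCut_eq_zero_iff : outCut E Q = 0 ↔ ∀ a ∈ Q, ∀ b ∉ Q, (a, b) ∉ E := by
  simp only [outCut, Finset.card_eq_zero, Finset.filter_eq_empty_iff, Prod.forall, not_and]
  exact ⟨fun h a ha b hb hab => h a b hab ha hb, fun h a b hab ha hb => h a ha b hb hab⟩

theorem outCut_singleton_lt (hsrc : src ∈ L) (hL : ∀ a b, (a, b) ∈ E → b ∈ L) :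
    outCut E {src} < L.length := by
  classical
  calc outCut E {src} ≤ (L.toFinset.erase src).card := by
        refine Finset.card_le_card_of_injOn Prod.snd ?_ ?_
        · rintro ⟨a, b⟩ h
          obtain ⟨hab, -, hb⟩ := Finset.mem_filter.1 h
          exact Finset.mem_coe.2 (Finset.mem_erase.2 ⟨hb, List.mem_toFinset.2 (hL a b hab)⟩)
        · rintro ⟨a, b⟩ h ⟨a', b'⟩ h' hb
          simp_all
    _ < L.toFinset.card := Finset.card_erase_lt_of_mem (by simpa using hsrc)
    _ ≤ L.length := L.toFinset_card_le

/-- `v` is the minimum number of arcs that leave a node set containing `src` but not `dst`. -/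
def IsMinCut (c : Finset (ν × ν)) (src dst : ν) (v : ℕ) : Prop :=
  (∃ Q : Set ν, src ∈ Q ∧ dst ∉ Q ∧ outCut c Q = v) ∧
    ∀ Q : Set ν, src ∈ Q → dst ∉ Q → v ≤ outCut c Q

theorem IsMinCut.lt_iff {t : ℕ} (h : IsMinCut c src dst v) :
    v < t ↔ ∃ Q : Set ν, src ∈ Q ∧ dst ∉ Q ∧ outCut c Q < t := by
  obtain ⟨⟨Q, hsrc, hdst, hQ⟩, hmin⟩ := h
  exact ⟨fun h => ⟨Q, hsrc, hdst, hQ ▸ h⟩, fun ⟨Q, h, h', hlt⟩ => (hmin Q h h').trans_lt hlt⟩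

/-- `E` is the residual network, with nodes in `L`, of a flow of value `v` from `src` to `dst` in
the network `c` with unit capacities. The flow itself is not recorded: all that matters is that each
cut has lost exactly `v` arcs. -/
structure IsResidual (L : List ν) (c : Finset (ν × ν)) (src dst : ν) (v : ℕ)
    (E : Finset (ν × ν)) : Prop where
  mem : ∀ a b, (a, b) ∈ E → a ∈ L ∧ b ∈ L
  oriented : IsOriented E
  cut : ∀ Q : Set ν, src ∈ Q → dst ∉ Q → outCut E Q + v = outCut c Q

theorem IsResidual.isMinCut (h : IsResidual L c src dst v E) (hsrc : src ∈ Q) (hdst : dst ∉ Q)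
    (hQ : outCut E Q = 0) : IsMinCut c src dst v :=
  ⟨⟨Q, hsrc, hdst, by rw [← h.cut Q hsrc hdst, hQ, zero_add]⟩,
    fun Q' hsrc' hdst' => by rw [← h.cut Q' hsrc' hdst']; exact Nat.le_add_left _ _⟩

theorem IsResidual.lt_length (h : IsResidual L c src dst v E) (hsrc : src ∈ L) (hne : src ≠ dst)
    (hc : ∀ a b, (a, b) ∈ c → b ∈ L) : v < L.length :=
  (Nat.le_add_left _ _).trans_lt
    ((h.cut {src} rfl hne.symm).trans_lt (outCut_singleton_lt hsrc hc))

open Classical in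
/-- `E'` arises from `E` by augmentation along a path from `x` to `dst`. -/
structure IsAugmentedFrom (L : List ν) (dst : ν) (E : Finset (ν × ν)) (x : ν)
    (E' : Finset (ν × ν)) : Prop where
  mem : ∀ a b, (a, b) ∈ E' → a ∈ L ∧ b ∈ L
  oriented : IsOriented E'
  cut : ∀ Q : Set ν, dst ∉ Q → outCut E' Q + (if x ∈ Q then 1 else 0) = outCut E Q

theorem IsResidual.isAugmentedFrom (h : IsResidual L c src dst v E) :
    IsAugmentedFrom L dst E dst E :=
  ⟨h.mem, h.oriented, fun Q hQ => by rw [if_neg hQ, add_zero]⟩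

theorem IsAugmentedFrom.reverseArc (h : IsAugmentedFrom L dst E b E') (hab : (a, b) ∈ E') :
    IsAugmentedFrom L dst E a (reverseArc E' a b) where
  mem x y hxy := by
    rcases mem_reverseArc.1 hxy with ⟨rfl, rfl⟩ | ⟨-, hxy⟩
    · exact (h.mem _ _ hab).symm
    · exact h.mem x y hxy
  oriented := h.oriented.reverseArc hab
  cut Q hQ := by rw [outCut_reverseArc h.oriented hab, h.cut Q hQ]

theorem IsResidual.of_isAugmentedFrom (h : IsResidual L c src dst v E)
    (h' : IsAugmentedFrom L dst E src E') : IsResidual L c src dst (v + 1) E' where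
  mem := h'.mem
  oriented := h'.oriented
  cut Q hsrc hdst := by
    rw [← h.cut Q hsrc hdst, ← h'.cut Q hdst, if_pos hsrc]; ring

end Residual

section SearchTree

variable {ν : Type*} [DecidableEq ν] {E E' : Finset (ν × ν)} {src x : ν} {par par' : ν → ν → Prop}
  {V : Finset ν}

/-- The nodes of `V` can be found by a search from `src` along the arcs in which `a` becomes a
parent of `b`, written `par b a`, when `b` is found through the arc from `a` to `b`. -/
inductive SearchTree (E : Finset (ν × ν)) (src : ν) (par : ν → ν → Prop) : Finset ν → Prop
  | root : SearchTree E src par {src}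
  | grow {V : Finset ν} {a b : ν} : SearchTree E src par V → a ∈ V → b ∉ V → (a, b) ∈ E →
      par b a → SearchTree E src par (insert b V)

theorem SearchTree.congr (h : SearchTree E src par V)
    (hE : ∀ a ∈ V, ∀ b ∈ V, (a, b) ∈ E → (a, b) ∈ E') (hpar : ∀ b ∈ V, ∀ a, par b a → par' b a) :
    SearchTree E' src par' V := by
  induction h with
  | root => exact .root
  | @grow V a b _ ha hb hab hpa ih =>
    refine .grow (ih (fun x hx y hy => hE x ?_ y ?_) fun x hx => hpar x ?_) ha hb
      (hE a ?_ b ?_ hab) (hpar b ?_ a hpa) <;> simp_all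

theorem SearchTree.src_mem (h : SearchTree E src par V) : src ∈ V := by
  induction h with
  | root => exact Finset.mem_singleton_self _
  | grow _ _ _ _ _ ih => exact Finset.mem_insert_of_mem ih

theorem SearchTree.exists_parent (h : SearchTree E src par V) (hx : x ∈ V) (hne : x ≠ src) :
    ∃ V' ⊂ V, SearchTree E src par V' ∧ x ∉ V' ∧ ∃ a ∈ V', par x a ∧ (a, x) ∈ E := by
  induction h with
  | root => exact absurd (Finset.mem_singleton.1 hx) hne
  | @grow V a b h ha hb hab hpa ih =>
    rcases Finset.mem_insert.1 hx with rfl | hx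
    · exact ⟨V, Finset.ssubset_insert hb, h, hb, a, ha, hpa, hab⟩
    · obtain ⟨V', hV', h'⟩ := ih hx
      exact ⟨V', hV'.trans (Finset.ssubset_insert hb), h'⟩

theorem SearchTree.subset_of_outCut_eq_zero {Q : Set ν} (h : SearchTree E src par V)
    (hsrc : src ∈ Q) (hQ : outCut E Q = 0) : ∀ x ∈ V, x ∈ Q := by
  induction h with
  | root => simpa using hsrc
  | @grow V a b _ ha _ hab _ ih =>
    rw [outCut_eq_zero_iff] at hQ
    exact Finset.forall_mem_insert _ _ _ |>.2 ⟨by_contra fun hb => hQ a (ih a ha) b hb hab, ih⟩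

theorem SearchTree.forall_mem {L : List ν} (h : SearchTree E src par V) (hsrc : src ∈ L)
    (hL : ∀ a b, (a, b) ∈ E → b ∈ L) : ∀ x ∈ V, x ∈ L := by
  induction h with
  | root => simpa using hsrc
  | grow _ _ _ hab _ ih => exact Finset.forall_mem_insert _ _ _ |>.2 ⟨hL _ _ hab, ih⟩

theorem SearchTree.card_le_length {L : List ν} (h : SearchTree E src par V) (hsrc : src ∈ L)
    (hL : ∀ a b, (a, b) ∈ E → b ∈ L) : V.card ≤ L.length :=
  (Finset.card_le_card fun x hx => List.mem_toFinset.2 (h.forall_mem hsrc hL x hx)).trans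
    L.toFinset_card_le

end SearchTree

section SplitNetwork

variable {V : Type*} {G : SimpleGraph V} {S U : Finset V} {Q : Set (V ⊕ V)} {u w x y : V} {t : ℕ}

/-- The arcs of the split graph: each vertex `x` is replaced by an arc from `inl x` to `inr x`,
which has to be used by the paths through `x`. -/
def SplitAdj (G : SimpleGraph V) : V ⊕ V → V ⊕ V → Prop
  | .inl x, .inr y => x = y
  | .inr x, .inl y => G.Adj x y
  | _, _ => False

open Classical in
/-- The arcs of the split graph of `G[S]`. -/
noncomputable def splitArcs (G : SimpleGraph V) (S : Finset V) : Finset ((V ⊕ V) × (V ⊕ V)) :=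
  (S.disjSum S ×ˢ S.disjSum S).filter fun e => SplitAdj G e.1 e.2

theorem mem_splitArcs {a b : V ⊕ V} :
    (a, b) ∈ splitArcs G S ↔ (a ∈ S.disjSum S ∧ b ∈ S.disjSum S) ∧ SplitAdj G a b := by
  simp [splitArcs]

theorem isOriented_splitArcs : IsOriented (splitArcs G S) := by
  rintro (x | x) (y | y) hxy hyx <;> simp_all [mem_splitArcs, SplitAdj]

theorem Separates.exists_outCut_le (h : Separates G S U u w) :
    ∃ Q : Set (V ⊕ V), Sum.inr u ∈ Q ∧ Sum.inl w ∉ Q ∧ outCut (splitArcs G S) Q ≤ U.card := by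
  classical
  obtain ⟨huU, hwU, R, huR, hwR, hcl⟩ := h
  refine ⟨{a | a.elim (fun x => x ∈ U ∨ x ∈ R) fun x => x ∉ U ∧ x ∈ R}, ⟨huU, huR⟩,
    not_or.2 ⟨hwU, hwR⟩, ?_⟩
  calc _ ≤ (U.image fun x => ((Sum.inl x : V ⊕ V), (Sum.inr x : V ⊕ V))).card := by
        refine Finset.card_le_card ?_
        rintro ⟨x | x, y | y⟩ h <;>
          simp only [Finset.mem_filter, mem_splitArcs, SplitAdj, Finset.inl_mem_disjSum,
            Finset.inr_mem_disjSum, Set.mem_ofPred_eq, Sum.elim_inl, Sum.elim_inr] at h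
        · exact h.1.2.elim
        · obtain ⟨⟨-, rfl⟩, hQ⟩ := h
          exact Finset.mem_image_of_mem _ (by tauto)
        · obtain ⟨⟨⟨hx, hy⟩, hxy⟩, ⟨hxU, hxR⟩, hyQ⟩ := h
          rw [not_or] at hyQ
          exact absurd (hcl x hxR hx hxU y hy hyQ.1 hxy) hyQ.2
        · exact h.1.2.elim
    _ ≤ U.card := Finset.card_image_le

open Classical in
/-- Vertices that meet all arcs leaving `Q` in the split graph: such an arc is blocked by its head,
unless it enters `w`, when it is blocked by its tail. -/
noncomputable def blockingSet (G : SimpleGraph V) (S : Finset V) (Q : Set (V ⊕ V)) (u w : V) :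
    Finset V :=
  S.filter fun x => x ≠ u ∧ x ≠ w ∧ ((Sum.inl x ∈ Q ∧ Sum.inr x ∉ Q) ∨
    (Sum.inr x ∈ Q ∧ G.Adj x w) ∨ (Sum.inl x ∉ Q ∧ ∃ y ∈ S, Sum.inr y ∈ Q ∧ G.Adj y x))

theorem card_blockingSet_le (hwS : w ∈ S) (hw : Sum.inl w ∉ Q) :
    (blockingSet G S Q u w).card ≤ outCut (splitArcs G S) Q := by
  classical
  refine Finset.card_le_card_of_surjOn (fun e => if e.2 = Sum.inl w then e.1.elim id id else
    e.2.elim id id) fun x hx => ?_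
  simp only [blockingSet, Finset.coe_filter, Set.mem_ofPred_eq] at hx
  simp only [Set.mem_image, Finset.coe_filter, Set.mem_ofPred_eq, Prod.exists, mem_splitArcs]
  obtain ⟨hxS, -, hxw, ⟨hin, hout⟩ | ⟨hout, hxw'⟩ | ⟨hin, y, hy, hyQ, hyx⟩⟩ := hx
  · exact ⟨.inl x, .inr x, by simp [SplitAdj, *], by simp⟩
  · exact ⟨.inr x, .inl w, by simp [SplitAdj, *], by simp⟩
  · exact ⟨.inr y, .inl x, by simp [SplitAdj, *], by simp [hxw]⟩

theorem separates_blockingSet (hne : u ≠ w) (hadj : ¬ G.Adj u w) (hu : Sum.inr u ∈ Q) :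
    Separates G S (blockingSet G S Q u w) u w := by
  refine ⟨by simp [blockingSet], by simp [blockingSet], {x | Sum.inr x ∈ Q ∧ x ≠ w}, ⟨hu, hne⟩,
    fun h => h.2 rfl, ?_⟩
  rintro a ⟨haQ, haw⟩ haS haU b hbS hbU hab
  simp only [blockingSet, Finset.mem_filter, not_and, not_or] at haU hbU
  have haw' : ¬ G.Adj a w := fun h => by
    by_cases hau : a = u
    · exact hadj (hau ▸ h)
    · exact (haU haS hau haw).2.1 haQ h
  have hbw : b ≠ w := fun h => haw' (h ▸ hab)
  refine ⟨?_, hbw⟩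
  by_cases hbu : b = u
  · rwa [hbu]
  obtain ⟨hb, -, hb'⟩ := hbU hbS hbu hbw
  have hbQ : Sum.inl b ∈ Q := by_contra fun h => hb' h ⟨a, haS, haQ, hab⟩
  exact not_not.1 (hb hbQ)

/-- Menger's theorem in its max-flow min-cut form. -/
theorem exists_separates_iff {v : ℕ} (hne : u ≠ w) (hadj : ¬ G.Adj u w) (hwS : w ∈ S)
    (hv : IsMinCut (splitArcs G S) (Sum.inr u) (Sum.inl w) v) :
    (∃ U ⊆ S, U.card < t ∧ Separates G S U u w) ↔ v < t := by
  classical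
  rw [hv.lt_iff]
  constructor
  · rintro ⟨U, -, hU, hsep⟩
    obtain ⟨Q, hu, hw, hQ⟩ := hsep.exists_outCut_le
    exact ⟨Q, hu, hw, hQ.trans_lt hU⟩
  · rintro ⟨Q, hu, hw, hQ⟩
    exact ⟨blockingSet G S Q u w, Finset.filter_subset _ _,
      (card_blockingSet_le hwS hw).trans_lt hQ, separates_blockingSet hne hadj hu⟩

end SplitNetwork

/-! ### The flow program -/

namespace Reg

abbrev nodes : ℕ := 34
abbrev sourceNode : ℕ := 35
abbrev sinkNode : ℕ := 36
abbrev flowValue : ℕ := 37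
abbrev arcs : ℕ := 38
abbrev arc : ℕ := 39
abbrev tail : ℕ := 40
abbrev head : ℕ := 41
abbrev searchRound : ℕ := 42
abbrev current : ℕ := 43
abbrev predecessor : ℕ := 44
abbrev flowRound : ℕ := 45

end Reg

namespace Arr

abbrev residual : ℕ := 7
abbrev reached : ℕ := 8
abbrev parent : ℕ := 9

end Arr

/-- Mark the head of the arc from `tail` to `head` as reached if its tail is reached. -/
def scanArc : Prog :=
  .cond (arr reached (reg tail) * (1 - arr reached (reg head)) *
      arr residual (reg tail * reg nodes + reg head))
    (.store parent (reg head) (reg tail) ;; .store reached (reg head) 1) .skip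

/-- Scan all pairs of nodes. -/
def scanArcs : Prog := forPairs arcs arc tail head nodes scanArc

/-- Find the nodes that can be reached from the source in the residual network. -/
def searchNodes : Prog :=
  fill reached 0 searchRound nodes (reg searchRound =ₑ reg sourceNode) ;;
  forLoop searchRound nodes scanArcs

/-- Reverse the arc that leads from the parent of the node `current` to this node, and move on to
the parent. -/
def augmentStep : Prog :=
  predecessor ::= arr parent (reg current) ;;
  .store residual (reg predecessor * reg nodes + reg current) 0 ;;
  .store residual (reg current * reg nodes + reg predecessor) 1 ;;
  current ::= reg predecessor

/-- Send one unit of flow along the path found by the last search. -/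
def augment : Prog :=
  current ::= reg sinkNode ;; .loop (1 - (reg current =ₑ reg sourceNode)) augmentStep

/-- Augment the flow if this is possible. -/
def flowStep : Prog :=
  searchNodes ;;
  .cond (arr reached (reg sinkNode)) (augment ;; flowValue ::= reg flowValue + 1) .skip

/-- Compute the value of a maximum flow from the source to the sink. -/
def maxFlow : Prog := flowValue ::= 0 ;; forLoop flowRound nodes flowStep

section

variable {ν : Type*} {L : List ν} {E c : Finset (ν × ν)} {src dst a b x y : ν} {i j B M : ℕ}
  {V : Finset ν} {f : ℕ → ℕ} {s s' : State}

/-- The cells of the array `f` form the adjacency matrix of the network with the arcs `E`. -/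
def TabulatesArcs (L : List ν) (E : Finset (ν × ν)) (f : ℕ → ℕ) : Prop :=
  TabulatesRel L (fun a b => (a, b) ∈ E) f

theorem TabulatesArcs.reverseArc (h : TabulatesArcs L E f) (hL : L.Nodup)
    (ha : L[i]? = some a) (hb : L[j]? = some b) (hab : a ≠ b) :
    TabulatesArcs L (reverseArc E a b)
      (Function.update (Function.update f (i * L.length + j) 0) (j * L.length + i) 1) := by
  obtain ⟨hi, rfl⟩ := List.getElem?_eq_some_iff.1 ha
  obtain ⟨hj, rfl⟩ := List.getElem?_eq_some_iff.1 hb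
  intro i' j' hi' hj'
  have hmem : (L[i'], L[j']) ∈ TwoClub.reverseArc E L[i] L[j] ↔
      i' = j ∧ j' = i ∨ ¬(i' = i ∧ j' = j) ∧ (L[i'], L[j']) ∈ E := by
    simp only [mem_reverseArc, hL.getElem_inj_iff]
  simp only [Function.update_apply, mul_add_inj hj' hi, mul_add_inj hj' hj, h i' j' hi' hj', hmem]
  split_ifs <;> simp_all

/-- The data of a flow computation: a network on the nodes in the list `L` with its source and its
sink. -/
structure HoldsNetwork (L : List ν) (src dst : ν) (E : Finset (ν × ν)) (s : State) : Prop where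
  nodes : s.reg nodes = L.length
  source : L[s.reg sourceNode]? = some src
  sink : L[s.reg sinkNode]? = some dst
  arcs : TabulatesArcs L E (s.arr residual)

theorem HoldsNetwork.congr (h : HoldsNetwork L src dst E s)
    (hnodes : s'.reg Reg.nodes = s.reg Reg.nodes)
    (hsource : s'.reg sourceNode = s.reg sourceNode) (hsink : s'.reg sinkNode = s.reg sinkNode)
    (hresidual : s'.arr residual = s.arr residual) : HoldsNetwork L src dst E s' :=
  ⟨hnodes.trans h.nodes, hsource ▸ h.source, hsink ▸ h.sink, hresidual ▸ h.arcs⟩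

/-- The array `f` records `a` as the parent of `b`. -/
def IsParent (L : List ν) (f : ℕ → ℕ) (b a : ν) : Prop :=
  ∃ i, L[i]? = some b ∧ L[f i]? = some a

theorem IsParent.update (h : IsParent L f y x) (hb : L[j]? = some b) (hy : y ≠ b) :
    IsParent L (Function.update f j i) y x := by
  obtain ⟨k, hk, hx⟩ := h
  have hkj : k ≠ j := by
    rintro rfl
    exact hy (Option.some.inj (hk.symm.trans hb))
  exact ⟨k, hk, by rwa [Function.update_of_ne hkj]⟩

theorem IsParent.getElem? (h : IsParent L f b a) (hL : L.Nodup) (hb : L[i]? = some b) :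
    L[f i]? = some a := by
  obtain ⟨k, hk, ha⟩ := h
  obtain ⟨hi, rfl⟩ := List.getElem?_eq_some_iff.1 hb
  obtain ⟨hk', hki⟩ := List.getElem?_eq_some_iff.1 hk
  rwa [hL.getElem_inj_iff.1 hki] at ha

section SearchTree

variable [DecidableEq ν]

/-- The search from the source has reached the nodes in `V`. -/
structure HoldsSearchTree (L : List ν) (E : Finset (ν × ν)) (src : ν) (V : Finset ν) (s : State) :
    Prop where
  reached : TabulatesSet L V (s.arr reached)
  tree : SearchTree E src (IsParent L (s.arr parent)) V

theorem HoldsSearchTree.congr (h : HoldsSearchTree L E src V s)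
    (hreached : s'.arr Arr.reached = s.arr Arr.reached) (hparent : s'.arr parent = s.arr parent) :
    HoldsSearchTree L E src V s' :=
  ⟨hreached ▸ h.reached, hparent ▸ h.tree⟩

theorem HoldsSearchTree.grow (h : HoldsSearchTree L E src V s) (hL : L.Nodup) (ha : L[i]? = some a)
    (hb : L[j]? = some b) (haV : a ∈ V) (hbV : b ∉ V) (hab : (a, b) ∈ E) :
    HoldsSearchTree L E src (insert b V) ((s.setArr parent j i).setArr Arr.reached j 1) where
  reached := by
    obtain ⟨hj, rfl⟩ := List.getElem?_eq_some_iff.1 hb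
    intro k hk
    simp [Function.update_apply, h.reached k hk, hL.getElem_inj_iff]
    split_ifs <;> simp_all
  tree := by
    refine .grow (h.tree.congr (fun _ _ _ _ => id) fun x hx y hxy => ?_) haV hbV hab
      ⟨j, hb, by simpa using ha⟩
    simpa using hxy.update hb (ne_of_mem_of_not_mem hx hbV)

theorem halts_scanArc (hL : L.Nodup) (hnet : HoldsNetwork L src dst E s)
    (hV : HoldsSearchTree L E src V s) (hi : i < L.length) (hj : j < L.length)
    (htail : s.reg tail = i) (hhead : s.reg head = j) (hB : L.length ≤ B) :
    Halts B M scanArc s fun s' => ∃ V', V ⊆ V' ∧ HoldsSearchTree L E src V' s' ∧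
      (V' = V → L[i] ∈ V → (L[i], L[j]) ∈ E → L[j] ∈ V) := by
  have hb : (arr reached (reg tail) * (1 - arr reached (reg head)) *
      arr residual (reg tail * reg nodes + reg head)).eval s ≠ 0 ↔
        L[i] ∈ V ∧ L[j] ∉ V ∧ (L[i], L[j]) ∈ E := by
    simp only [Expr.eval_mul, Expr.eval_sub, Expr.eval_arr, Expr.eval_add, Expr.eval_reg,
      Expr.eval_ofNat, htail, hhead, hnet.nodes, hV.reached i hi, hV.reached j hj,
      hnet.arcs i j hi hj]
    split_ifs <;> simp_all
  refine .cond (fun h => ?_) fun h => ?_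
  · obtain ⟨hiV, hjV, hij⟩ := hb.1 h
    refine .store_seq (by simp [htail]; omega) <| .store (by simp; omega)
      ⟨insert L[j] V, Finset.subset_insert _ _, ?_, fun h => absurd h (by simpa using hjV)⟩
    simpa [htail, hhead] using hV.grow hL (List.getElem?_eq_getElem hi)
      (List.getElem?_eq_getElem hj) hiV hjV hij
  · exact .skip ⟨V, subset_rfl, hV, fun _ hiV hij => by_contra fun hjV => hb.2 ⟨hiV, hjV, hij⟩ h⟩

theorem halts_scanArcs (hL : L.Nodup) (hE : ∀ a b, (a, b) ∈ E → a ∈ L ∧ b ∈ L)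
    (hnet : HoldsNetwork L src dst E s) (hV : HoldsSearchTree L E src V s)
    (hM : L.length * L.length ≤ M) (hMB : M ≤ B) :
    Halts B M scanArcs s fun s' => ∃ V', V ⊆ V' ∧ HoldsSearchTree L E src V' s' ∧
      (V' = V → outCut E V = 0) := by
  refine .forPairs (fun k s' => ∃ V', V ⊆ V' ∧ HoldsSearchTree L E src V' s' ∧
    (V' = V → ∀ i j (_ : i < L.length) (_ : j < L.length), i * L.length + j < k →
      L[i] ∈ V → (L[i], L[j]) ∈ E → L[j] ∈ V)) hnet.nodes hM hMB ?_
    ⟨V, subset_rfl, hV, by simp⟩ ?_ ?_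
  · rintro k s₁ s₂ hA ⟨V', hVV', hV', h⟩
    exact ⟨V', hVV', hV'.congr (hA.arr _) (hA.arr _), h⟩
  · rintro a ha b hb s' hA htail hhead ⟨V', hVV', hV', h⟩
    refine (halts_scanArc hL (hnet.congr (hA.reg _) (hA.reg _) (hA.reg _) (hA.arr _)) hV' ha hb
      htail hhead ((Nat.le_mul_self _).trans (hM.trans hMB))).post ?_
    rintro s'' - ⟨V'', hVV'', hV'', h'⟩
    refine ⟨V'', hVV'.trans hVV'', hV'', ?_⟩
    rintro rfl i j hi hj hij
    obtain rfl : V' = V'' := hVV''.antisymm hVV'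
    rcases Nat.lt_succ_iff_lt_or_eq.1 hij with hlt | heq
    · exact h rfl i j hi hj hlt
    · obtain ⟨rfl, rfl⟩ := (mul_add_inj hj hb).1 heq
      exact h' rfl
  · rintro s' - ⟨V', hVV', hV', h⟩
    refine ⟨V', hVV', hV', fun hVV => outCut_eq_zero_iff.2 fun a ha b hb hab => hb ?_⟩
    obtain ⟨i, hi, rfl⟩ := List.getElem_of_mem (hE a b hab).1
    obtain ⟨j, hj, rfl⟩ := List.getElem_of_mem (hE _ b hab).2
    exact h hVV i j hi hj (mul_add_lt_mul_self hi hj) ha hab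

theorem halts_searchNodes (hL : L.Nodup) (hE : ∀ a b, (a, b) ∈ E → a ∈ L ∧ b ∈ L)
    (hnet : HoldsNetwork L src dst E s) (hM : L.length * L.length ≤ M) (hMB : M ≤ B) :
    Halts B M searchNodes s fun s' => ∃ V, HoldsSearchTree L E src V s' ∧ outCut E V = 0 := by
  have hlen : L.length ≤ M := (Nat.le_mul_self _).trans hM
  obtain ⟨hi, hsrc⟩ := List.getElem?_eq_some_iff.1 hnet.source
  refine .andThen (halts_fill (f := fun v => if v ∈ ({src} : Finset ν) then 1 else 0) (base := 0)
    hnet.nodes hlen hMB ?_ (fun _ _ => rfl) ?_) fun s₁ hA₁ hreached => ?_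
  · intro v
    split_ifs <;> omega
  · intro j hj s' hA hjs
    simp [hjs, hA.reg sourceNode, ← hsrc, hL.getElem_inj_iff]
  have hnet₁ : HoldsNetwork L src dst E s₁ :=
    hnet.congr (hA₁.reg _) (hA₁.reg _) (hA₁.reg _) (hA₁.arr _)
  refine .forLoop (fun j s' => ∃ V, HoldsSearchTree L E src V s' ∧ (outCut E V = 0 ∨ j < V.card))
    hnet₁.nodes hlen hMB ⟨{src}, ⟨fun k hk => ?_, .root⟩, .inr (by simp)⟩ ?_ ?_
  · simpa using hreached.1 k hk
  · rintro j - s' hA - ⟨V, hV, hcard⟩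
    refine (halts_scanArcs hL hE (hnet₁.congr (hA.reg _) (hA.reg _) (hA.reg _) (hA.arr _)) hV
      hM hMB).post ?_
    rintro s'' - ⟨V', hVV', hV', h⟩
    refine ⟨V', hV'.congr rfl rfl, ?_⟩
    by_cases heq : V' = V
    · exact .inl (heq ▸ h heq)
    rcases hcard with hcut | hcard
    · exact absurd (hVV'.antisymm (hV'.tree.subset_of_outCut_eq_zero hV.tree.src_mem hcut))
        (Ne.symm heq)
    · exact .inr (Nat.lt_of_le_of_lt hcard (Finset.card_lt_card (hVV'.ssubset_of_ne (Ne.symm heq))))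
  · rintro s' - ⟨V, hV, hcut | hcard⟩
    · exact ⟨V, hV, hcut⟩
    · exact absurd hcard (hV.tree.card_le_length (List.mem_of_getElem? hnet.source)
        fun a b hab => (hE a b hab).2).not_gt

/-- The flow has been augmented along the path from `x` to the sink in the search tree, of which
the part `V` is left. -/
structure HoldsAugmentation (L : List ν) (E : Finset (ν × ν)) (src dst x : ν) (V : Finset ν)
    (E' : Finset (ν × ν)) (s : State) : Prop where
  nodes : s.reg nodes = L.length
  current : L[s.reg current]? = some x
  mem : x ∈ V
  arcs : TabulatesArcs L E' (s.arr residual)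
  tree : SearchTree E' src (IsParent L (s.arr parent)) V
  augmented : IsAugmentedFrom L dst E x E'

theorem halts_augmentStep {E' : Finset (ν × ν)} (hL : L.Nodup)
    (h : HoldsAugmentation L E src dst x V E' s) (hne : x ≠ src) (hB : L.length ≤ B) :
    Halts B M augmentStep s fun s' => ∃ a V' E'', V' ⊂ V ∧
      HoldsAugmentation L E src dst a V' E'' s' := by
  obtain ⟨V', hV', htree, hxV', a, haV', hxa, hax⟩ := h.tree.exists_parent h.mem hne
  have hparent := hxa.getElem? hL h.current
  have hlt := (List.getElem?_eq_some_iff.1 hparent).1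
  refine .assign_seq (by simpa using hlt.le.trans hB) <| .store_seq (by simp) <|
    .store_seq (by simp; omega) <| .assign (by simpa using hlt.le.trans hB) ⟨a, V',
      reverseArc E' a x, hV', by simpa using h.nodes, by simpa using hparent, haV', ?_, ?_,
      h.augmented.reverseArc hax⟩
  · simpa [h.nodes] using
      h.arcs.reverseArc hL hparent h.current (ne_of_mem_of_not_mem haV' hxV')
  · refine htree.congr (fun b _ b' hb' hbb => mem_reverseArc.2 (.inr ⟨?_, hbb⟩))
      fun b _ b' hbb => by simpa using hbb
    rintro ⟨-, rfl⟩
    exact hxV' hb'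

theorem halts_augment (hL : L.Nodup) (hnet : HoldsNetwork L src dst E s)
    (hV : HoldsSearchTree L E src V s) (hdst : dst ∈ V) (hE : IsAugmentedFrom L dst E dst E)
    (hM : L.length ≤ M) (hMB : M ≤ B) :
    Halts B M augment s fun s' => ∃ E', TabulatesArcs L E' (s'.arr residual) ∧
      IsAugmentedFrom L dst E src E' := by
  have hsink := (List.getElem?_eq_some_iff.1 hnet.sink).1
  obtain ⟨hsource, hsrc⟩ := List.getElem?_eq_some_iff.1 hnet.source
  have hcard := hV.tree.card_le_length (List.mem_of_getElem? hnet.source)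
    fun a b h => (hE.mem a b h).2
  have hloop {x s'} (hA : Agree augmentStep.regs augmentStep.arrs
      (s.setReg current (s.reg sinkNode)) s') (hx : L[s'.reg current]? = some x) :
      (1 - (reg current =ₑ reg sourceNode)).eval s' = 0 ↔ x = src := by
    obtain ⟨hi, rfl⟩ := List.getElem?_eq_some_iff.1 hx
    by_cases h : s'.reg current = s.reg sourceNode <;>
      simp [hA.reg sourceNode, ← hsrc, hL.getElem_inj_iff, h]
  refine .assign_seq (by simp; omega) <| .loop (fun r s' => ∃ x V' E', V'.card = r ∧
    HoldsAugmentation L E src dst x V' E' s') (hcard.trans hM)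
    ⟨dst, V, E, rfl, by simpa using hnet.nodes, by simpa using hnet.sink, hdst,
      by simpa using hnet.arcs, by simpa using hV.tree, hE⟩ ?_ ?_
  · rintro r s' hA ⟨x, V', E', rfl, h⟩ hb
    refine (halts_augmentStep hL h (mt (hloop hA h.current).2 hb) (hM.trans hMB)).post ?_
    rintro s'' - ⟨a, V'', E'', hV'', h'⟩
    exact ⟨_, Finset.card_lt_card hV'', a, V'', E'', rfl, h'⟩
  · rintro r s' hA ⟨x, V', E', -, h⟩ hb
    exact ⟨E', h.arcs, (hloop hA h.current).1 hb ▸ h.augmented⟩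

end SearchTree

theorem halts_flowStep {v : ℕ} (hL : L.Nodup) (hnet : HoldsNetwork L src dst E s)
    (hE : IsResidual L c src dst v E) (hv : s.reg flowValue = v) (hvB : v < B)
    (hM : L.length * L.length ≤ M) (hMB : M ≤ B) :
    Halts B M flowStep s fun s' => ∃ E', TabulatesArcs L E' (s'.arr residual) ∧
      IsResidual L c src dst (s'.reg flowValue) E' ∧
      (s'.reg flowValue = v + 1 ∨ IsMinCut c src dst (s'.reg flowValue)) := by
  classical
  obtain ⟨hi, hdst⟩ := List.getElem?_eq_some_iff.1 hnet.sink
  refine .andThen (halts_searchNodes hL hE.mem hnet hM hMB) fun s' hA => ?_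
  rintro ⟨V, hV, hcut⟩
  have hnet' : HoldsNetwork L src dst E s' :=
    hnet.congr (hA.reg _) (hA.reg _) (hA.reg _) (hA.arr _)
  have hv' : s'.reg flowValue = v := (hA.reg _).trans hv
  have hreached : (arr reached (reg sinkNode)).eval s' ≠ 0 ↔ dst ∈ V := by
    simp [hA.reg sinkNode, hV.reached _ hi, hdst]
  refine .cond (fun h => ?_) fun h => .skip ?_
  · refine .andThen (halts_augment hL hnet' hV (hreached.1 h) hE.isAugmentedFrom
      ((Nat.le_mul_self _).trans hM) hMB) fun s'' hA' => ?_
    rintro ⟨E', hE', haug⟩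
    have hv'' : s''.reg flowValue = v := (hA'.reg _).trans hv'
    refine .assign (by simpa [hv''] using hvB) ⟨E', by simpa using hE', ?_⟩
    simpa [hv''] using hE.of_isAugmentedFrom haug
  · rw [hv']
    exact ⟨E, hnet'.arcs, hE, .inr (hE.isMinCut hV.tree.src_mem (mt hreached.2 (not_not.2 h)) hcut)⟩

theorem halts_maxFlow (hL : L.Nodup) (hnet : HoldsNetwork L src dst c s) (hne : src ≠ dst)
    (hc : ∀ a b, (a, b) ∈ c → a ∈ L ∧ b ∈ L) (hc' : IsOriented c)
    (hM : L.length * L.length ≤ M) (hMB : M ≤ B) :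
    Halts B M maxFlow s fun s' => IsMinCut c src dst (s'.reg flowValue) := by
  have hsrc := List.mem_of_getElem? hnet.source
  have hlt {v E} (h : IsResidual L c src dst v E) : v < L.length :=
    h.lt_length hsrc hne fun a b hab => (hc a b hab).2
  have hlen : L.length ≤ M := (Nat.le_mul_self _).trans hM
  refine .assign_seq (by simp) <| .forLoop (fun j s' => ∃ E, TabulatesArcs L E (s'.arr residual) ∧
    IsResidual L c src dst (s'.reg flowValue) E ∧
    (s'.reg flowValue = j ∨ IsMinCut c src dst (s'.reg flowValue))) (by simpa using hnet.nodes)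
    hlen hMB ⟨c, by simpa using hnet.arcs, by simpa using ⟨hc, hc', fun _ _ _ => rfl⟩, by simp⟩
    ?_ ?_
  · rintro j hj s' hA - ⟨E, hE, hres, h⟩
    have hnet' : HoldsNetwork L src dst E s' :=
      ⟨(hA.reg _).trans (by simpa using hnet.nodes), by rw [hA.reg sourceNode]; exact hnet.source,
        by rw [hA.reg sinkNode]; exact hnet.sink, hE⟩
    refine (halts_flowStep hL hnet' hres rfl ((hlt hres).trans_le (hlen.trans hMB)) hM hMB).post ?_
    rintro s'' - ⟨E', hE', hres', h'⟩
    refine ⟨E', by simpa using hE', by simpa using hres', ?_⟩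
    have hnext (hmin : IsMinCut c src dst (s'.reg flowValue)) :
        s''.reg flowValue ≠ s'.reg flowValue + 1 := by
      intro h
      obtain ⟨Q, hsrcQ, hdstQ, hQ⟩ := hmin.1
      have := hres'.cut Q hsrcQ hdstQ
      omega
    rcases h with rfl | h
    · simpa using h'
    · exact .inr (by simpa using h'.resolve_left (hnext h))
  · rintro s' - ⟨E, -, hres, h | h⟩
    · exact absurd (hlt hres) (by omega)
    · exact h

end

/-! ### Conflicts in connected 2-clubs -/

/-- `1` if there is an arc of the split graph from the node `tail` to the node `head`, and `0`
otherwise. The node `i < reg size` is the first copy of the vertex `i`, and `reg size + i` is the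
second one. -/
def splitEntry : Expr :=
  (reg tail + reg size =ₑ reg head) * arr members (reg tail) +
    (1 - (reg tail <ₑ reg size)) * (reg head <ₑ reg size) *
      (arr members (reg tail - reg size) * arr members (reg head) *
        arr matrix ((reg tail - reg size) * reg size + reg head))

/-- Write the adjacency matrix of the split graph to the array `residual`. -/
def buildNetwork : Prog :=
  forPairs arcs arc tail head nodes (.store residual (reg tail * reg nodes + reg head) splitEntry)

/-- Decide whether fewer than `reg param` vertices separate the nonadjacent vertices `left` and
`right`. -/
def separationConf : Prog :=
  nodes ::= 2 * reg size ;;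
  buildNetwork ;;
  sourceNode ::= reg left + reg size ;;
  sinkNode ::= reg right ;;
  maxFlow ;;
  verdict ::= reg flowValue <ₑ reg param

/-- Decide whether the vertices `left` and `right` are in conflict in a connected 2-club. -/
def connectedConf : Prog :=
  .cond adjacent (verdict ::= 0)
    (countCommon ;; .cond (reg common) separationConf (verdict ::= 1))

section

variable {V : Type} {G : SimpleGraph V} {t B M i : ℕ} {l : List V} {S : Finset V} {u w : V}
  {s s' : State}

/-- The nodes of the split graph in the order of their numbers. -/
def splitNodes (l : List V) : List (V ⊕ V) := l.map Sum.inl ++ l.map Sum.inr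

theorem length_splitNodes : (splitNodes l).length = 2 * l.length := by
  simp [splitNodes, two_mul]

theorem nodup_splitNodes (hl : l.Nodup) : (splitNodes l).Nodup :=
  List.nodup_append'.2 ⟨hl.map Sum.inl_injective, hl.map Sum.inr_injective, by
    simp [List.disjoint_left]⟩

theorem mem_splitNodes_of_mem_splitArcs (hS : ∀ v ∈ S, v ∈ l) {a b : V ⊕ V}
    (h : (a, b) ∈ splitArcs G S) : a ∈ splitNodes l ∧ b ∈ splitNodes l := by
  have hmem {c : V ⊕ V} (hc : c ∈ S.disjSum S) : c ∈ splitNodes l := by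
    rcases c with x | x <;> simp_all [splitNodes]
  exact (mem_splitArcs.1 h).1.imp hmem hmem

theorem getElem?_splitNodes_inl (hu : l[i]? = some u) : (splitNodes l)[i]? = some (.inl u) := by
  obtain ⟨hi, rfl⟩ := List.getElem?_eq_some_iff.1 hu
  simp [splitNodes, List.getElem?_append, hi]

theorem getElem?_splitNodes_inr (hu : l[i]? = some u) :
    (splitNodes l)[i + l.length]? = some (.inr u) := by
  obtain ⟨hi, rfl⟩ := List.getElem?_eq_some_iff.1 hu
  simp [splitNodes, hi]

theorem getElem_splitNodes_cases (hi : i < (splitNodes l).length) :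
    (∃ h : i < l.length, (splitNodes l)[i] = .inl l[i]) ∨
      ∃ k, ∃ h : k < l.length, i = k + l.length ∧ (splitNodes l)[i] = .inr l[k] := by
  rw [length_splitNodes] at hi
  by_cases h : i < l.length
  · exact .inl ⟨h, by simp [splitNodes, h]⟩
  · exact .inr ⟨i - l.length, by omega, by omega, by simp [splitNodes, List.getElem_append, h]⟩

open Classical in
theorem eval_splitEntry {j : ℕ} (hl : l.Nodup) (hinst : HoldsInstance G t l s)
    (hmem : TabulatesSet l S (s.arr members)) (htail : s.reg tail = i) (hhead : s.reg head = j)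
    (hi : i < (splitNodes l).length) (hj : j < (splitNodes l).length) :
    splitEntry.eval s =
      if ((splitNodes l)[i], (splitNodes l)[j]) ∈ splitArcs G S then 1 else 0 := by
  simp only [splitEntry, Expr.eval_add, Expr.eval_mul, Expr.eval_sub, Expr.eval_eq, Expr.eval_lt,
    Expr.eval_reg, Expr.eval_arr, Expr.eval_ofNat, htail, hhead, hinst.size]
  rcases getElem_splitNodes_cases hi with ⟨hi', hli⟩ | ⟨i, hi', rfl, hli⟩ <;>
    rcases getElem_splitNodes_cases hj with ⟨hj', hlj⟩ | ⟨j, hj', rfl, hlj⟩ <;>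
    rw [hli, hlj]
  · have hne : i + l.length ≠ j := by omega
    simp [mem_splitArcs, SplitAdj, hi', hne]
  · by_cases hij : i = j
    · subst hij
      simp [mem_splitArcs, SplitAdj, hi', hmem i hi']
    · simp [mem_splitArcs, SplitAdj, hi', hij, hl.getElem_inj_iff]
  · have hne : i + l.length + l.length ≠ j := by omega
    simp only [hne, hj', hmem i hi', hmem j hj', hinst.matrix i j hi' hj', mem_splitArcs, SplitAdj,
      Finset.inl_mem_disjSum, Finset.inr_mem_disjSum, add_tsub_cancel_right]
    split_ifs <;> simp_all
  · have hne : i + l.length ≠ j := by omega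
    simp [mem_splitArcs, SplitAdj, hne]

theorem halts_buildNetwork (hl : l.Nodup) (hinst : HoldsInstance G t l s)
    (hmem : TabulatesSet l S (s.arr members)) (hnodes : s.reg nodes = (splitNodes l).length)
    (hM : (splitNodes l).length * (splitNodes l).length ≤ M) (hMB : M ≤ B) :
    Halts B M buildNetwork s fun s' =>
      TabulatesArcs (splitNodes l) (splitArcs G S) (s'.arr residual) := by
  classical
  refine .forPairs (fun k s' => TabulatesRelUpTo (splitNodes l) (fun a b => (a, b) ∈ splitArcs G S)
      k (s'.arr residual)) hnodes hM hMB
    (fun k s₁ s₂ h hI => by simpa only [h.arr residual] using hI) (by simp [TabulatesRelUpTo])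
    (fun i hi j hj s' hA htail hhead hI => ?_) (fun s' _ => TabulatesRelUpTo.tabulatesRel)
  have heval := eval_splitEntry hl (hinst.congr (hA.reg _) (hA.reg _) (hA.arr _))
    (by rwa [hA.arr members]) htail hhead hi hj
  refine .store ?_ ?_
  · rw [heval]
    split_ifs <;> nlinarith
  · convert hI.update hi hj using 1
    simp [heval, htail, hhead, hA.reg Reg.nodes, hnodes]
    congr

theorem halts_separationConf (hl : l.Nodup) (hinst : HoldsInstance G t l s)
    (hS : ∀ v ∈ S, v ∈ l) (hmem : TabulatesSet l S (s.arr members)) (hw : w ∈ S) (hne : u ≠ w)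
    (hadj : ¬ G.Adj u w) (hleft : l[s.reg left]? = some u) (hright : l[s.reg right]? = some w)
    (hM : 4 * l.length ^ 2 ≤ M) (hMB : M ≤ B) :
    Halts B M separationConf s fun s' =>
      s'.reg verdict ≠ 0 ↔ ∃ U ⊆ S, U.card < t ∧ Separates G S U u w := by
  have hlen : (splitNodes l).length = 2 * l.length := length_splitNodes
  have hM' : (splitNodes l).length * (splitNodes l).length ≤ M := by rw [hlen]; linarith
  have hlt := (List.getElem?_eq_some_iff.1 hleft).1
  have hlt' := (List.getElem?_eq_some_iff.1 hright).1
  have hB : 2 * l.length ≤ B := by nlinarith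
  refine .assign_seq (by simpa [hinst.size] using hB) ?_
  refine .andThen (halts_buildNetwork (l := l) (S := S) (G := G) (t := t) hl
    (hinst.congr (by simp) (by simp) (by simp)) (by simpa using hmem)
    (by simp [hinst.size, hlen]) hM' hMB) fun s₁ hA₁ harcs => ?_
  have hleft₁ : s₁.reg left = s.reg left := hA₁.reg left
  have hright₁ : s₁.reg right = s.reg right := hA₁.reg right
  have hsize₁ : s₁.reg size = l.length := (hA₁.reg size).trans hinst.size
  have hnodes₁ : s₁.reg nodes = (splitNodes l).length := by
    simp [hA₁.reg Reg.nodes, hlen, hinst.size]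
  refine .assign_seq (by simp [hleft₁, hsize₁]; omega) <| .assign_seq (by simp [hright₁]; omega) <|
    .andThen (halts_maxFlow (nodup_splitNodes hl) (src := .inr u) (dst := .inl w)
      ⟨by simpa using hnodes₁, by simpa [hleft₁, hsize₁] using getElem?_splitNodes_inr hleft,
        by simpa [hright₁] using getElem?_splitNodes_inl hright, by simpa using harcs⟩ (by simp)
      (fun a b => mem_splitNodes_of_mem_splitArcs hS) isOriented_splitArcs hM' hMB)
      fun s₂ hA₂ hcut => ?_
  have hparam : s₂.reg param = t := (hA₂.reg _).trans ((hA₁.reg _).trans hinst.param)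
  rw [exists_separates_iff hne hadj hw hcut]
  refine .assign (?_ : ite _ _ _ ≤ B) ?_
  · split_ifs <;> omega
  · simp [hparam]

theorem decidesConflict_connectedConf : DecidesConflict connectedConf ConnectedConflict where
  writesAbove := by decide
  halts {V G t B M l S u w s} hl hinst hS hmem _ hw hne hleft hright hM hMB := by
    classical
    have hB : 1 ≤ B := by
      have := (List.getElem?_eq_some_iff.1 hleft).1
      nlinarith
    have hadj := hinst.eval_adjacent hleft hright
    refine .cond (fun h => .assign (by simp) ?_) fun h => ?_
    · simp_all [ConnectedConflict]
    refine .andThen (halts_countCommon hl hinst hS hmem hleft hright (by nlinarith) hMB)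
      fun s' hA hcommon => ?_
    replace hadj : ¬ G.Adj u w := by simpa [hadj] using h
    refine .cond (fun h => ?_) fun h => .assign (by simpa) ?_
    · refine (halts_separationConf hl (hinst.of_agree_countCommon hA) hS (by rwa [hA.arr members])
        hw hne hadj (by rwa [hA.reg left]) (by rwa [hA.reg right]) hM hMB).post ?_
      rintro s'' - hs''
      simp_all [ConnectedConflict]
    · simp_all [ConnectedConflict]

end

/-! ### The three problems -/

theorem solvableInTime_of_exec
    {Club : ∀ n : ℕ, SimpleGraph (Fin n) → ℕ → Finset (Fin n) → Prop}
    {f : ∀ n : ℕ, SimpleGraph (Fin n) → ℝ} (p : Prog) (c : ℕ) (C : ℝ)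
    (h : ∀ n, 0 < n → ∀ (G : SimpleGraph (Fin n)) (adj : Fin n → List (Fin n)),
      IsAdjacencyList G adj → ∀ t k, ∃ (T : ℕ) (s : State),
        Exec ((n + t + k + 2) ^ c) p (inputState adj t k) T s ∧ (T : ℝ) ≤ C * f n G ∧
        s.reg answer ≤ 1 ∧ (s.reg answer = 1 ↔ ∃ S, Club n G t S ∧ k ≤ S.card)) :
    SolvableInTime Club f := by
  refine ⟨p, c, C, fun n hn G adj hadj t k => ?_⟩
  obtain ⟨T, s, hexec, hT, hle, hanswer⟩ := h n hn G adj hadj t k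
  exact ⟨T, s, hexec, hT, hanswer.2,
    fun hno => Nat.lt_one_iff.1 <| hle.lt_of_ne fun h => hno (hanswer.1 h)⟩

theorem solvableInTime_hereditary :
    SolvableInTime (fun _ G t S => IsHereditaryTwoClub G t S) maxDegreeBound := by
  obtain ⟨C, hC⟩ := exists_exec_solve decidesConflict_hereditaryConf
    persistent_hereditaryConflict (reg threshold) (fun _ k => k) (fun _ => rfl) fun t k => by omega
  refine solvableInTime_of_exec (solve (reg threshold) hereditaryConf) 8 C
    fun n hn G adj hadj t k => ?_
  simpa only [isHereditaryTwoClub_iff] using hC n hn G adj hadj t k isLocal_hereditaryConflict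

theorem solvableInTime_connected :
    SolvableInTime (fun _ G t S => IsConnectedTwoClub G t S) maxDegreeBound := by
  -- The condition `t < S.card` is part of the size requirement `max k (t + 1) ≤ S.card`.
  obtain ⟨C, hC⟩ := exists_exec_solve decidesConflict_connectedConf persistent_connectedConflict
    (reg threshold + (reg param + 1 - reg threshold)) (fun t k => k + (t + 1 - k))
    (fun _ => rfl) fun t k => by omega
  refine solvableInTime_of_exec
    (solve (reg threshold + (reg param + 1 - reg threshold)) connectedConf) 8 C
    fun n hn G adj hadj t k => ?_
  have hsize (m : ℕ) : k + (t + 1 - k) ≤ m ↔ t < m ∧ k ≤ m := by omega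
  simpa only [isConnectedTwoClub_iff, hsize, and_assoc, and_left_comm] using
    hC n hn G adj hadj t k isLocal_connectedConflict

theorem one_le_maxDegreeBound {n : ℕ} (hn : 0 < n) (G : SimpleGraph (Fin n)) :
    1 ≤ maxDegreeBound n G :=
  one_le_mul_of_one_le_of_one_le (one_le_pow₀ (by norm_num)) (by exact_mod_cast hn)

theorem exists_conflictFree_robust_zero_iff {n k : ℕ} {G : SimpleGraph (Fin n)} :
    (∃ S, ConflictFree (RobustConflict G 0) S ∧ k ≤ S.card) ↔ k < n + 1 := by
  refine ⟨fun ⟨S, _, hS⟩ => ?_, fun hk => ⟨.univ, fun u _ w _ _ => ?_, ?_⟩⟩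
  · exact Nat.lt_succ_of_le (hS.trans (by simpa using S.card_le_univ))
  · simp [RobustConflict]
  · simpa using Nat.le_of_lt_succ hk

theorem solvableInTime_robust :
    SolvableInTime (fun _ G t S => IsRobustTwoClub G t S) maxDegreeBound := by
  obtain ⟨C, hC⟩ := exists_exec_solve decidesConflict_robustConf persistent_robustConflict
    (reg threshold) (fun _ k => k) (fun _ => rfl) fun t k => by omega
  -- Conflicts are not local for `t = 0`, but then every set is a `t`-robust 2-club.
  refine solvableInTime_of_exec (.cond (reg param) (solve (reg threshold) robustConf)
    (answer ::= reg threshold <ₑ reg order + 1)) 8 (|C| + 8) fun n hn G adj hadj t k => ?_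
  have hbound := one_le_maxDegreeBound hn G
  simp only [isRobustTwoClub_iff]
  rcases eq_or_ne t 0 with rfl | ht
  · rw [exists_conflictFree_robust_zero_iff]
    have hle : Expr.eval (inputState adj 0 k) (reg threshold <ₑ reg order + 1) ≤ 1 := by
      change ite _ _ _ ≤ 1
      split_ifs <;> omega
    refine ⟨_, _, .cond_false rfl (.assign _ _ _ (hle.trans (Nat.one_le_pow _ _ (by omega)))), ?_,
      by simpa using hle, by simp [inputState]⟩
    have htime : ((1 + 1 + (5 + 1) : ℕ) : ℝ) ≤ |C| + 8 := by norm_num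
    exact htime.trans (le_mul_of_one_le_right (by positivity) hbound)
  · obtain ⟨T, s, hexec, hT, hanswer⟩ := hC n hn G adj hadj t k (isLocal_robustConflict ht)
    refine ⟨_, s, .cond_true (by simpa [inputState] using ht) hexec, ?_, hanswer⟩
    calc ((1 + 1 + T : ℕ) : ℝ) ≤ 2 + C * maxDegreeBound n G := by push_cast; linarith
      _ ≤ (|C| + 8) * maxDegreeBound n G := by nlinarith [le_abs_self C]

end TwoClub

theorem mainTheorem8 :
    SolvableInTime (fun _ G t S => IsRobustTwoClub G t S) maxDegreeBound ∧
    SolvableInTime (fun _ G t S => IsHereditaryTwoClub G t S) maxDegreeBound ∧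
    SolvableInTime (fun _ G t S => IsConnectedTwoClub G t S) maxDegreeBound :=
  ⟨TwoClub.solvableInTime_robust, TwoClub.solvableInTime_hereditary,
    TwoClub.solvableInTime_connected⟩
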